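/- Let $-0.095<\alpha<0$ and let $\mu$ be a probability measure on $\mathbb{C}$ that is invariant under rotations about $0$, is supported on the closed unit disk, and satisfies the following: for some $\varepsilon\in(0,1]$, $\mu$ has a density $f_\mu$ with respect to Lebesgue measure on $\{1-\varepsilon\le|z|\le1\}$, and there are constants $c_\mu,C_\mu>0$ such that the radial density $f_R(r):=2\pi r f_\mu(re^{\sqrt{-1}\theta})$ (which does not depend on $\theta$) satisfies $c_\mu\le f_R(r)/(1-r)^\alpha\le C_\mu$ for $1-\varepsilon\le r<1$. Let $X_1,X_2,\dots$ be i.i.d. random variables with law $\mu$, and let $p_n(z):=\prod_{j=1}^n(z-X_j)$. Critical points of $p_n$ are the roots of $p_n'$. Let $\ell_n$ be positive integers with $\ell_n\to\infty$ and $\ell_n<\sqrt{\log n}$ for all large $n$, and let $\delta\in(0,-\alpha)$. Write $X^\downarrow_{(1)},\dots,X^\downarrow_{(n)}$ for $X_1,\dots,X_n$ listed in order of decreasing modulus (ties being broken by decreasing principal argument in $(-\pi,\pi]$), and $W^\downarrow_{(1)},\dots,W^\downarrow_{(n-1)}$ for the critical points of $p_n$, with multiplicity, listed in order of decreasing modulus.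 Put $\mathcal{A}_n^-:=\{z\in\mathbb{C}:1-\ell_n/n\le|z|\le1\}$. Then there is a constant $C>0$ such that, with probability $1-O(1/\ell_n)$ as $n\to\infty$, all of the following hold. (i) There are at least $n^\delta$ (distinct) critical points of $p_n$ in $\mathcal{A}_n^-$. (ii) For each $i\in\{1,\dots,n\}$ with $X_i\in\mathcal{A}_n^-$ there is precisely one critical point $W_i^{(n)}$ of $p_n$, counted with multiplicity, within distance $3/n$ of $X_i$, and $$\left|W_i^{(n)}-X_i+\frac1n\,\frac{1}{\frac1{n-1}\sum_{j\ne i}\frac1{X_i-X_j}}\right|<C\,\ell_n\,n^{-\frac{5\alpha+3}{2(\alpha+1)}},\qquad \left|W_i^{(n)}-X_i\left(1-\tfrac1n\right)\right|<C\left(\frac1{\ell_n^4n}\right)^{1/(\alpha+1)}.$$ (iii) There is an injection $\iota$ from the set of critical points of $p_n$ in $\mathcal{A}_n^-$ to $\{1,\dots,n\}$ such that each critical point $W\in\mathcal{A}_n^-$ satisfies $X_{\iota(W)}\in\mathcal{A}_n^-$, $$W=X_{\iota(W)}\left(1-\tfrac1n+o\left(\tfrac1n\right)\right)\quad\text{and}\quad\left|W-X_{\iota(W)}\left(1-\tfrac1n\right)\right|<C\left(\frac1{\ell_n^4n}\right)^{1/(\alpha+1)},$$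 where the $o(1/n)$ term is bounded by a deterministic sequence that is $o(1/n)$ and does not depend on $W$, and where $\iota(W)$ is the only index of a root in $\mathcal{A}_n^-$ for which the last inequality holds. (iv) For $1\le i\le\ell_n$, $$1-\left(\frac{\ell_n^2}{n}\right)^{\frac1{\alpha+1}}\le\left|X^\downarrow_{(i)}\right|\le1-\left(\frac1{n\ell_n}\right)^{\frac1{\alpha+1}},\qquad\left|W^\downarrow_{(i)}-X^\downarrow_{(i)}\left(1-\tfrac1n\right)\right|<C\left(\frac1{\ell_n^4n}\right)^{1/(\alpha+1)},$$ $$\left|W^\downarrow_{(i)}-X^\downarrow_{(i)}+\frac1n\,\frac1{\frac1{n-1}\sum_{j\ne i}\frac1{X^\downarrow_{(i)}-X^\downarrow_{(j)}}}\right|<C\,\ell_n\,n^{-\frac{5\alpha+3}{2(\alpha+1)}},$$ and $W^\downarrow_{(i)}$ is the unique critical point of $p_n$, counted with multiplicity, within distance $3/n$ of $X^\downarrow_{(i)}$. -/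

import Mathlib

open Filter MeasureTheory ProbabilityTheory Asymptotics
open scoped Topology

noncomputable section

/-- The closed annulus `{z : 1 - t ≤ |z| ≤ 1}` of width `t` at the edge of the unit disk. -/
def edgeAnnulus (t : ℝ) : Set ℂ := {z | 1 - t ≤ ‖z‖ ∧ ‖z‖ ≤ 1}

/-- `μ` is a radially symmetric probability distribution supported on the closed unit disk which
has a density `f` with respect to Lebesgue measure on some annulus `{1 - ε ≤ |z| ≤ 1}`, such that
the radial density `fR r = 2 π r f (r e^{iθ})` is comparable to `(1 - r) ^ α`.
The two-sided bound is asked for `r < 1`, where `(1 - r) ^ α` is a positive real number also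
for negative `α`. -/
structure RadialEdgeLaw (μ : Measure ℂ) (α : ℝ) : Prop where
  isProbability : IsProbabilityMeasure μ
  rotation_invariant : ∀ u : ℂ, ‖u‖ = 1 → μ.map (fun z => u * z) = μ
  supported : μ (Metric.closedBall (0 : ℂ) 1)ᶜ = 0
  alpha_gt : -1 < α
  density : ∃ ε : ℝ, 0 < ε ∧ ε ≤ 1 ∧ ∃ f : ℂ → ℝ, Measurable f ∧
    μ.restrict (edgeAnnulus ε) =
      (volume.restrict (edgeAnnulus ε)).withDensity (fun z => ENNReal.ofReal (f z)) ∧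
    ∃ fR : ℝ → ℝ,
      (∀ r θ : ℝ, 1 - ε ≤ r → r ≤ 1 →
        fR r = 2 * Real.pi * r * f (r * Complex.exp (θ * Complex.I))) ∧
      ∃ c C : ℝ, 0 < c ∧ 0 < C ∧
        ∀ r : ℝ, 1 - ε ≤ r → r < 1 → c ≤ fR r / (1 - r) ^ α ∧ fR r / (1 - r) ^ α ≤ C

/-- The monic polynomial `∏ i, (z - x i)` with the given roots. -/
def rootPoly {n : ℕ} (x : Fin n → ℂ) : Polynomial ℂ :=
  ∏ i, (Polynomial.X - Polynomial.C (x i))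

/-- The critical points of `∏ i, (z - x i)`: the roots of its derivative, with multiplicity. -/
def critPts {n : ℕ} (x : Fin n → ℂ) : Multiset ℂ :=
  (Polynomial.derivative (rootPoly x)).roots

/-- The correction `(1 / n) * 1 / ((1 / (n - 1)) * ∑ j ≠ i, 1 / (x i - x j))`. -/
def rootShift {n : ℕ} (x : Fin n → ℂ) (i : Fin n) : ℂ :=
  1 / (n : ℂ) * (1 / (1 / ((n : ℂ) - 1) * ∑ j ∈ Finset.univ.erase i, 1 / (x i - x j)))

/-- The position of `z` in the spiral order on `ℂ`: first by modulus, then by argument in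
`(-π, π]`. (Here `Complex.arg 0 = 0`, and `0` is the smallest element.) -/
def spiralKey (z : ℂ) : ℝ ×ₗ ℝ := toLex (‖z‖, Complex.arg z)

/-- The order statistics `X↓`, i.e. the entries of `x` listed in decreasing spiral order, so
that `descending x 0` is the largest entry and `descending x k` is the `(k + 1)`-st largest. -/
def descending {n : ℕ} (x : Fin n → ℂ) (k : Fin n) : ℂ :=
  x (Tuple.sort (fun i => spiralKey (x i)) (Fin.rev k))

/-- `W` lists all critical points of `∏ i, (z - x i)`, with multiplicity, in order of decreasing
modulus (ties in any order). -/
def IsCritListing {n : ℕ} (x : Fin n → ℂ) (W : Fin (n - 1) → ℂ) : Prop :=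
  Finset.univ.val.map W = critPts x ∧ Antitone (fun k => ‖W k‖)

end

/-! Write `S_i(z)` for the sum of `1 / (z - x j)` over `j ≠ i`. Near `x i` the critical points solve
`z = x i - 1 / S_i(z)`. By rotation invariance the Cauchy transform of `μ` on `|z| > 1` is `1 / z`,
so one expects `S_i(z) ≈ n / z`, hence `z ≈ x i (1 - 1/n)`. The proof makes this uniform in an
annulus of width `τ = n ^ (-2/3)` around the unit circle.

Probability. On the circle `|z| = 1 + τ` the Cauchy sum expands in the power sums of the roots.
These are centred by rotation invariance, and pairwise independence gives their second moments. One
weighted sum of their squares, `powerEnergy`, bounds the deviation from `n / z` at all points of the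
circle simultaneously, so no net is needed (`norm_cauchy_sub_le`). The same bound with a radial
weight controls the Poisson sum `∑ τ / |z - x j| ^ 2` (`sum_div_norm_sq_le`). Roots closer than `8
τ` are handled by a first-moment bound for `1 / |x i - x j|`, based on the estimate `O(s ^ (α + 2))`
for the mass of a ball of radius `s` near the circle.

Determinism. For a configuration satisfying these bounds (`EdgeRegular`), moving from the circle
into the annulus costs a multiple of the Poisson sum for distant roots and the pair sum for close
ones, so `|S_i(z) - n / z| ≤ 12 ε₁ n`. The map `z ↦ x i - 1 / S_i(z)` is then a contraction of the
ball of radius `3 / n`, and a second-derivative estimate makes its fixed point a simple critical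
point (`exists_critPt`). Conversely, a critical point in the annulus is paired with its nearest root
(`exists_root_of_mem_critPts`). When the moduli of the top roots are separated by more than eight
times the approximation error `t`, the critical points inherit the order of the roots
(`listing_near`).

Parameters. Take `ε₁ = n ^ (-(1/6 + α/2))` and `ε₃ = n ^ (-(1/4 + α/2))`. Separation of scales
requires `ε₁ / n` to be smaller than `(ℓ ^ 4 n) ^ (-1/(α+1))`, that is `(α + 1)(7/6 + α/2) > 1`,
true for `α ≥ -0.103`. The pair sum requires `α > -1/10`. Both follow from `α > -0.095`. The failure
bound of order `1 / ℓ` comes from the largest modulus; the order-statistics count and the gaps fail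
with probability `O(1 / ℓ ^ 2)`, and the other events with probability bounded by negative powers of
`n`. -/

open scoped ENNReal

/-! ### Masses of thin shells -/

/-- The mass of a thin annulus near the unit circle in polar coordinates. -/
theorem lintegral_annulus_eq {f : ℂ → ℝ} (hf : Measurable f) {ε : ℝ} (hε1 : ε ≤ 1) {fR : ℝ → ℝ}
    (hfR : ∀ r θ : ℝ, 1 - ε ≤ r → r ≤ 1 →
        fR r = 2 * Real.pi * r * f (r * Complex.exp (θ * Complex.I)))
    {u v : ℝ} (hu : 1 - ε ≤ u) (hv : v ≤ 1) :
    ∫⁻ z in {z : ℂ | u ≤ ‖z‖ ∧ ‖z‖ ≤ v}, ENNReal.ofReal (f z) =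
      ∫⁻ r in Set.Ioc u v, ENNReal.ofReal (fR r) := by
  have hms : MeasurableSet {z : ℂ | u ≤ ‖z‖ ∧ ‖z‖ ≤ v} :=
    (measurableSet_le measurable_const measurable_norm).inter
      (measurableSet_le measurable_norm measurable_const)
  rw [← lintegral_indicator hms, ← Complex.lintegral_comp_polarCoord_symm,
    polarCoord_target, Measure.volume_eq_prod]
  have hmeas : Measurable fun p : ℝ × ℝ => ENNReal.ofReal p.1 •
      ({z : ℂ | u ≤ ‖z‖ ∧ ‖z‖ ≤ v}.indicator (fun z => ENNReal.ofReal (f z))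
        (Complex.polarCoord.symm p)) := by
    simp only [Complex.polarCoord_symm_apply]
    refine (ENNReal.measurable_ofReal.comp measurable_fst).smul ?_
    exact ((ENNReal.measurable_ofReal.comp hf).indicator hms).comp (by fun_prop)
  rw [setLIntegral_prod _ hmeas.aemeasurable]
  have hu0 : 0 ≤ u := by linarith
  have key : ∀ r ∈ Set.Ioi (0:ℝ), ∫⁻ θ in Set.Ioo (-Real.pi) Real.pi, ENNReal.ofReal r •
      ({z : ℂ | u ≤ ‖z‖ ∧ ‖z‖ ≤ v}.indicator (fun z => ENNReal.ofReal (f z))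
        (Complex.polarCoord.symm (r, θ))) =
      (Set.Icc u v).indicator (fun r => ENNReal.ofReal (fR r)) r := by
    intro r hr
    have hr0 : (0:ℝ) < r := hr
    by_cases hruv : u ≤ r ∧ r ≤ v
    · have hind : r ∈ Set.Icc u v := hruv
      rw [Set.indicator_of_mem hind]
      have : ∀ θ : ℝ, ENNReal.ofReal r •
        ({z : ℂ | u ≤ ‖z‖ ∧ ‖z‖ ≤ v}.indicator (fun z => ENNReal.ofReal (f z))
          (Complex.polarCoord.symm (r, θ))) = ENNReal.ofReal (fR r / (2 * Real.pi)) := by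
        intro θ
        have hmem : Complex.polarCoord.symm (r, θ) ∈ {z : ℂ | u ≤ ‖z‖ ∧ ‖z‖ ≤ v} := by
          simp only [Set.mem_ofPred_eq, Complex.norm_polarCoord_symm, abs_of_pos hr0]
          exact hruv
        rw [Set.indicator_of_mem hmem, smul_eq_mul, ← ENNReal.ofReal_mul hr0.le,
          Complex.polarCoord_symm_apply, hfR r θ (by linarith [hruv.1]) (by linarith [hruv.2]),
          Complex.exp_mul_I]
        congr 1
        have := Real.pi_pos
        field_simp
        push_cast
        rw [mul_comm (Complex.sin _)]
      simp only [this]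
      rw [setLIntegral_const, Real.volume_Ioo, ← ENNReal.ofReal_mul']
      · congr 1
        have := Real.pi_pos
        field_simp
        ring
      · linarith [Real.pi_pos]
    · have hind : r ∉ Set.Icc u v := hruv
      rw [Set.indicator_of_notMem hind]
      have : ∀ θ : ℝ, ENNReal.ofReal r •
        ({z : ℂ | u ≤ ‖z‖ ∧ ‖z‖ ≤ v}.indicator (fun z => ENNReal.ofReal (f z))
          (Complex.polarCoord.symm (r, θ))) = 0 := by
        intro θ
        have hmem : Complex.polarCoord.symm (r, θ) ∉ {z : ℂ | u ≤ ‖z‖ ∧ ‖z‖ ≤ v} := by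
          simp only [Set.mem_ofPred_eq, Complex.norm_polarCoord_symm, abs_of_pos hr0]
          exact hruv
        rw [Set.indicator_of_notMem hmem, smul_zero]
      rw [lintegral_congr this, lintegral_zero]
  rw [setLIntegral_congr_fun measurableSet_Ioi key, lintegral_indicator measurableSet_Icc,
    Measure.restrict_restrict measurableSet_Icc]
  refine setLIntegral_congr ?_
  have h1 : Set.Ioc u v ⊆ Set.Icc u v ∩ Set.Ioi 0 := fun r hr =>
    ⟨⟨hr.1.le, hr.2⟩, lt_of_le_of_lt hu0 hr.1⟩
  have h2 : (Set.Icc u v ∩ Set.Ioi 0 : Set ℝ) ⊆ Set.Icc u v := Set.inter_subset_left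
  exact (h2.eventuallyLE.trans (Ioc_ae_eq_Icc (μ := volume) (a := u) (b := v)).symm.le).antisymm
    h1.eventuallyLE

theorem lintegral_one_sub_rpow {α u v : ℝ} (hα : -1 < α) (huv : u ≤ v) (hv : v ≤ 1) :
    ∫⁻ r in Set.Ioc u v, ENNReal.ofReal ((1 - r) ^ α) =
      ENNReal.ofReal (((1 - u) ^ (α + 1) - (1 - v) ^ (α + 1)) / (α + 1)) := by
  have hint : IntervalIntegrable (fun r : ℝ => (1 - r) ^ α) volume u v := by
    have := (intervalIntegral.intervalIntegrable_rpow' (a := 1 - u) (b := 1 - v) hα).comp_sub_left 1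
    simpa using this
  have h := intervalIntegral.integral_comp_sub_left (a := u) (b := v) (fun r : ℝ => r ^ α) 1
  rw [integral_rpow (Or.inl hα)] at h
  rw [← h, intervalIntegral.integral_of_le huv, ofReal_integral_eq_lintegral_ofReal]
  · exact (intervalIntegrable_iff_integrableOn_Ioc_of_le huv).1 hint
  · filter_upwards [ae_restrict_mem measurableSet_Ioc] with r hr
    exact Real.rpow_nonneg (by linarith [hr.2]) _

/-- Upper and lower bounds for the masses of thin annuli. -/
structure RadialMass (μ : Measure ℂ) (α c C ε : ℝ) : Prop where
  c_pos : 0 < c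
  C_pos : 0 < C
  eps_pos : 0 < ε
  eps_le : ε ≤ 1
  upper : ∀ u v : ℝ, 1 - ε ≤ u → u ≤ v → μ {z | u ≤ ‖z‖ ∧ ‖z‖ ≤ v} ≤
    ENNReal.ofReal (C * (v - u) ^ (α + 1))
  lower : ∀ h : ℝ, 0 ≤ h → h ≤ ε → ENNReal.ofReal (c * h ^ (α + 1)) ≤ μ {z | 1 - h ≤ ‖z‖ ∧ ‖z‖ ≤ 1}

/-- Since `0 < α + 1 ≤ 1`, the power `h ^ (α + 1)` is subadditive, so a shell obeys the same upper
bound as one of equal width touching the unit circle. -/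
theorem RadialEdgeLaw.exists_radialMass {μ : Measure ℂ} {α : ℝ} (hμ : RadialEdgeLaw μ α)
    (hα' : α < 0) : ∃ c C ε : ℝ, RadialMass μ α c C ε := by
  obtain ⟨ε, hε, hε1, f, hf, hfμ, fR, hfR, c, C, hc, hC, hb⟩ := hμ.density
  have hα := hμ.alpha_gt
  have hα1 : 0 < α + 1 := by linarith
  have mass : ∀ u v : ℝ, 1 - ε ≤ u → v ≤ 1 → μ {z | u ≤ ‖z‖ ∧ ‖z‖ ≤ v} =
      ∫⁻ r in Set.Ioc u v, ENNReal.ofReal (fR r) := by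
    intro u v hu hv
    have hms : MeasurableSet {z : ℂ | u ≤ ‖z‖ ∧ ‖z‖ ≤ v} :=
      (measurableSet_le measurable_const measurable_norm).inter
        (measurableSet_le measurable_norm measurable_const)
    have hsub : {z : ℂ | u ≤ ‖z‖ ∧ ‖z‖ ≤ v} ⊆ edgeAnnulus ε := fun z hz =>
      ⟨hu.trans hz.1, hz.2.trans hv⟩
    rw [← lintegral_annulus_eq hf hε1 hfR hu hv, ← Measure.restrict_eq_self μ hsub, hfμ,
      withDensity_apply _ hms, Measure.restrict_restrict hms, Set.inter_eq_left.2 hsub]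
  -- The density bounds are assumed only for `r < 1`; the endpoint is a null set.
  have hne : ∀ᵐ r : ℝ, r ≠ 1 := by simp [ae_iff]
  have upper1 : ∀ u v : ℝ, 1 - ε ≤ u → u ≤ v → v ≤ 1 → μ {z | u ≤ ‖z‖ ∧ ‖z‖ ≤ v} ≤
      ENNReal.ofReal (C / (α + 1) * (v - u) ^ (α + 1)) := by
    intro u v hu huv hv
    rw [mass u v hu hv]
    calc ∫⁻ r in Set.Ioc u v, ENNReal.ofReal (fR r)
        ≤ ∫⁻ r in Set.Ioc u v, ENNReal.ofReal C * ENNReal.ofReal ((1 - r) ^ α) := by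
          refine lintegral_mono_ae ?_
          filter_upwards [ae_restrict_mem measurableSet_Ioc, ae_restrict_of_ae hne] with r hr hr1
          have hr1' : r < 1 := lt_of_le_of_ne (hr.2.trans hv) hr1
          rw [← ENNReal.ofReal_mul hC.le]
          exact ENNReal.ofReal_le_ofReal
            ((div_le_iff₀ (Real.rpow_pos_of_pos (by linarith) _)).1 (hb r (by linarith [hr.1]) hr1').2)
      _ = ENNReal.ofReal (C * (((1 - u) ^ (α + 1) - (1 - v) ^ (α + 1)) / (α + 1))) := by
          rw [lintegral_const_mul' _ _ ENNReal.ofReal_ne_top, lintegral_one_sub_rpow hα huv hv,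
            ENNReal.ofReal_mul hC.le]
      _ ≤ _ := by
          refine ENNReal.ofReal_le_ofReal ?_
          have := Real.rpow_add_le_add_rpow (p := α + 1) (a := 1 - v) (b := v - u) (by linarith) (by linarith)
            hα1.le (by linarith)
          rw [show 1 - v + (v - u) = 1 - u by ring] at this
          rw [mul_div_assoc', div_mul_eq_mul_div]
          refine div_le_div_of_nonneg_right ?_ hα1.le
          exact mul_le_mul_of_nonneg_left (by linarith) hC.le
  have hout : μ {z | 1 < ‖z‖} = 0 := by
    have := hμ.supported
    convert this using 2
    ext z; simp
  refine ⟨c / (α + 1), C / (α + 1), ε, by positivity, by positivity, hε, hε1, ?_, ?_⟩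
  · intro u v hu huv
    rcases le_total v 1 with hv | hv
    · exact upper1 u v hu huv hv
    · have hle : μ {z | u ≤ ‖z‖ ∧ ‖z‖ ≤ v} ≤ μ {z | u ≤ ‖z‖ ∧ ‖z‖ ≤ 1} + μ {z | 1 < ‖z‖} := by
        refine (measure_mono ?_).trans (measure_union_le _ _)
        intro z hz
        rcases le_or_gt ‖z‖ 1 with h | h
        · exact Or.inl ⟨hz.1, h⟩
        · exact Or.inr h
      rw [hout, add_zero] at hle
      refine hle.trans ?_
      rcases le_total u 1 with hu1 | hu1
      · refine (upper1 u 1 hu hu1 le_rfl).trans (ENNReal.ofReal_le_ofReal ?_)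
        gcongr
      · refine (measure_mono (t := {z | 1 ≤ ‖z‖ ∧ ‖z‖ ≤ 1}) fun z hz => ⟨hu1.trans hz.1, hz.2⟩).trans ?_
        refine (upper1 1 1 (by linarith) le_rfl le_rfl).trans (ENNReal.ofReal_le_ofReal ?_)
        rw [sub_self, Real.zero_rpow hα1.ne', mul_zero]
        exact mul_nonneg (by positivity) (Real.rpow_nonneg (by linarith) _)
  · intro h h0 hh
    rw [mass _ _ (by linarith) le_rfl]
    calc ENNReal.ofReal (c / (α + 1) * h ^ (α + 1))
        = ENNReal.ofReal c * ∫⁻ r in Set.Ioc (1 - h) 1, ENNReal.ofReal ((1 - r) ^ α) := by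
          rw [lintegral_one_sub_rpow hα (by linarith) le_rfl, ← ENNReal.ofReal_mul hc.le]
          congr 1
          rw [sub_self, Real.zero_rpow hα1.ne']
          ring_nf
      _ = ∫⁻ r in Set.Ioc (1 - h) 1, ENNReal.ofReal c * ENNReal.ofReal ((1 - r) ^ α) := by
          rw [lintegral_const_mul' _ _ ENNReal.ofReal_ne_top]
      _ ≤ _ := by
          refine lintegral_mono_ae ?_
          filter_upwards [ae_restrict_mem measurableSet_Ioc, ae_restrict_of_ae hne] with r hr hr1
          have hr1' : r < 1 := lt_of_le_of_ne hr.2 hr1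
          rw [← ENNReal.ofReal_mul hc.le]
          exact ENNReal.ofReal_le_ofReal
            ((le_div_iff₀ (Real.rpow_pos_of_pos (by linarith) _)).1 (hb r (by linarith [hr.1]) hr1').1)

/-! ### Masses of small balls -/

theorem half_le_norm_exp_sub_exp {a b : ℝ} (hab : |a - b| ≤ 1) :
    |a - b| / 2 ≤ ‖Complex.exp (a * Complex.I) - Complex.exp (b * Complex.I)‖ := by
  have h1 : Complex.exp (a * Complex.I) - Complex.exp (b * Complex.I) =
      Complex.exp (b * Complex.I) * (Complex.exp (Complex.I * ((a - b : ℝ) : ℂ)) - 1) := by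
    rw [mul_sub, ← Complex.exp_add, mul_one]
    congr 2
    push_cast; ring
  rw [h1, norm_mul, Complex.norm_exp_ofReal_mul_I, one_mul, Complex.norm_exp_I_mul_ofReal_sub_one,
    norm_mul, Real.norm_eq_abs, Real.norm_eq_abs, abs_two, Real.abs_sin_eq_sin_abs_of_abs_le_pi]
  · have h2 := Real.mul_le_sin (x := |(a - b) / 2|) (abs_nonneg _)
      (by rw [abs_div, abs_two]; linarith [Real.pi_gt_three])
    rw [abs_div, abs_two] at h2 ⊢
    have h3 : (1:ℝ) / 2 ≤ 2 / Real.pi := by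
      rw [div_le_div_iff₀ two_pos Real.pi_pos]; linarith [Real.pi_le_four]
    nlinarith [abs_nonneg (a - b)]
  · rw [abs_div, abs_two]; linarith [Real.pi_gt_three]

theorem measure_closedBall_rotate {μ : Measure ℂ}
    (hrot : ∀ u : ℂ, ‖u‖ = 1 → μ.map (fun z => u * z) = μ) (x u : ℂ) (hu : ‖u‖ = 1) (s : ℝ) :
    μ (Metric.closedBall (u * x) s) = μ (Metric.closedBall x s) := by
  conv_lhs => rw [← hrot u hu]
  rw [Measure.map_apply (by fun_prop) Metric.isClosed_closedBall.measurableSet]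
  congr 1
  ext z
  simp only [Set.mem_preimage, Metric.mem_closedBall, dist_eq_norm, ← mul_sub, norm_mul, hu, one_mul]

/-- About `1 / (9 s)` rotated copies of the ball are disjoint, have equal mass and lie in one shell
of width `2 s`. Dividing the shell mass by their number gains a factor of order `s`. -/
theorem RadialMass.measure_closedBall_le {μ : Measure ℂ} {α c C ε : ℝ} (hM : RadialMass μ α c C ε)
    (hrot : ∀ u : ℂ, ‖u‖ = 1 → μ.map (fun z => u * z) = μ) (hα : -1 < α) (hα' : α < 0)
    {x : ℂ} {s : ℝ} (hs : 0 < s) (hs1 : s ≤ 1 / 18) (hsε : 1 - ε + s ≤ ‖x‖) (hx : 1 / 2 ≤ ‖x‖) :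
    μ (Metric.closedBall x s) ≤ ENNReal.ofReal (36 * C * s ^ (α + 2)) := by
  -- With angular step `9 s`, the centres are at least `(9 s / 2) ‖x‖ ≥ 9 s / 4 > 2 s` apart. The
  -- total angle stays below `1`, where the chord estimate applies.
  set N : ℕ := ⌊1 / (9 * s)⌋₊ with hN
  have hN1 : (N : ℝ) ≤ 1 / (9 * s) := Nat.floor_le (by positivity)
  have hN2 : 1 / (18 * s) ≤ (N : ℝ) := by
    have := Nat.lt_floor_add_one (1 / (9 * s))
    have h2 : 1 / (9 * s) = 2 * (1 / (18 * s)) := by field_simp; norm_num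
    have h3 : 1 ≤ 1 / (18 * s) := by rw [le_div_iff₀ (by positivity)]; linarith
    rw [← hN] at this
    linarith
  let φ : ℕ → ℝ := fun k => k * (9 * s)
  have hdisj : Set.PairwiseDisjoint (↑(Finset.range N))
      (fun k => Metric.closedBall (Complex.exp (φ k * Complex.I) * x) s) := by
    intro k hk l hl hkl
    refine Metric.closedBall_disjoint_closedBall ?_
    rw [dist_eq_norm, ← sub_mul, norm_mul]
    have hk' : k < N := Finset.mem_range.1 hk
    have hl' : l < N := Finset.mem_range.1 hl
    have e : φ k - φ l = ((k : ℝ) - l) * (9 * s) := by simp only [φ]; ring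
    have h1 : (1 : ℝ) ≤ |(k : ℝ) - l| := by
      have : (1 : ℤ) ≤ |(k : ℤ) - l| := Int.one_le_abs (by omega)
      exact_mod_cast this
    have h2 : |(k : ℝ) - l| ≤ N := by
      rw [abs_le]
      have : (k : ℝ) < N := by exact_mod_cast hk'
      have : (l : ℝ) < N := by exact_mod_cast hl'
      have : (0 : ℝ) ≤ k := by positivity
      have : (0 : ℝ) ≤ l := by positivity
      constructor <;> linarith
    have h3 : |φ k - φ l| = |(k : ℝ) - l| * (9 * s) := by
      rw [e, abs_mul, abs_of_pos (by positivity : 0 < 9 * s)]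
    have h4 := half_le_norm_exp_sub_exp (a := φ k) (b := φ l) (by
      rw [h3]
      calc |(k : ℝ) - l| * (9 * s) ≤ 1 / (9 * s) * (9 * s) := by gcongr; exact h2.trans hN1
        _ = 1 := by field_simp)
    rw [h3] at h4
    have h5 : 9 * s / 2 ≤ ‖Complex.exp (φ k * Complex.I) - Complex.exp (φ l * Complex.I)‖ := by
      nlinarith
    nlinarith
  have hsum : (N : ℝ≥0∞) * μ (Metric.closedBall x s) ≤ ENNReal.ofReal (C * (2 * s) ^ (α + 1)) := by
    calc (N : ℝ≥0∞) * μ (Metric.closedBall x s)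
        = ∑ k ∈ Finset.range N, μ (Metric.closedBall (Complex.exp (φ k * Complex.I) * x) s) := by
          rw [Finset.sum_congr rfl fun k _ => measure_closedBall_rotate hrot x _
            (Complex.norm_exp_ofReal_mul_I _) s]
          simp
      _ = μ (⋃ k ∈ Finset.range N, Metric.closedBall (Complex.exp (φ k * Complex.I) * x) s) :=
          (measure_biUnion_finset hdisj fun k _ => Metric.isClosed_closedBall.measurableSet).symm
      _ ≤ μ {z | ‖x‖ - s ≤ ‖z‖ ∧ ‖z‖ ≤ ‖x‖ + s} := by
          refine measure_mono ?_
          intro z hz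
          simp only [Set.mem_iUnion, Metric.mem_closedBall, dist_eq_norm] at hz
          obtain ⟨k, -, hz⟩ := hz
          have hn : ‖Complex.exp (φ k * Complex.I) * x‖ = ‖x‖ := by
            rw [norm_mul, Complex.norm_exp_ofReal_mul_I, one_mul]
          have := abs_le.1 ((abs_norm_sub_norm_le z (Complex.exp (φ k * Complex.I) * x)).trans hz)
          rw [hn] at this
          exact ⟨by linarith [this.1], by linarith [this.2]⟩
      _ ≤ _ := by
          refine (hM.upper _ _ (by linarith) (by linarith)).trans (le_of_eq ?_)
          congr 3
          ring
  have hNpos : (0 : ℝ) < N := lt_of_lt_of_le (by positivity) hN2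
  have hC := hM.C_pos
  calc μ (Metric.closedBall x s)
      ≤ ENNReal.ofReal (C * (2 * s) ^ (α + 1)) / (N : ℝ≥0∞) := by
        rw [ENNReal.le_div_iff_mul_le (Or.inl (by exact_mod_cast hNpos.ne'))
          (Or.inl (ENNReal.natCast_ne_top N)), mul_comm]
        exact hsum
    _ = ENNReal.ofReal (C * (2 * s) ^ (α + 1) / N) := by
        rw [ENNReal.ofReal_div_of_pos hNpos, ENNReal.ofReal_natCast]
    _ ≤ _ := by
        refine ENNReal.ofReal_le_ofReal ?_
        rw [div_le_iff₀ hNpos]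
        have h2 : (2 : ℝ) ^ (α + 1) ≤ 2 := by
          calc (2 : ℝ) ^ (α + 1) ≤ 2 ^ (1 : ℝ) :=
                Real.rpow_le_rpow_of_exponent_le (by norm_num) (by linarith)
            _ = 2 := Real.rpow_one 2
        have e1 : s ^ (α + 2) = s ^ (α + 1) * s := by
          rw [show α + 2 = α + 1 + 1 by ring, Real.rpow_add_one hs.ne']
        rw [Real.mul_rpow zero_le_two hs.le, e1]
        have hp : 0 < s ^ (α + 1) := Real.rpow_pos_of_pos hs _
        have h18 : 1 ≤ 18 * s * N := by
          have := (div_le_iff₀ (by positivity : 0 < 18 * s)).1 hN2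
          linarith
        calc C * (2 ^ (α + 1) * s ^ (α + 1)) ≤ C * (2 * s ^ (α + 1)) * 1 := by
              rw [mul_one]; gcongr
          _ ≤ C * (2 * s ^ (α + 1)) * (18 * s * N) := by gcongr
          _ = _ := by ring

/-! ### Dyadic estimates for singular integrals -/

theorem tsum_ofReal_mul_pow {A r : ℝ} (hA : 0 ≤ A) (hr : 0 ≤ r) (hr1 : r < 1) :
    ∑' k : ℕ, ENNReal.ofReal (A * r ^ k) = ENNReal.ofReal (A / (1 - r)) := by
  rw [← ENNReal.ofReal_tsum_of_nonneg (fun k => by positivity)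
    ((summable_geometric_of_lt_one hr hr1).mul_left A), tsum_mul_left,
    tsum_geometric_of_lt_one hr hr1, div_eq_mul_inv]

/-- The interaction kernel `1 / |x - y|`, restricted to distances at most `t`. -/
noncomputable def nearKernel (t : ℝ) (x y : ℂ) : ℝ≥0∞ :=
  Set.indicator {p : ℂ × ℂ | ‖p.1 - p.2‖ ≤ t} (fun p => ‖p.1 - p.2‖ₑ⁻¹) (x, y)

theorem measurable_nearKernel (t : ℝ) : Measurable fun p : ℂ × ℂ => nearKernel t p.1 p.2 := by
  unfold nearKernel
  refine Measurable.indicator (by fun_prop) ?_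
  exact measurableSet_le (by fun_prop) measurable_const

theorem nearKernel_le_tsum {t : ℝ} (ht : 0 < t) (x y : ℂ) :
    nearKernel t x y ≤ ∑' k : ℕ, ENNReal.ofReal (2 ^ (k + 1) / t) *
      (Metric.closedBall x (t / 2 ^ k)).indicator 1 y := by
  unfold nearKernel
  by_cases hxy : (x, y) ∈ {p : ℂ × ℂ | ‖p.1 - p.2‖ ≤ t}
  swap
  · rw [Set.indicator_of_notMem hxy]; exact zero_le
  rw [Set.indicator_of_mem hxy]
  have hle : ‖x - y‖ ≤ t := hxy
  rcases eq_or_ne x y with rfl | hne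
  -- On the diagonal the kernel is `⊤`, so the dyadic series has to diverge as well.
  · refine le_top.trans (le_of_eq ?_)
    symm
    rw [eq_top_iff]
    calc (⊤ : ℝ≥0∞) = ∑' _ : ℕ, ENNReal.ofReal (1 / t) :=
          (ENNReal.tsum_const_eq_top_of_ne_zero (by simpa using ht)).symm
      _ ≤ _ := by
          refine ENNReal.tsum_le_tsum fun k => ?_
          rw [Set.indicator_of_mem (Metric.mem_closedBall_self (by positivity)), Pi.one_apply, mul_one]
          refine ENNReal.ofReal_le_ofReal ?_
          gcongr
          exact one_le_pow₀ (by norm_num)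
  · have hd : 0 < ‖x - y‖ := norm_pos_iff.2 (sub_ne_zero.2 hne)
    obtain ⟨k, hk1, hk2⟩ := exists_nat_pow_near (x := t / ‖x - y‖) (y := (2 : ℝ))
      (by rw [le_div_iff₀ hd]; linarith) (by norm_num)
    refine le_trans ?_ (ENNReal.le_tsum k)
    have hy : y ∈ Metric.closedBall x (t / 2 ^ k) := by
      rw [Metric.mem_closedBall, dist_comm, dist_eq_norm, le_div_iff₀ (by positivity)]
      rw [le_div_iff₀ hd] at hk1
      linarith
    rw [Set.indicator_of_mem hy, Pi.one_apply, mul_one, ← ofReal_norm,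
      ← ENNReal.ofReal_inv_of_pos hd]
    refine ENNReal.ofReal_le_ofReal ?_
    rw [div_lt_iff₀ hd] at hk2
    rw [inv_le_comm₀ hd (by positivity), inv_div, div_le_iff₀ (by positivity)]
    linarith

/-- The ball of radius `t / 2 ^ k` contributes a multiple of `(2 ^ k / t) (t / 2 ^ k) ^ (α + 2)`: a
geometric series of ratio `2 ^ (-(α + 1)) < 1`. -/
theorem RadialMass.lintegral_nearKernel_le {μ : Measure ℂ} {α c C ε : ℝ} (hM : RadialMass μ α c C ε)
    (hrot : ∀ u : ℂ, ‖u‖ = 1 → μ.map (fun z => u * z) = μ) (hα : -1 < α) (hα' : α < 0)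
    {x : ℂ} {t : ℝ} (ht : 0 < t) (ht1 : t ≤ 1 / 18) (htε : 1 - ε + t ≤ ‖x‖) (hx : 1 / 2 ≤ ‖x‖) :
    ∫⁻ y, nearKernel t x y ∂μ ≤
      ENNReal.ofReal (72 * C / (1 - 2 ^ (-(α + 1))) * t ^ (α + 1)) := by
  have hC := hM.C_pos
  have hr1 : (2 : ℝ) ^ (-(α + 1)) < 1 := Real.rpow_lt_one_of_one_lt_of_neg (by norm_num) (by linarith)
  calc ∫⁻ y, nearKernel t x y ∂μ
      ≤ ∫⁻ y, ∑' k : ℕ, ENNReal.ofReal (2 ^ (k + 1) / t) *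
          (Metric.closedBall x (t / 2 ^ k)).indicator 1 y ∂μ :=
        lintegral_mono fun y => nearKernel_le_tsum ht x y
    _ = ∑' k : ℕ, ENNReal.ofReal (2 ^ (k + 1) / t) * μ (Metric.closedBall x (t / 2 ^ k)) := by
        rw [lintegral_tsum fun k => ((measurable_one.indicator
          Metric.isClosed_closedBall.measurableSet).const_mul _).aemeasurable]
        congr 1
        ext k
        rw [lintegral_const_mul _ (measurable_one.indicator
          Metric.isClosed_closedBall.measurableSet), lintegral_indicator_one
          Metric.isClosed_closedBall.measurableSet]
    _ ≤ ∑' k : ℕ, ENNReal.ofReal (72 * C * t ^ (α + 1) * (2 ^ (-(α + 1))) ^ k) := by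
        refine ENNReal.tsum_le_tsum fun k => ?_
        have h2k : (1 : ℝ) ≤ 2 ^ k := one_le_pow₀ (by norm_num)
        have hsle : t / 2 ^ k ≤ t := div_le_self ht.le h2k
        have := hM.measure_closedBall_le hrot hα hα' (x := x) (s := t / 2 ^ k) (by positivity)
          (hsle.trans ht1) (by linarith) hx
        refine (mul_le_mul_right this _).trans (le_of_eq ?_)
        rw [← ENNReal.ofReal_mul (by positivity)]
        congr 1
        have hs : 0 < t / 2 ^ k := by positivity
        rw [show α + 2 = α + 1 + 1 by ring, Real.rpow_add_one hs.ne',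
          Real.div_rpow ht.le (by positivity), Real.rpow_neg zero_le_two, inv_pow,
          ← Real.rpow_natCast (2 ^ (α + 1)) k, ← Real.rpow_natCast 2 k, ← Real.rpow_mul zero_le_two,
          ← Real.rpow_mul zero_le_two, mul_comm (α + 1) (k : ℝ), Real.rpow_natCast]
        field_simp
        norm_num [pow_succ]
        ring
    _ = _ := by
        rw [tsum_ofReal_mul_pow (by positivity) (by positivity) hr1]
        congr 1
        ring

theorem RadialMass.exists_tail_le {μ : Measure ℂ} [IsProbabilityMeasure μ] {α c C ε : ℝ}
    (hM : RadialMass μ α c C ε) (hsupp : μ (Metric.closedBall (0 : ℂ) 1)ᶜ = 0)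
    (hα : -1 < α) :
    ∃ K : ℝ, 0 < K ∧ ∀ h : ℝ, 0 ≤ h → μ {z | 1 - h ≤ ‖z‖} ≤ ENNReal.ofReal (K * h ^ (α + 1)) := by
  have hε := hM.eps_pos
  have hC := hM.C_pos
  -- The second summand makes the bound at least `1` once `h ≥ ε`, where nothing is known about the
  -- density.
  refine ⟨C + ε ^ (-(α + 1)), by positivity, fun h h0 => ?_⟩
  have hp : 0 ≤ h ^ (α + 1) := Real.rpow_nonneg h0 _
  rcases le_total h ε with hh | hh
  · have hle : μ {z | 1 - h ≤ ‖z‖} ≤ μ {z | 1 - h ≤ ‖z‖ ∧ ‖z‖ ≤ 1} +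
        μ (Metric.closedBall (0 : ℂ) 1)ᶜ := by
      refine (measure_mono ?_).trans (measure_union_le _ _)
      intro z hz
      rcases le_or_gt ‖z‖ 1 with h | h
      · exact Or.inl ⟨hz, h⟩
      · exact Or.inr (by simpa using h)
    rw [hsupp, add_zero] at hle
    refine hle.trans ((hM.upper _ _ (by linarith) (by linarith)).trans
      (ENNReal.ofReal_le_ofReal ?_))
    rw [sub_sub_cancel]
    have : 0 ≤ ε ^ (-(α + 1)) := by positivity
    nlinarith
  · refine prob_le_one.trans ?_
    rw [ENNReal.one_le_ofReal]
    have h1 : 1 ≤ ε ^ (-(α + 1)) * h ^ (α + 1) := by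
      rw [Real.rpow_neg hε.le, ← div_eq_inv_mul, one_le_div (by positivity)]
      exact Real.rpow_le_rpow hε.le hh (by linarith)
    nlinarith

/-- At distance about `2 ^ k τ` from the circle the integrand is at most `2 ^ (-k)`, while the mass
is at most a multiple of `(2 ^ k τ) ^ (α + 1)`. The ratio of the resulting series is `2 ^ α`, and `α
< 0` makes it converge. -/
theorem lintegral_edge_le {μ : Measure ℂ} {α K : ℝ} (hK : 0 < K)
    (htail : ∀ h : ℝ, 0 ≤ h → μ {z | 1 - h ≤ ‖z‖} ≤ ENNReal.ofReal (K * h ^ (α + 1)))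
    (hsupp : μ (Metric.closedBall (0 : ℂ) 1)ᶜ = 0)
    (hα' : α < 0) {τ : ℝ} (hτ : 0 < τ) :
    ∫⁻ z, ENNReal.ofReal (τ / (τ + 1 - ‖z‖)) ∂μ ≤
      ENNReal.ofReal (2 * K / (1 - 2 ^ α) * τ ^ (α + 1)) := by
  have hr1 : (2 : ℝ) ^ α < 1 := Real.rpow_lt_one_of_one_lt_of_neg (by norm_num) (by linarith)
  have hms : ∀ h : ℝ, MeasurableSet {z : ℂ | 1 - h ≤ ‖z‖} := fun h =>
    measurableSet_le measurable_const measurable_norm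
  have hae : ∀ᵐ z ∂μ, ‖z‖ ≤ 1 := by
    rw [ae_iff]; convert hsupp using 2; ext z; simp
  calc ∫⁻ z, ENNReal.ofReal (τ / (τ + 1 - ‖z‖)) ∂μ
      ≤ ∫⁻ z, ∑' k : ℕ, ENNReal.ofReal ((1 / 2) ^ k) *
          {z : ℂ | 1 - 2 ^ (k + 1) * τ ≤ ‖z‖}.indicator 1 z ∂μ := by
        refine lintegral_mono_ae ?_
        filter_upwards [hae] with z hz
        rcases lt_or_ge (1 - ‖z‖) τ with hd | hd
        · refine le_trans ?_ (ENNReal.le_tsum 0)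
          rw [Set.indicator_of_mem (by simp only [Set.mem_ofPred_eq]; norm_num; linarith)]
          simp only [pow_zero, Pi.one_apply, mul_one, ENNReal.ofReal_one, ENNReal.ofReal_le_one]
          rw [div_le_one (by linarith)]; linarith
        · have hd0 : 0 < 1 - ‖z‖ := by linarith
          obtain ⟨k, hk1, hk2⟩ := exists_nat_pow_near (x := (1 - ‖z‖) / τ) (y := (2 : ℝ))
            (by rw [le_div_iff₀ hτ]; linarith) (by norm_num)
          rw [le_div_iff₀ hτ] at hk1
          rw [div_lt_iff₀ hτ] at hk2
          refine le_trans ?_ (ENNReal.le_tsum k)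
          rw [Set.indicator_of_mem (by simp only [Set.mem_ofPred_eq]; linarith), Pi.one_apply, mul_one]
          refine ENNReal.ofReal_le_ofReal ?_
          rw [one_div, inv_pow, div_le_iff₀ (by linarith), ← div_eq_inv_mul, le_div_iff₀ (by positivity)]
          linarith
    _ = ∑' k : ℕ, ENNReal.ofReal ((1 / 2) ^ k) * μ {z : ℂ | 1 - 2 ^ (k + 1) * τ ≤ ‖z‖} := by
        rw [lintegral_tsum fun k => ((measurable_one.indicator (hms _)).const_mul _).aemeasurable]
        congr 1
        ext k
        rw [lintegral_const_mul _ (measurable_one.indicator (hms _)), lintegral_indicator_one (hms _)]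
    _ ≤ ∑' k : ℕ, ENNReal.ofReal (2 * K * τ ^ (α + 1) * (2 ^ α) ^ k) := by
        refine ENNReal.tsum_le_tsum fun k => ?_
        refine (mul_le_mul_right (htail _ (by positivity)) _).trans ?_
        rw [← ENNReal.ofReal_mul (by positivity)]
        refine ENNReal.ofReal_le_ofReal ?_
        have e2 : ((2 : ℝ) ^ (k + 1)) ^ (α + 1) = 2 ^ (α + 1) * (2 ^ α) ^ k * 2 ^ k := by
          rw [← Real.rpow_natCast 2 (k + 1), ← Real.rpow_natCast (2 ^ α) k, ← Real.rpow_natCast 2 k,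
            ← Real.rpow_mul zero_le_two, ← Real.rpow_mul zero_le_two,
            ← Real.rpow_add two_pos, ← Real.rpow_add two_pos]
          congr 1
          push_cast
          ring
        have h2 : (2 : ℝ) ^ (α + 1) ≤ 2 := by
          calc (2 : ℝ) ^ (α + 1) ≤ 2 ^ (1 : ℝ) :=
                Real.rpow_le_rpow_of_exponent_le (by norm_num) (by linarith)
            _ = 2 := Real.rpow_one 2
        rw [Real.mul_rpow (by positivity) hτ.le, e2]
        have e3 : (1 / 2 : ℝ) ^ k * 2 ^ k = 1 := by rw [← mul_pow]; norm_num
        calc (1 / 2 : ℝ) ^ k * (K * (2 ^ (α + 1) * (2 ^ α) ^ k * 2 ^ k * τ ^ (α + 1)))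
            = ((1 / 2 : ℝ) ^ k * 2 ^ k) * (2 ^ (α + 1) * (K * τ ^ (α + 1) * (2 ^ α) ^ k)) := by ring
          _ ≤ 1 * (2 * (K * τ ^ (α + 1) * (2 ^ α) ^ k)) := by rw [e3]; gcongr
          _ = _ := by ring
    _ = _ := by
        rw [tsum_ofReal_mul_pow (by positivity) (by positivity) hr1]
        congr 1
        ring

/-! ### Second moments of weighted power sums -/

section Moments

variable {Ω : Type*} [MeasurableSpace Ω] {P : Measure Ω} {μ : Measure ℂ}
  {ι : Type*} [Fintype ι] {X : ι → Ω → ℂ}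

theorem variance_sum_comp (hlaw : ∀ i, HasLaw (X i) μ P)
    (hind : Pairwise fun i j => IndepFun (X i) (X j) P) {g : ℂ → ℝ} (hg : Measurable g)
    (hg2 : MemLp g 2 μ) :
    variance (fun ω => ∑ i, g (X i ω)) P = Fintype.card ι * variance g μ := by
  have hL : ∀ i, MemLp (g ∘ X i) 2 P := fun i =>
    MemLp.comp_of_map ((hlaw i).map_eq.symm ▸ hg2) (hlaw i).aemeasurable
  have h1 : (fun ω => ∑ i, g (X i ω)) = ∑ i, g ∘ X i := by ext ω; simp
  rw [h1, IndepFun.variance_sum (fun i _ => hL i) fun i _ j _ hij => (hind hij).comp hg hg]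
  have h2 : ∀ i, variance (g ∘ X i) P = variance g μ := fun i => by
    rw [← (hlaw i).map_eq, variance_map]
    · exact hg.aemeasurable
    · exact (hlaw i).aemeasurable
  simp [h2]

theorem integral_sum_comp (hlaw : ∀ i, HasLaw (X i) μ P) {g : ℂ → ℝ} (hg : Integrable g μ) :
    ∫ ω, ∑ i, g (X i ω) ∂P = Fintype.card ι * ∫ z, g z ∂μ := by
  have hi : ∀ i, Integrable (fun ω => g (X i ω)) P := fun i => by
    have : Integrable g (P.map (X i)) := (hlaw i).map_eq.symm ▸ hg
    exact this.comp_aemeasurable (hlaw i).aemeasurable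
  rw [integral_finsetSum _ fun i _ => hi i]
  have h2 : ∀ i, ∫ ω, g (X i ω) ∂P = ∫ z, g z ∂μ := fun i => by
    rw [← (hlaw i).map_eq, integral_map (hlaw i).aemeasurable]
    rw [(hlaw i).map_eq]; exact hg.aestronglyMeasurable
  simp [h2]

theorem lintegral_sum_comp (hlaw : ∀ i, HasLaw (X i) μ P) {g : ℂ → ℝ≥0∞} (hg : Measurable g) :
    ∫⁻ ω, ∑ i, g (X i ω) ∂P = Fintype.card ι * ∫⁻ z, g z ∂μ := by
  rw [lintegral_finsetSum' (f := fun i ω => g (X i ω)) _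
    fun i _ => hg.comp_aemeasurable (hlaw i).aemeasurable]
  have h2 : ∀ i, ∫⁻ ω, g (X i ω) ∂P = ∫⁻ z, g z ∂μ := fun i => by
    rw [← (hlaw i).map_eq, lintegral_map' hg.aemeasurable (hlaw i).aemeasurable]
  simp [h2]

theorem lintegral_sq_sum_le [IsProbabilityMeasure P] (hlaw : ∀ i, HasLaw (X i) μ P)
    (hind : Pairwise fun i j => IndepFun (X i) (X j) P) [IsProbabilityMeasure μ] {g : ℂ → ℝ}
    (hg : Measurable g) (hg2 : MemLp g 2 μ) (h0 : ∫ z, g z ∂μ = 0) :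
    ∫⁻ ω, ENNReal.ofReal ((∑ i, g (X i ω)) ^ 2) ∂P =
      Fintype.card ι * ∫⁻ z, ENNReal.ofReal (g z ^ 2) ∂μ := by
  have hL : MemLp (fun ω => ∑ i, g (X i ω)) 2 P := by
    refine memLp_finsetSum _ fun i _ => ?_
    exact MemLp.comp_of_map (g := g) ((hlaw i).map_eq.symm ▸ hg2) (hlaw i).aemeasurable
  rw [← ofReal_integral_eq_lintegral_ofReal hL.integrable_sq (ae_of_all _ fun ω => sq_nonneg _),
    ← ofReal_integral_eq_lintegral_ofReal hg2.integrable_sq (ae_of_all _ fun ω => sq_nonneg _),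
    ← variance_of_integral_eq_zero hg.aemeasurable h0,
    ← variance_of_integral_eq_zero hL.aestronglyMeasurable.aemeasurable
      (by rw [integral_sum_comp hlaw (hg2.integrable (by norm_num)), h0, mul_zero]),
    variance_sum_comp hlaw hind hg hg2, ENNReal.ofReal_mul (by positivity), ENNReal.ofReal_natCast]

theorem lintegral_norm_sq_sum_le [IsProbabilityMeasure P] (hlaw : ∀ i, HasLaw (X i) μ P)
    (hind : Pairwise fun i j => IndepFun (X i) (X j) P) [IsProbabilityMeasure μ] {g : ℂ → ℂ}
    (hg : Measurable g) (hg2 : MemLp g 2 μ) (h0 : ∫ z, g z ∂μ = 0) :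
    ∫⁻ ω, ENNReal.ofReal (‖∑ i, g (X i ω)‖ ^ 2) ∂P =
      Fintype.card ι * ∫⁻ z, ENNReal.ofReal (‖g z‖ ^ 2) ∂μ := by
  have hgi : Integrable g μ := hg2.integrable (by norm_num)
  have hre := lintegral_sq_sum_le hlaw hind (g := fun z => (g z).re) (by fun_prop) hg2.re
    (by have := congrArg Complex.re h0; rw [Complex.zero_re] at this
        rw [← this]; exact integral_re hgi)
  have him := lintegral_sq_sum_le hlaw hind (g := fun z => (g z).im) (by fun_prop) hg2.im
    (by have := congrArg Complex.im h0; rw [Complex.zero_im] at this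
        rw [← this]; exact integral_im hgi)
  have e : ∀ w : ℂ, ENNReal.ofReal (‖w‖ ^ 2) = ENNReal.ofReal (w.re ^ 2) + ENNReal.ofReal (w.im ^ 2) := by
    intro w
    rw [← ENNReal.ofReal_add (sq_nonneg _) (sq_nonneg _), Complex.sq_norm, Complex.normSq_apply]
    congr 1; ring
  simp only [e]
  rw [lintegral_add_left' , lintegral_add_left (by fun_prop), mul_add]
  · simp only [Complex.re_sum, Complex.im_sum]
    rw [hre, him]
  · refine (AEMeasurable.pow_const ?_ 2).ennreal_ofReal
    refine Complex.measurable_re.comp_aemeasurable ?_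
    exact Finset.aemeasurable_fun_sum _ fun i _ => hg.comp_aemeasurable (hlaw i).aemeasurable

/-- Rotation by the angle `π / k` preserves `μ` and changes the sign of `z ^ k`. -/
theorem integral_radial_mul_pow_eq_zero (hrot : ∀ u : ℂ, ‖u‖ = 1 → μ.map (fun z => u * z) = μ)
    {b : ℝ → ℝ} (hb : Measurable b) {k : ℕ} (hk : k ≠ 0) :
    ∫ z, (b ‖z‖ : ℂ) * z ^ k ∂μ = 0 := by
  set u : ℂ := Complex.exp ((Real.pi / k : ℝ) * Complex.I) with hu
  have hu1 : ‖u‖ = 1 := Complex.norm_exp_ofReal_mul_I _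
  have huk : u ^ k = -1 := by
    rw [hu, ← Complex.exp_nat_mul, ← Complex.exp_pi_mul_I]
    congr 1
    have : (k : ℂ) ≠ 0 := by exact_mod_cast hk
    push_cast
    field_simp
  have hmeas : Measurable fun z : ℂ => (b ‖z‖ : ℂ) * z ^ k := by fun_prop
  have h : ∫ z, (b ‖z‖ : ℂ) * z ^ k ∂μ = - ∫ z, (b ‖z‖ : ℂ) * z ^ k ∂μ := by
    conv_lhs => rw [← hrot u hu1]
    rw [integral_map (by fun_prop) hmeas.aestronglyMeasurable, ← integral_neg]
    congr 1
    ext z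
    rw [norm_mul, hu1, one_mul, mul_pow, huk]
    ring
  have h2 : (2 : ℂ) * ∫ z, (b ‖z‖ : ℂ) * z ^ k ∂μ = 0 := by linear_combination h
  simpa using h2

/-- The weighted power sum `∑ b(|x j|) (x j) ^ k`. -/
noncomputable def powerSum (b : ℝ → ℝ) (x : ι → ℂ) (k : ℕ) : ℂ := ∑ j, (b ‖x j‖ : ℂ) * x j ^ k

/-- The weighted energy of the power sums of positive order. -/
noncomputable def powerEnergy (b : ℝ → ℝ) (τ : ℝ) (x : ι → ℂ) : ℝ≥0∞ :=
  ∑' k : ℕ, ENNReal.ofReal ((1 + τ)⁻¹ ^ (k + 1) * ‖powerSum b x (k + 1)‖ ^ 2)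

/-- Centring and pairwise independence remove the cross terms in each squared power sum. Summing the
moments `|z| ^ (2 k)` against the weights is a geometric series with value `1 / (1 + τ - |z| ^ 2)`,
which is at most `1 / (τ + 1 - |z|)` on the disk. -/
theorem lintegral_powerEnergy_le [IsProbabilityMeasure P] (hlaw : ∀ i, HasLaw (X i) μ P)
    (hind : Pairwise fun i j => IndepFun (X i) (X j) P) [IsProbabilityMeasure μ]
    (hrot : ∀ u : ℂ, ‖u‖ = 1 → μ.map (fun z => u * z) = μ)
    (hsupp : μ (Metric.closedBall (0 : ℂ) 1)ᶜ = 0) {b : ℝ → ℝ} (hb : Measurable b)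
    (hb1 : ∀ r, 0 ≤ r → r ≤ 1 → |b r| ≤ 1) {τ : ℝ} (hτ : 0 < τ) :
    ∫⁻ ω, powerEnergy b τ (fun i => X i ω) ∂P ≤
      Fintype.card ι * (ENNReal.ofReal (1 / τ) * ∫⁻ z, ENNReal.ofReal (τ / (τ + 1 - ‖z‖)) ∂μ) := by
  have hae : ∀ᵐ z ∂μ, ‖z‖ ≤ 1 := by
    rw [ae_iff]; convert hsupp using 2; ext z; simp
  have hgm : ∀ k : ℕ, Measurable fun z : ℂ => (b ‖z‖ : ℂ) * z ^ k := fun k => by fun_prop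
  have hg1 : ∀ (k : ℕ) (z : ℂ), ‖z‖ ≤ 1 → ‖(b ‖z‖ : ℂ) * z ^ k‖ ≤ ‖z‖ ^ k := fun k z hz => by
    rw [norm_mul, norm_pow, Complex.norm_real, Real.norm_eq_abs]
    exact mul_le_of_le_one_left (by positivity) (hb1 _ (norm_nonneg _) hz)
  have hg2 : ∀ k : ℕ, MemLp (fun z : ℂ => (b ‖z‖ : ℂ) * z ^ k) 2 μ := fun k => by
    refine MemLp.of_bound (hgm k).aestronglyMeasurable 1 ?_
    filter_upwards [hae] with z hz
    exact (hg1 k z hz).trans (pow_le_one₀ (norm_nonneg _) hz)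
  have hR : 0 < 1 + τ := by linarith
  have term : ∀ k : ℕ, ∫⁻ ω, ENNReal.ofReal ((1 + τ)⁻¹ ^ (k + 1) *
      ‖powerSum b (fun i => X i ω) (k + 1)‖ ^ 2) ∂P ≤
      Fintype.card ι * ∫⁻ z, ENNReal.ofReal ((1 + τ)⁻¹ * ((1 + τ)⁻¹ * ‖z‖ ^ 2) ^ k) ∂μ := by
    intro k
    have h := lintegral_norm_sq_sum_le hlaw hind (hgm (k + 1)) (hg2 (k + 1))
      (integral_radial_mul_pow_eq_zero hrot hb k.succ_ne_zero)
    have h0 : 0 ≤ (1 + τ)⁻¹ ^ (k + 1) := by positivity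
    simp_rw [ENNReal.ofReal_mul h0]
    rw [lintegral_const_mul' _ _ ENNReal.ofReal_ne_top]
    simp only [powerSum]
    rw [h, mul_left_comm, ← lintegral_const_mul' _ _ ENNReal.ofReal_ne_top]
    refine mul_le_mul_right ?_ _
    refine lintegral_mono_ae ?_
    filter_upwards [hae] with z hz
    rw [← ENNReal.ofReal_mul h0]
    refine ENNReal.ofReal_le_ofReal ?_
    calc (1 + τ)⁻¹ ^ (k + 1) * ‖(b ‖z‖ : ℂ) * z ^ (k + 1)‖ ^ 2
        ≤ (1 + τ)⁻¹ ^ (k + 1) * (‖z‖ ^ k) ^ 2 := by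
          gcongr
          exact (hg1 (k + 1) z hz).trans (pow_le_pow_of_le_one (norm_nonneg _) hz (Nat.le_succ k))
      _ = _ := by ring
  unfold powerEnergy
  have hX : ∀ i, AEMeasurable (X i) P := fun i => (hlaw i).aemeasurable
  rw [lintegral_tsum]
  · refine (ENNReal.tsum_le_tsum term).trans ?_
    rw [ENNReal.tsum_mul_left, ← lintegral_tsum fun k => by fun_prop,
      ← lintegral_const_mul' _ _ ENNReal.ofReal_ne_top]
    refine mul_le_mul_right ?_ _
    refine lintegral_mono_ae ?_
    filter_upwards [hae] with z hz
    have hz2 : ‖z‖ ^ 2 ≤ ‖z‖ := by nlinarith [norm_nonneg z]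
    have hlt : (1 + τ)⁻¹ * ‖z‖ ^ 2 < 1 := by
      rw [← div_eq_inv_mul, div_lt_one hR]; linarith
    rw [tsum_ofReal_mul_pow (by positivity) (by positivity) hlt, ← ENNReal.ofReal_mul (by positivity)]
    refine ENNReal.ofReal_le_ofReal ?_
    have e : (1 + τ)⁻¹ / (1 - (1 + τ)⁻¹ * ‖z‖ ^ 2) = 1 / (1 + τ - ‖z‖ ^ 2) := by
      have h1 : 1 - (1 + τ)⁻¹ * ‖z‖ ^ 2 ≠ 0 := by linarith
      have h2 : 1 + τ - ‖z‖ ^ 2 ≠ 0 := by nlinarith [norm_nonneg z]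
      field_simp
    have e2 : 1 / τ * (τ / (τ + 1 - ‖z‖)) = 1 / (τ + 1 - ‖z‖) := by
      have : τ + 1 - ‖z‖ ≠ 0 := by linarith
      field_simp
    rw [e, e2]
    exact one_div_le_one_div_of_le (by linarith) (by linarith)
  · intro k
    refine AEMeasurable.ennreal_ofReal ?_
    refine AEMeasurable.const_mul (AEMeasurable.pow_const (AEMeasurable.norm ?_) 2) _
    exact Finset.aemeasurable_fun_sum _ fun i _ => (hgm (k + 1)).comp_aemeasurable (hX i)

end Moments

/-! ### Uniform bounds on the circle of radius `1 + τ` -/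

section PowerSeries

variable {ι : Type*} [Fintype ι]

/-- A bound for a weighted Cauchy transform just outside the unit disk by the energy. -/
theorem norm_cauchy_sub_le {b : ℝ → ℝ} {τ : ℝ} (hτ : 0 < τ) {x : ι → ℂ} (hx : ∀ i, ‖x i‖ ≤ 1)
    {D : ℝ} (hD : 0 < D) (hV : powerEnergy b τ x ≤ ENNReal.ofReal (D ^ 2 * τ)) {z : ℂ}
    (hz : ‖z‖ = 1 + τ) :
    ‖∑ j, (b ‖x j‖ : ℂ) * (z / (z - x j)) - ∑ j, (b ‖x j‖ : ℂ)‖ ≤ D := by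
  have hR : 0 < 1 + τ := by linarith
  have hr1 : (1 + τ)⁻¹ < 1 := inv_lt_one_of_one_lt₀ (by linarith)
  have hz0 : z ≠ 0 := norm_pos_iff.1 (by rw [hz]; exact hR)
  have hlt : ∀ j, ‖x j / z‖ < 1 := fun j => by
    rw [norm_div, hz, div_lt_one hR]; linarith [hx j]
  have hs1 : HasSum (fun k => z⁻¹ ^ (k + 1) * powerSum b x (k + 1))
      (∑ j, (b ‖x j‖ : ℂ) * (z / (z - x j)) - ∑ j, (b ‖x j‖ : ℂ)) := by
    rw [← Finset.sum_sub_distrib]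
    simp only [powerSum, Finset.mul_sum]
    refine hasSum_sum fun j _ => ?_
    have hne : z - x j ≠ 0 := by
      intro h
      have := hlt j
      rw [← sub_eq_zero.1 h, div_self hz0] at this
      simp at this
    have h := (hasSum_geometric_of_norm_lt_one (hlt j)).mul_left ((b ‖x j‖ : ℂ) * (x j / z))
    have e : (b ‖x j‖ : ℂ) * (z / (z - x j)) - (b ‖x j‖ : ℂ) =
        (b ‖x j‖ : ℂ) * (x j / z) * (1 - x j / z)⁻¹ := by
      rw [one_sub_div hz0]
      field_simp
      ring
    rw [e]
    refine (congrArg (fun F => HasSum F _) (funext fun k => ?_)).mpr h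
    rw [inv_pow, div_pow, pow_succ' (x j), pow_succ' z]
    field_simp
  have hgeo : Summable fun k : ℕ => (1 + τ)⁻¹ ^ (k + 1) * (D * τ / 2) := by
    simp_rw [pow_succ]
    exact ((summable_geometric_of_lt_one (by positivity) hr1).mul_right _).mul_right _
  have hVne : powerEnergy b τ x ≠ ∞ := ne_top_of_le_ne_top ENNReal.ofReal_ne_top hV
  have hVs : Summable fun k : ℕ => (1 + τ)⁻¹ ^ (k + 1) * ‖powerSum b x (k + 1)‖ ^ 2 := by
    have := ENNReal.summable_toReal hVne
    refine this.congr fun k => ENNReal.toReal_ofReal (by positivity)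
  have hVle : ∑' k : ℕ, (1 + τ)⁻¹ ^ (k + 1) * ‖powerSum b x (k + 1)‖ ^ 2 ≤ D ^ 2 * τ := by
    unfold powerEnergy at hV
    rw [← ENNReal.ofReal_tsum_of_nonneg (fun k => by positivity) hVs] at hV
    exact (ENNReal.ofReal_le_ofReal_iff (by positivity)).1 hV
  -- AM-GM in the form `p ≤ D τ / 2 + p ^ 2 / (2 D τ)`. After weighting, both halves sum to at most
  -- `D / 2`, and the bound depends on `z` only through its modulus.
  have hbound : ∀ k : ℕ, ‖z⁻¹ ^ (k + 1) * powerSum b x (k + 1)‖ ≤ (1 + τ)⁻¹ ^ (k + 1) * (D * τ / 2) +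
      ((1 + τ)⁻¹ ^ (k + 1) * ‖powerSum b x (k + 1)‖ ^ 2) * (1 / (2 * (D * τ))) := by
    intro k
    rw [norm_mul, norm_pow, norm_inv, hz, mul_assoc, ← mul_add]
    gcongr
    have hl : 0 < D * τ := by positivity
    rw [mul_one_div, div_add_div _ _ two_ne_zero (by positivity), le_div_iff₀ (by positivity)]
    nlinarith [sq_nonneg (‖powerSum b x (k + 1)‖ - D * τ)]
  have hsum := hgeo.add (hVs.mul_right (1 / (2 * (D * τ))))
  rw [← hs1.tsum_eq]
  refine (tsum_of_norm_bounded hsum.hasSum hbound).trans ?_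
  rw [hgeo.tsum_add (hVs.mul_right _), tsum_mul_right, tsum_mul_right]
  have hg : ∑' k : ℕ, (1 + τ)⁻¹ ^ (k + 1) = 1 / τ := by
    simp_rw [pow_succ]
    rw [tsum_mul_right, tsum_geometric_of_lt_one (by positivity) hr1]
    have : 1 - (1 + τ)⁻¹ ≠ 0 := by linarith
    have h2 : 1 + τ - 1 ≠ 0 := by linarith
    field_simp
    ring
  rw [hg]
  calc 1 / τ * (D * τ / 2) + (∑' k : ℕ, (1 + τ)⁻¹ ^ (k + 1) * ‖powerSum b x (k + 1)‖ ^ 2) *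
        (1 / (2 * (D * τ))) ≤ 1 / τ * (D * τ / 2) + (D ^ 2 * τ) * (1 / (2 * (D * τ))) := by gcongr
    _ = D := by field_simp; ring

theorem norm_sum_inv_sub_le {τ : ℝ} (hτ : 0 < τ) {x : ι → ℂ} (hx : ∀ i, ‖x i‖ ≤ 1)
    {D : ℝ} (hD : 0 < D) (hV : powerEnergy (fun _ => 1) τ x ≤ ENNReal.ofReal (D ^ 2 * τ)) {z : ℂ}
    (hz : ‖z‖ = 1 + τ) :
    ‖∑ j, 1 / (z - x j) - Fintype.card ι / z‖ ≤ D := by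
  have h := norm_cauchy_sub_le hτ hx hD hV hz
  have hz0 : z ≠ 0 := norm_pos_iff.1 (by rw [hz]; linarith)
  have e : ∑ j, ((1 : ℝ) : ℂ) * (z / (z - x j)) - ∑ j : ι, ((1 : ℝ) : ℂ) =
      z * (∑ j, 1 / (z - x j) - Fintype.card ι / z) := by
    rw [mul_sub, Finset.mul_sum, mul_div_cancel₀ _ hz0]
    simp [div_eq_mul_inv]
  rw [e, norm_mul, hz] at h
  nlinarith [norm_nonneg (∑ j, 1 / (z - x j) - Fintype.card ι / z)]

/-- The radial factor in front of the Poisson kernel. -/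
noncomputable def poissonWeight (τ r : ℝ) : ℝ := τ / ((1 + τ) ^ 2 - r ^ 2)

/-- The Poisson kernel `(|z|² - |x|²) / |z - x|²` equals `2 Re (z / (z - x)) - 1`. Multiplying by `b
= poissonWeight τ |x|` cancels its numerator and leaves `τ / |z - x|²`, so the sum is the real part
of a weighted Cauchy sum plus the sum of the weights. -/
theorem sum_div_norm_sq_le {τ : ℝ} (hτ : 0 < τ) {x : ι → ℂ} (hx : ∀ i, ‖x i‖ ≤ 1)
    {D : ℝ} (hD : 0 < D) (hV : powerEnergy (poissonWeight τ) τ x ≤ ENNReal.ofReal (D ^ 2 * τ)) {z : ℂ}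
    (hz : ‖z‖ = 1 + τ) :
    ∑ j, τ / ‖z - x j‖ ^ 2 ≤ ∑ j, poissonWeight τ ‖x j‖ + 2 * D := by
  have h := norm_cauchy_sub_le hτ hx hD hV hz
  have e : ∀ j, τ / ‖z - x j‖ ^ 2 =
      2 * ((poissonWeight τ ‖x j‖ : ℂ) * (z / (z - x j)) - (poissonWeight τ ‖x j‖ : ℂ)).re +
        poissonWeight τ ‖x j‖ := by
    intro j
    have hne : z - x j ≠ 0 := by
      intro h
      rw [sub_eq_zero.1 h] at hz
      linarith [hx j]
    have hn : 0 < ‖z - x j‖ ^ 2 := by positivity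
    have hden : (1 + τ) ^ 2 - ‖x j‖ ^ 2 ≠ 0 := by nlinarith [norm_nonneg (x j), hx j]
    have hre : (z / (z - x j)).re = (((1 + τ) ^ 2 - ‖x j‖ ^ 2) / ‖z - x j‖ ^ 2 + 1) / 2 := by
      have h1 : Complex.normSq (z - x j) ≠ 0 := by simpa using hne
      have h3 : (z / (z - x j)).re = (z.re * (z - x j).re + z.im * (z - x j).im) / Complex.normSq (z - x j) := by
        rw [Complex.div_re]; ring
      rw [h3, ← hz, Complex.sq_norm, Complex.sq_norm, Complex.sq_norm, div_add_one h1, div_div,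
        div_eq_div_iff h1 (by positivity)]
      simp only [Complex.normSq_apply, Complex.sub_re, Complex.sub_im]
      ring
    rw [Complex.sub_re, Complex.re_ofReal_mul, Complex.ofReal_re, hre, poissonWeight]
    field_simp
    ring
  rw [Finset.sum_congr rfl fun j _ => e j, Finset.sum_add_distrib, ← Finset.mul_sum, ← Complex.re_sum,
    Finset.sum_sub_distrib]
  linarith [(Complex.re_le_norm _).trans h]

end PowerSeries

/-! ### Deterministic estimates for regular configurations -/

/-- Configurations of `n` points in the closed unit disk whose Cauchy transform and Poisson sums are
under control on the circle of radius `1 + τ`, and whose points near the unit circle do not interact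
much with nearby points. -/
structure EdgeRegular {n : ℕ} (x : Fin n → ℂ) (τ ε₁ ε₃ : ℝ) : Prop where
  tau_pos : 0 < τ
  tau_le : τ ≤ ε₁
  eps_le : ε₁ ≤ 1 / 1000
  eps_le' : ε₃ ≤ ε₁
  le_mul : 10 ≤ n * τ
  norm_le : ∀ i, ‖x i‖ ≤ 1
  cauchy : ∀ z : ℂ, ‖z‖ = 1 + τ → ‖∑ j, 1 / (z - x j) - n / z‖ ≤ ε₁ * n
  poisson : ∀ z : ℂ, ‖z‖ = 1 + τ → ∑ j, τ / ‖z - x j‖ ^ 2 ≤ ε₁ * n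
  ne : ∀ i j, 1 - 5 * τ ≤ ‖x i‖ → j ≠ i → x i ≠ x j
  pair : ∀ i, 1 - 5 * τ ≤ ‖x i‖ →
    ∑ j ∈ (Finset.univ.erase i).filter (fun j => ‖x i - x j‖ ≤ 8 * τ), 1 / ‖x i - x j‖ ≤ ε₃ * n

/-- The part `∑ j ≠ i, 1 / (z - x j)` of the logarithmic derivative. -/
noncomputable def otherSum {n : ℕ} (x : Fin n → ℂ) (i : Fin n) (z : ℂ) : ℂ :=
  ∑ j ∈ Finset.univ.erase i, 1 / (z - x j)

/-- The interaction energy `∑ j ≠ i, 1 / |x i - x j| ^ 2`. -/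
noncomputable def otherEnergy {n : ℕ} (x : Fin n → ℂ) (i : Fin n) : ℝ :=
  ∑ j ∈ Finset.univ.erase i, 1 / ‖x i - x j‖ ^ 2

theorem otherEnergy_nonneg {n : ℕ} (x : Fin n → ℂ) (i : Fin n) : 0 ≤ otherEnergy x i :=
  Finset.sum_nonneg fun j _ => by positivity

theorem exists_outer_point {τ : ℝ} (hτ : 0 < τ) (hτ1 : τ < 1) {z : ℂ} (h1 : 1 - τ ≤ ‖z‖)
    (h2 : ‖z‖ ≤ 1 + τ) : ∃ w : ℂ, ‖w‖ = 1 + τ ∧ ‖w - z‖ ≤ 2 * τ := by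
  have hz : 0 < ‖z‖ := by linarith
  refine ⟨((1 + τ) / ‖z‖ : ℝ) • z, ?_, ?_⟩
  · rw [norm_smul, Real.norm_eq_abs, abs_of_nonneg (by positivity), div_mul_cancel₀ _ hz.ne']
  · have e : ((1 + τ) / ‖z‖ : ℝ) • z - z = ((1 + τ) / ‖z‖ - 1 : ℝ) • z := by rw [sub_smul, one_smul]
    rw [e, norm_smul, Real.norm_eq_abs, ← abs_of_pos hz, ← abs_mul, abs_of_pos hz, sub_mul,
      div_mul_cancel₀ _ hz.ne', abs_le]
    constructor <;> linarith

namespace EdgeRegular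

variable {n : ℕ} {x : Fin n → ℂ} {τ ε₁ ε₃ : ℝ}

theorem n_pos (h : EdgeRegular x τ ε₁ ε₃) : (0 : ℝ) < n := by
  have := h.le_mul
  have := h.tau_pos
  by_contra hn
  have : (n : ℝ) * τ ≤ 0 := mul_nonpos_of_nonpos_of_nonneg (not_lt.1 hn) h.tau_pos.le
  linarith

theorem inv_le (h : EdgeRegular x τ ε₁ ε₃) : 1 / (n : ℝ) ≤ τ / 10 := by
  rw [div_le_div_iff₀ h.n_pos (by norm_num)]
  linarith [h.le_mul]

/-- Compare with the radial projection `w` of `z` onto the outer circle. A root far from `z` changes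
its term by a multiple of `τ / |w - x j|²`; a root near `z` has a term at `w` of that size, since
`|w - x j| ≤ 6 τ`. The constant is `6` from the Poisson sum, `1` from the Cauchy sum and `3` from
replacing `n / w` by `n / z`. -/
theorem norm_far_sub_le (h : EdgeRegular x τ ε₁ ε₃) {z : ℂ} (h1 : 1 - τ ≤ ‖z‖) (h2 : ‖z‖ ≤ 1 + τ) :
    ‖∑ j ∈ Finset.univ.filter (fun j => 4 * τ < ‖z - x j‖), 1 / (z - x j) - n / z‖ ≤
      10 * ε₁ * n := by
  have hτ := h.tau_pos
  have hτ1 : τ ≤ 1 / 1000 := h.tau_le.trans h.eps_le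
  have hn := h.n_pos
  obtain ⟨w, hw, hwz⟩ := exists_outer_point hτ (by linarith) h1 h2
  have hz0 : z ≠ 0 := norm_pos_iff.1 (by linarith)
  have hw0 : w ≠ 0 := norm_pos_iff.1 (by linarith)
  have hd' : ∀ j, 0 < ‖w - x j‖ := fun j => by
    have := norm_sub_norm_le w (x j)
    linarith [h.norm_le j]
  have hterm : ∀ j, ‖(if 4 * τ < ‖z - x j‖ then 1 / (z - x j) else 0) - 1 / (w - x j)‖ ≤
      6 * (τ / ‖w - x j‖ ^ 2) := by
    intro j
    have htri : ‖w - x j‖ ≤ 2 * τ + ‖z - x j‖ := by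
      have := norm_add_le (w - z) (z - x j)
      rw [sub_add_sub_cancel] at this
      linarith
    have hpos := hd' j
    split_ifs with hj
    · have hd : 0 < ‖z - x j‖ := by linarith
      have e : 1 / (z - x j) - 1 / (w - x j) = (w - z) / ((z - x j) * (w - x j)) := by
        have := norm_pos_iff.1 hd
        have := norm_pos_iff.1 hpos
        field_simp
        ring
      rw [e, norm_div, norm_mul, mul_div_assoc', div_le_div_iff₀ (by positivity) (by positivity)]
      have h3 : ‖w - x j‖ ≤ 3 / 2 * ‖z - x j‖ := by linarith
      calc ‖w - z‖ * ‖w - x j‖ ^ 2 ≤ (2 * τ) * (3 / 2 * ‖z - x j‖ * ‖w - x j‖) := by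
            rw [sq]; gcongr
        _ ≤ 6 * τ * (‖z - x j‖ * ‖w - x j‖) := by
            nlinarith [mul_pos hτ (mul_pos hd hpos)]
    · rw [zero_sub, norm_neg, norm_div, norm_one, mul_div_assoc',
        div_le_div_iff₀ hpos (by positivity)]
      have h3 : ‖w - x j‖ ≤ 6 * τ := by linarith [not_lt.1 hj]
      nlinarith
  have e : ∑ j ∈ Finset.univ.filter (fun j => 4 * τ < ‖z - x j‖), 1 / (z - x j) - n / z =
      ∑ j, ((if 4 * τ < ‖z - x j‖ then 1 / (z - x j) else 0) - 1 / (w - x j)) +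
        (∑ j, 1 / (w - x j) - n / w) + (n / w - n / z) := by
    rw [Finset.sum_sub_distrib, Finset.sum_filter]
    ring
  have hlast : ‖(n / w - n / z : ℂ)‖ ≤ 3 * τ * n := by
    have e : (n / w - n / z : ℂ) = n * (z - w) / (w * z) := by field_simp
    rw [e, norm_div, norm_mul, norm_mul, Complex.norm_natCast, norm_sub_rev,
      div_le_iff₀ (by positivity), hw]
    have h3 : 2 / 3 ≤ (1 + τ) * ‖z‖ := by nlinarith
    calc (n : ℝ) * ‖w - z‖ ≤ n * (2 * τ) := by gcongr
      _ = 3 * τ * n * (2 / 3) := by ring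
      _ ≤ _ := by gcongr
  rw [e]
  calc _ ≤ ‖∑ j, ((if 4 * τ < ‖z - x j‖ then 1 / (z - x j) else 0) - 1 / (w - x j))‖ +
        ‖∑ j, 1 / (w - x j) - n / w‖ + ‖(n / w - n / z : ℂ)‖ := norm_add₃_le
    _ ≤ 6 * (ε₁ * n) + ε₁ * n + 3 * τ * n := by
        gcongr
        · refine (norm_sum_le _ _).trans ((Finset.sum_le_sum fun j _ => hterm j).trans ?_)
          rw [← Finset.mul_sum]
          gcongr
          exact h.poisson w hw
        · exact h.cauchy w hw
    _ ≤ _ := by nlinarith [h.tau_le]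

/-- The hypothesis `hij` lets distances from `z` be replaced by distances from `x i`, at the price
of a factor `2`. The close roots then fall under `pair`, adding at most `2 ε₃ n ≤ 2 ε₁ n` to the far
estimate. This is also why `pair` reaches out to `8 τ` and down to modulus `1 - 5 τ`. -/
theorem norm_otherSum_sub_le (h : EdgeRegular x τ ε₁ ε₃) {z : ℂ} (h1 : 1 - τ ≤ ‖z‖)
    (h2 : ‖z‖ ≤ 1 + τ) {i : Fin n} (hi : ‖z - x i‖ ≤ 4 * τ)
    (hij : ∀ j, j ≠ i → ‖x i - x j‖ ≤ 2 * ‖z - x j‖) :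
    ‖otherSum x i z - n / z‖ ≤ 12 * ε₁ * n := by
  have hn := h.n_pos
  have hxi : 1 - 5 * τ ≤ ‖x i‖ := by
    have := norm_sub_norm_le z (x i)
    linarith
  have hfar : (Finset.univ.erase i).filter (fun j => 4 * τ < ‖z - x j‖) =
      Finset.univ.filter (fun j => 4 * τ < ‖z - x j‖) := by
    ext j
    simp only [Finset.mem_filter, Finset.mem_erase, Finset.mem_univ, and_true, true_and,
      and_iff_right_iff_imp]
    rintro hj rfl
    linarith
  have hnear : ‖∑ j ∈ (Finset.univ.erase i).filter (fun j => ¬ 4 * τ < ‖z - x j‖), 1 / (z - x j)‖ ≤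
      2 * (ε₃ * n) := by
    refine (norm_sum_le _ _).trans ?_
    refine le_trans ?_ (mul_le_mul_of_nonneg_left (h.pair i hxi) zero_le_two)
    rw [Finset.mul_sum]
    refine le_trans (Finset.sum_le_sum (g := fun j => 2 * (1 / ‖x i - x j‖)) ?_)
      (Finset.sum_le_sum_of_subset_of_nonneg ?_ fun j _ _ => by positivity)
    · intro j hj
      have hji : j ≠ i := Finset.ne_of_mem_erase (Finset.mem_filter.1 hj).1
      have hpos : 0 < ‖x i - x j‖ := norm_pos_iff.2 (sub_ne_zero.2 (h.ne i j hxi hji))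
      have := hij j hji
      rw [norm_div, norm_one, mul_one_div, div_le_div_iff₀ (by linarith) hpos]
      linarith
    · intro j hj
      rw [Finset.mem_filter] at hj ⊢
      refine ⟨hj.1, ?_⟩
      linarith [hij j (Finset.ne_of_mem_erase hj.1), not_lt.1 hj.2]
  have e : otherSum x i z - n / z =
      (∑ j ∈ Finset.univ.filter (fun j => 4 * τ < ‖z - x j‖), 1 / (z - x j) - n / z) +
      ∑ j ∈ (Finset.univ.erase i).filter (fun j => ¬ 4 * τ < ‖z - x j‖), 1 / (z - x j) := by
    rw [otherSum, ← Finset.sum_filter_add_sum_filter_not _ (fun j => 4 * τ < ‖z - x j‖), hfar]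
    ring
  rw [e]
  refine (norm_add_le _ _).trans ((add_le_add (h.norm_far_sub_le h1 h2) hnear).trans ?_)
  nlinarith [h.eps_le']

/-- A root within `8 τ` contributes a single term `1 / |x i - x j| ≤ ε₃ n ≤ n / 1000`; any other
root is at distance more than `8 τ ≥ 80 / n`. -/
theorem separation (h : EdgeRegular x τ ε₁ ε₃) {i j : Fin n} (hi : 1 - 5 * τ ≤ ‖x i‖) (hj : j ≠ i) :
    80 / n ≤ ‖x i - x j‖ := by
  have hn := h.n_pos
  have hpos : 0 < ‖x i - x j‖ := norm_pos_iff.2 (sub_ne_zero.2 (h.ne i j hi hj))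
  by_cases hd : ‖x i - x j‖ ≤ 8 * τ
  · have h1 : 1 / ‖x i - x j‖ ≤ ε₃ * n := by
      refine le_trans ?_ (h.pair i hi)
      exact Finset.single_le_sum (f := fun j => 1 / ‖x i - x j‖) (fun j _ => by positivity)
        (Finset.mem_filter.2 ⟨Finset.mem_erase.2 ⟨hj, Finset.mem_univ j⟩, hd⟩)
    have h2 : ε₃ * n ≤ n / 1000 := by
      nlinarith [h.eps_le, h.eps_le']
    rw [div_le_iff₀ hpos] at h1
    rw [div_le_iff₀ hn]
    nlinarith
  · have := h.inv_le
    have e : (80 : ℝ) / n = 80 * (1 / n) := by ring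
    rw [e]; linarith

/-- Distant roots are dominated by the Poisson sum at a nearby outer point. For close ones, a sum of
squares of nonnegative terms is at most the square of their sum. -/
theorem otherEnergy_le (h : EdgeRegular x τ ε₁ ε₃) {i : Fin n} (hi : 1 - τ ≤ ‖x i‖) :
    otherEnergy x i ≤ 3 * (ε₁ * n) / τ + (ε₃ * n) ^ 2 := by
  have hτ := h.tau_pos
  have hτ1 : τ ≤ 1 / 1000 := h.tau_le.trans h.eps_le
  have hn := h.n_pos
  have hε₁ : 0 < ε₁ := hτ.trans_le h.tau_le
  have hi5 : 1 - 5 * τ ≤ ‖x i‖ := by linarith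
  obtain ⟨w, hw, hwz⟩ := exists_outer_point hτ (by linarith) hi (by linarith [h.norm_le i])
  rw [otherEnergy, ← Finset.sum_filter_add_sum_filter_not _ (fun j => ‖x i - x j‖ ≤ 8 * τ), add_comm]
  refine add_le_add ?_ ?_
  · calc _ ≤ ∑ j ∈ (Finset.univ.erase i).filter (fun j => ¬ ‖x i - x j‖ ≤ 8 * τ),
          3 / τ * (τ / ‖w - x j‖ ^ 2) := by
          refine Finset.sum_le_sum fun j hj => ?_
          have hj2 := not_le.1 (Finset.mem_filter.1 hj).2
          have hwj : 0 < ‖w - x j‖ := by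
            have := norm_sub_norm_le w (x j)
            linarith [h.norm_le j]
          have htri : ‖w - x j‖ ≤ 2 * τ + ‖x i - x j‖ := by
            have := norm_add_le (w - x i) (x i - x j)
            rw [sub_add_sub_cancel] at this
            linarith
          have e : 3 / τ * (τ / ‖w - x j‖ ^ 2) = 3 / ‖w - x j‖ ^ 2 := by field_simp
          have hd : 0 < ‖x i - x j‖ := by linarith
          rw [e, div_le_div_iff₀ (by positivity) (by positivity)]
          have : ‖w - x j‖ ≤ 5 / 4 * ‖x i - x j‖ := by linarith
          nlinarith
      _ ≤ ∑ j, 3 / τ * (τ / ‖w - x j‖ ^ 2) :=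
          Finset.sum_le_sum_of_subset_of_nonneg (Finset.subset_univ _) fun j _ _ => by positivity
      _ ≤ 3 / τ * (ε₁ * n) := by
          rw [← Finset.mul_sum]
          gcongr
          exact h.poisson w hw
      _ = _ := by ring
  · have hp := h.pair i hi5
    have h0 : 0 ≤ ε₃ * n := le_trans (Finset.sum_nonneg fun j _ => by positivity) hp
    calc _ ≤ ∑ j ∈ (Finset.univ.erase i).filter (fun j => ‖x i - x j‖ ≤ 8 * τ),
          (ε₃ * n) * (1 / ‖x i - x j‖) := by
          refine Finset.sum_le_sum fun j hj => ?_
          have h1 : 1 / ‖x i - x j‖ ≤ ε₃ * n := le_trans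
            (Finset.single_le_sum (f := fun j => 1 / ‖x i - x j‖) (fun j _ => by positivity) hj) hp
          rw [← one_div_pow, sq]
          gcongr
      _ ≤ _ := by
          rw [← Finset.mul_sum, sq]
          gcongr

theorem otherEnergy_le' (h : EdgeRegular x τ ε₁ ε₃) (h3 : 0 ≤ ε₃) {i : Fin n} (hi : 1 - τ ≤ ‖x i‖) :
    otherEnergy x i ≤ (n : ℝ) ^ 2 / 1000 := by
  refine (h.otherEnergy_le hi).trans ?_
  have hτ := h.tau_pos
  have hn := h.n_pos
  have h4 : 3 * (ε₁ * n) / τ ≤ 3 / 10000 * (n : ℝ) ^ 2 := by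
    rw [div_le_iff₀ hτ]
    have := h.le_mul
    have := h.eps_le
    nlinarith [mul_pos hn hτ]
  have h5 : ε₃ ^ 2 ≤ 1 / 1000000 := by
    have : ε₃ ≤ 1 / 1000 := h.eps_le'.trans h.eps_le
    nlinarith
  nlinarith [sq_nonneg (n : ℝ)]

theorem norm_otherSum_ge (h : EdgeRegular x τ ε₁ ε₃) {z S : ℂ} (h1 : 1 - τ ≤ ‖z‖) (h2 : ‖z‖ ≤ 1 + τ)
    (hS : ‖S - n / z‖ ≤ 12 * ε₁ * n) : 98 / 100 * n ≤ ‖S‖ := by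
  have hn := h.n_pos
  have hτ := h.tau_pos
  have hτ1 : τ ≤ 1 / 1000 := h.tau_le.trans h.eps_le
  have hz : 0 < ‖z‖ := by linarith
  have h3 : 999 / 1000 * n ≤ ‖(n / z : ℂ)‖ := by
    rw [norm_div, Complex.norm_natCast, le_div_iff₀ hz]
    nlinarith
  have := norm_sub_norm_le (n / z : ℂ) S
  rw [norm_sub_rev] at this
  nlinarith [h.eps_le]

/-- If `S` were exactly `n / z`, the equation would give `z - x i = -z / n`. The proof follows the
error in `S` and the replacement of `z / n` by `x i / n`; the latter costs only `O(1 / n ^ 2)`,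
which is absorbed because `1 / n ≤ ε₁ / 10`. -/
theorem approx_of_eq_zero (h : EdgeRegular x τ ε₁ ε₃) {z S : ℂ} (h1 : 1 - τ ≤ ‖z‖) (h2 : ‖z‖ ≤ 1 + τ)
    (hS : ‖S - n / z‖ ≤ 12 * ε₁ * n) {i : Fin n} (h0 : 1 + (z - x i) * S = 0) :
    ‖z - x i * (1 - 1 / n)‖ ≤ 15 * ε₁ / n := by
  have hn := h.n_pos
  have hτ := h.tau_pos
  have hτ1 : τ ≤ 1 / 1000 := h.tau_le.trans h.eps_le
  have hz0 : z ≠ 0 := norm_pos_iff.1 (by linarith)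
  have hn0 : (n : ℂ) ≠ 0 := by exact_mod_cast hn.ne'
  have hε : 0 < ε₁ := hτ.trans_le h.tau_le
  have hSge := h.norm_otherSum_ge h1 h2 hS
  have hu : ‖z - x i‖ ≤ 103 / 100 / n := by
    have h3 : ‖z - x i‖ * ‖S‖ = 1 := by
      rw [← norm_mul, show (z - x i) * S = -1 by linear_combination h0]; simp
    rw [le_div_iff₀ hn]
    nlinarith [norm_nonneg (z - x i)]
  have e : z - x i * (1 - 1 / n) = -(z / n) * ((z - x i) * (S - n / z)) - (z - x i) / n := by
    have : (z - x i) * S = -1 := by linear_combination h0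
    rw [mul_sub (z - x i), this]
    field_simp
    ring
  rw [e]
  calc _ ≤ ‖-(z / n) * ((z - x i) * (S - n / z))‖ + ‖(z - x i) / n‖ := norm_sub_le _ _
    _ = ‖z‖ / n * (‖z - x i‖ * ‖S - n / z‖) + ‖z - x i‖ / n := by
        simp only [norm_mul, norm_neg, norm_div, Complex.norm_natCast]
    _ ≤ (1 + τ) / n * ((103 / 100 / n) * (12 * ε₁ * n)) + (103 / 100) * (1 / n) / n := by
        gcongr
        linarith [show (103 / 100 : ℝ) / n = (103 / 100) * (1 / n) by ring]
    _ ≤ (1 + τ) / n * ((103 / 100 / n) * (12 * ε₁ * n)) + (103 / 100) * (ε₁ / 10) / n := by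
        have hinv : 1 / (n : ℝ) ≤ ε₁ / 10 := by linarith [h.inv_le, h.tau_le]
        have := div_le_div_of_nonneg_right
          (mul_le_mul_of_nonneg_left hinv (by norm_num : (0 : ℝ) ≤ 103 / 100)) hn.le
        linarith
    _ = ((1 + τ) * (103 / 100) * 12 * ε₁ + 103 / 1000 * ε₁) / n := by field_simp; ring
    _ ≤ _ := by
        gcongr
        nlinarith

end EdgeRegular

/-! ### Algebra of the critical point equation -/

open Polynomial in
theorem eval_derivative_prod {ι : Type*} (s : Finset ι) (x : ι → ℂ) {z : ℂ} (hz : ∀ j ∈ s, z ≠ x j) :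
    (derivative (∏ j ∈ s, (X - C (x j)))).eval z =
      (∏ j ∈ s, (X - C (x j))).eval z * ∑ j ∈ s, 1 / (z - x j) := by
  classical
  induction s using Finset.induction_on with
  | empty => simp
  | insert a s ha ih =>
    have h1 := ih fun j hj => hz j (Finset.mem_insert_of_mem hj)
    have h2 : z - x a ≠ 0 := sub_ne_zero.2 (hz a (Finset.mem_insert_self a s))
    rw [Finset.prod_insert ha, Finset.sum_insert ha, derivative_mul, eval_add, eval_mul, eval_mul, h1]
    simp only [derivative_sub, derivative_X, derivative_C, sub_zero, eval_one, eval_sub, eval_X, eval_C,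
      eval_mul]
    field_simp

open Polynomial in
theorem eval_derivative_derivative_prod {ι : Type*} (s : Finset ι) (x : ι → ℂ) {z : ℂ}
    (hz : ∀ j ∈ s, z ≠ x j) :
    (derivative (derivative (∏ j ∈ s, (X - C (x j))))).eval z =
      (∏ j ∈ s, (X - C (x j))).eval z *
        ((∑ j ∈ s, 1 / (z - x j)) ^ 2 - ∑ j ∈ s, 1 / (z - x j) ^ 2) := by
  classical
  induction s using Finset.induction_on with
  | empty => simp
  | insert a s ha ih =>
    have hz' : ∀ j ∈ s, z ≠ x j := fun j hj => hz j (Finset.mem_insert_of_mem hj)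
    have h1 := ih hz'
    have h3 := eval_derivative_prod s x hz'
    have h2 : z - x a ≠ 0 := sub_ne_zero.2 (hz a (Finset.mem_insert_self a s))
    rw [Finset.prod_insert ha, Finset.sum_insert ha, Finset.sum_insert ha, derivative_mul,
      derivative_add, derivative_mul, derivative_mul]
    simp only [derivative_sub, derivative_X, derivative_C, sub_zero, derivative_one, eval_add, eval_mul,
      eval_one, eval_sub, eval_X, eval_C, eval_zero, h1, h3]
    field_simp
    ring

/-- The product `∏ j ≠ i, (z - x j)`. -/
noncomputable def otherPoly {n : ℕ} (x : Fin n → ℂ) (i : Fin n) : Polynomial ℂ :=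
  ∏ j ∈ Finset.univ.erase i, (Polynomial.X - Polynomial.C (x j))

theorem rootPoly_eq {n : ℕ} (x : Fin n → ℂ) (i : Fin n) :
    rootPoly x = (Polynomial.X - Polynomial.C (x i)) * otherPoly x i :=
  (Finset.mul_prod_erase _ _ (Finset.mem_univ i)).symm

theorem eval_otherPoly_ne_zero {n : ℕ} {x : Fin n → ℂ} {i : Fin n} {z : ℂ} (hz : ∀ j, j ≠ i → z ≠ x j) :
    (otherPoly x i).eval z ≠ 0 := by
  rw [otherPoly, Polynomial.eval_prod]
  refine Finset.prod_ne_zero_iff.2 fun j hj => ?_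
  simpa using sub_ne_zero.2 (hz j (Finset.ne_of_mem_erase hj))

open Polynomial in
theorem eval_derivative_rootPoly {n : ℕ} {x : Fin n → ℂ} {i : Fin n} {z : ℂ}
    (hz : ∀ j, j ≠ i → z ≠ x j) :
    (derivative (rootPoly x)).eval z = (otherPoly x i).eval z * (1 + (z - x i) * otherSum x i z) := by
  rw [rootPoly_eq x i, derivative_mul, eval_add, eval_mul, eval_mul, otherPoly,
    eval_derivative_prod _ _ fun j hj => hz j (Finset.ne_of_mem_erase hj)]
  simp only [derivative_sub, derivative_X, derivative_C, sub_zero, eval_one, eval_sub, eval_X, eval_C,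
    otherSum]
  ring

open Polynomial in
theorem eval_derivative_derivative_rootPoly {n : ℕ} {x : Fin n → ℂ} {i : Fin n} {z : ℂ}
    (hz : ∀ j, j ≠ i → z ≠ x j) (h0 : 1 + (z - x i) * otherSum x i z = 0) :
    (derivative (derivative (rootPoly x))).eval z = (otherPoly x i).eval z *
      (otherSum x i z - (z - x i) * ∑ j ∈ Finset.univ.erase i, 1 / (z - x j) ^ 2) := by
  have hz' : ∀ j ∈ Finset.univ.erase i, z ≠ x j := fun j hj => hz j (Finset.ne_of_mem_erase hj)
  rw [rootPoly_eq x i, derivative_mul, derivative_add, derivative_mul, derivative_mul, otherPoly]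
  simp only [derivative_sub, derivative_X, derivative_C, sub_zero, derivative_one, eval_add, eval_mul,
    eval_one, eval_sub, eval_X, eval_C, eval_zero, eval_derivative_prod _ _ hz',
    eval_derivative_derivative_prod _ _ hz']
  change _ = _ * (otherSum x i z - _)
  rw [← otherSum]
  linear_combination (eval z (∏ j ∈ Finset.univ.erase i, (X - C (x j)))) * otherSum x i z * h0

theorem derivative_rootPoly_ne_zero {n : ℕ} (hn : 0 < n) (x : Fin n → ℂ) :
    Polynomial.derivative (rootPoly x) ≠ 0 := by
  have hdeg : (rootPoly x).natDegree = n := by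
    rw [rootPoly, Polynomial.natDegree_finsetProd_X_sub_C_eq_card, Finset.card_univ, Fintype.card_fin]
  intro h
  have := Polynomial.derivative_eq_zero.1 h
  omega

theorem mem_critPts_iff {n : ℕ} (hn : 0 < n) {x : Fin n → ℂ} {z : ℂ} :
    z ∈ critPts x ↔ (Polynomial.derivative (rootPoly x)).eval z = 0 := by
  rw [critPts, Polynomial.mem_roots (derivative_rootPoly_ne_zero hn x), Polynomial.IsRoot]

/-- Only the factors other than `z - x i` are divided out, so the equation also covers `z = x i`,
where it correctly fails. -/
theorem mem_critPts_iff_of_ne {n : ℕ} {x : Fin n → ℂ} {i : Fin n} {z : ℂ}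
    (hz : ∀ j, j ≠ i → z ≠ x j) : z ∈ critPts x ↔ 1 + (z - x i) * otherSum x i z = 0 := by
  rw [mem_critPts_iff i.pos, eval_derivative_rootPoly hz, mul_eq_zero,
    or_iff_right (eval_otherPoly_ne_zero hz)]

/-- Gauss–Lucas for the unit disk. -/
theorem norm_le_one_of_mem_critPts {n : ℕ} (hn : 2 ≤ n) {x : Fin n → ℂ} (hx : ∀ i, ‖x i‖ ≤ 1) {z : ℂ}
    (hz : z ∈ critPts x) : ‖z‖ ≤ 1 := by
  have hdeg : (rootPoly x).natDegree = n := by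
    rw [rootPoly, Polynomial.natDegree_finsetProd_X_sub_C_eq_card, Finset.card_univ, Fintype.card_fin]
  have hpos : 0 < (rootPoly x).degree := Polynomial.natDegree_pos_iff_degree_pos.1 (by omega)
  have h1 := Polynomial.rootSet_derivative_subset_convexHull_rootSet hpos
  have h2 : z ∈ (Polynomial.derivative (rootPoly x)).rootSet ℂ := by
    rw [Polynomial.mem_rootSet]
    refine ⟨derivative_rootPoly_ne_zero (by omega) x, ?_⟩
    rw [Polynomial.coe_aeval_eq_eval]
    exact (mem_critPts_iff (by omega)).1 hz
  have h3 : (rootPoly x).rootSet ℂ ⊆ Metric.closedBall 0 1 := by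
    intro w hw
    rw [Polynomial.mem_rootSet, Polynomial.coe_aeval_eq_eval, rootPoly, Polynomial.eval_prod,
      Finset.prod_eq_zero_iff] at hw
    obtain ⟨-, i, -, hi⟩ := hw
    have : w = x i := by simpa [sub_eq_zero] using hi
    rw [mem_closedBall_zero_iff, this]
    exact hx i
  simpa using convexHull_min h3 (convex_closedBall 0 1) (h1 h2)

/-! ### Existence, uniqueness and simplicity of nearby critical points -/

namespace EdgeRegular

variable {n : ℕ} {x : Fin n → ℂ} {τ ε₁ ε₃ : ℝ}

theorem two_le (h : EdgeRegular x τ ε₁ ε₃) : 2 ≤ n := by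
  have h1 := h.le_mul
  have h2 : τ ≤ 1 / 1000 := h.tau_le.trans h.eps_le
  have : (2 : ℝ) ≤ n := by nlinarith [h.n_pos]
  exact_mod_cast this

/-- Every critical point near the unit circle belongs to a root. -/
theorem exists_root_of_mem_critPts (h : EdgeRegular x τ ε₁ ε₃) {w : ℂ} (hw : w ∈ critPts x)
    (h1 : 1 - τ ≤ ‖w‖) :
    ∃ i, ‖w‖ ≤ ‖x i‖ ∧ ‖w - x i * (1 - 1 / n)‖ ≤ 15 * ε₁ / n := by
  have hn := h.n_pos
  have hτ := h.tau_pos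
  have hτ1 : τ ≤ 1 / 1000 := h.tau_le.trans h.eps_le
  have hε : 0 < ε₁ := hτ.trans_le h.tau_le
  have hw1 := norm_le_one_of_mem_critPts h.two_le h.norm_le hw
  have h2 : ‖w‖ ≤ 1 + τ := by linarith
  have : Nonempty (Fin n) := ⟨⟨0, by have := h.two_le; omega⟩⟩
  obtain ⟨i, -, hi⟩ := Finset.exists_min_image Finset.univ (fun i => ‖w - x i‖) Finset.univ_nonempty
  by_cases hd : ‖w - x i‖ ≤ 4 * τ
  · have hxi : 1 - 5 * τ ≤ ‖x i‖ := by
      have := norm_sub_norm_le w (x i)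
      linarith
    -- As `x i` is the nearest root, `|x i - x j| ≤ |w - x i| + |w - x j| ≤ 2 |w - x j|`.
    have hij : ∀ j, j ≠ i → ‖x i - x j‖ ≤ 2 * ‖w - x j‖ := fun j hj => by
      have h3 := hi j (Finset.mem_univ j)
      have h4 := norm_sub_le (w - x j) (w - x i)
      rw [sub_sub_sub_cancel_left] at h4
      linarith
    have hne : ∀ j, j ≠ i → w ≠ x j := by
      rintro j hj rfl
      have h3 := hij j hj
      rw [sub_self, norm_zero, mul_zero] at h3
      exact h.ne i j hxi hj (sub_eq_zero.1 (norm_le_zero_iff.1 h3))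
    have h0 := (mem_critPts_iff_of_ne hne).1 hw
    have happ := h.approx_of_eq_zero h1 h2 (h.norm_otherSum_sub_le h1 h2 hd hij) h0
    refine ⟨i, ?_, happ⟩
    -- The inward shift `|x i| / n` exceeds the error `15 ε₁ / n ≤ 0.015 / n`, so `w` has modulus at
    -- most that of its root.
    have h5 := norm_sub_norm_le w (x i * (1 - 1 / n))
    have h6 : ‖x i * (1 - 1 / (n : ℂ))‖ = ‖x i‖ * (1 - 1 / n) := by
      rw [norm_mul]
      congr 1
      rw [show (1 - 1 / (n : ℂ)) = ((1 - 1 / n : ℝ) : ℂ) by push_cast; rfl, Complex.norm_real,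
        Real.norm_eq_abs, abs_of_nonneg]
      linarith [h.inv_le]
    have h7 : 15 * ε₁ / n ≤ 15 / 1000 * (1 / n) := by
      rw [mul_one_div]
      gcongr
      linarith [h.eps_le]
    have h8 : 0 < 1 / (n : ℝ) := by positivity
    have h9 := h.inv_le
    nlinarith
  -- With no root within `4 τ`, the far sum is the whole logarithmic derivative. It vanishes at `w`,
  -- yet must be close to `n / w`.
  · exfalso
    have hne : ∀ j, w ≠ x j := by
      rintro j rfl
      have := hi j (Finset.mem_univ j)
      rw [sub_self, norm_zero] at this
      linarith
    have h0 := (mem_critPts_iff_of_ne fun j (_ : j ≠ i) => hne j).1 hw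
    have hsum : ∑ j, 1 / (w - x j) = 0 := by
      rw [← Finset.add_sum_erase _ _ (Finset.mem_univ i)]
      have h3 : w - x i ≠ 0 := sub_ne_zero.2 (hne i)
      have h4 : 1 / (w - x i) + otherSum x i w = (1 + (w - x i) * otherSum x i w) / (w - x i) := by
        field_simp
      rw [← otherSum, h4, h0, zero_div]
    have hfar := h.norm_far_sub_le h1 h2
    rw [Finset.filter_true_of_mem fun j hj => by linarith [hi j hj, not_le.1 hd], hsum, zero_sub,
      norm_neg, norm_div, Complex.norm_natCast, div_le_iff₀ (by linarith)] at hfar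
    nlinarith [h.eps_le, mul_pos hε hn, norm_nonneg w]

section NearRoot

variable {i : Fin n} {z w : ℂ}

theorem norm_sub_ge_half (h : EdgeRegular x τ ε₁ ε₃) (hi : 1 - τ / 2 ≤ ‖x i‖)
    (hz : ‖z - x i‖ ≤ 3 / n) {j : Fin n} (hj : j ≠ i) : ‖x i - x j‖ ≤ 2 * ‖z - x j‖ := by
  have h1 := h.separation (i := i) (j := j) (by linarith [h.tau_pos]) hj
  have h2 := norm_sub_le (z - x j) (z - x i)
  rw [sub_sub_sub_cancel_left] at h2
  have e : (80 : ℝ) / n = 80 * (1 / n) := by ring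
  have e' : (3 : ℝ) / n = 3 * (1 / n) := by ring
  have : 0 < 1 / (n : ℝ) := by have := h.n_pos; positivity
  rw [e] at h1; rw [e'] at hz
  linarith

theorem sub_pos_of_near (h : EdgeRegular x τ ε₁ ε₃) (hi : 1 - τ / 2 ≤ ‖x i‖)
    (hz : ‖z - x i‖ ≤ 3 / n) {j : Fin n} (hj : j ≠ i) : 0 < ‖z - x j‖ := by
  have h1 := h.norm_sub_ge_half hi hz hj
  have := h.n_pos
  have h2 := h.separation (i := i) (j := j) (by linarith [h.tau_pos]) hj
  have h3 : (0 : ℝ) < 80 / n := by positivity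
  linarith

theorem norm_mem_of_near (h : EdgeRegular x τ ε₁ ε₃) (hi : 1 - τ / 2 ≤ ‖x i‖)
    (hz : ‖z - x i‖ ≤ 3 / n) : 1 - τ ≤ ‖z‖ ∧ ‖z‖ ≤ 1 + τ ∧ ‖z - x i‖ ≤ 4 * τ := by
  have e' : (3 : ℝ) / n = 3 * (1 / n) := by ring
  have := h.inv_le
  have := h.tau_pos
  have h1 := abs_le.1 (abs_norm_sub_norm_le z (x i))
  rw [e'] at hz
  refine ⟨by linarith, by linarith [h.norm_le i], by linarith⟩

theorem otherSum_near (h : EdgeRegular x τ ε₁ ε₃) (hi : 1 - τ / 2 ≤ ‖x i‖)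
    (hz : ‖z - x i‖ ≤ 3 / n) : ‖otherSum x i z - n / z‖ ≤ 12 * ε₁ * n := by
  obtain ⟨h1, h2, h3⟩ := h.norm_mem_of_near hi hz
  exact h.norm_otherSum_sub_le h1 h2 h3 fun j hj => h.norm_sub_ge_half hi hz hj

theorem otherSum_near_ge (h : EdgeRegular x τ ε₁ ε₃) (hi : 1 - τ / 2 ≤ ‖x i‖)
    (hz : ‖z - x i‖ ≤ 3 / n) : 98 / 100 * n ≤ ‖otherSum x i z‖ := by
  obtain ⟨h1, h2, h3⟩ := h.norm_mem_of_near hi hz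
  exact h.norm_otherSum_ge h1 h2 (h.otherSum_near hi hz)

theorem norm_otherSum_sub_otherSum_le (h : EdgeRegular x τ ε₁ ε₃) (hi : 1 - τ / 2 ≤ ‖x i‖)
    (hz : ‖z - x i‖ ≤ 3 / n) (hw : ‖w - x i‖ ≤ 3 / n) :
    ‖otherSum x i z - otherSum x i w‖ ≤ 4 * otherEnergy x i * ‖z - w‖ := by
  rw [otherSum, otherSum, otherEnergy, ← Finset.sum_sub_distrib, Finset.mul_sum, Finset.sum_mul]
  refine (norm_sum_le _ _).trans (Finset.sum_le_sum fun j hj => ?_)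
  have hj := Finset.ne_of_mem_erase hj
  have hz0 := h.sub_pos_of_near hi hz hj
  have hw0 := h.sub_pos_of_near hi hw hj
  have hz1 := h.norm_sub_ge_half hi hz hj
  have hw1 := h.norm_sub_ge_half hi hw hj
  have hp : 0 < ‖x i - x j‖ := norm_pos_iff.2 (sub_ne_zero.2 (h.ne i j (by linarith [h.tau_pos]) hj))
  have e : 1 / (z - x j) - 1 / (w - x j) = (w - z) / ((z - x j) * (w - x j)) := by
    have := norm_pos_iff.1 hz0
    have := norm_pos_iff.1 hw0
    field_simp
    ring
  rw [e, norm_div, norm_mul, norm_sub_rev, mul_one_div, div_mul_eq_mul_div,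
    div_le_div_iff₀ (by positivity) (by positivity)]
  have : ‖x i - x j‖ ^ 2 ≤ 4 * (‖z - x j‖ * ‖w - x j‖) := by nlinarith
  nlinarith [norm_nonneg (z - w)]

theorem norm_inv_otherSum_sub_le (h : EdgeRegular x τ ε₁ ε₃) (hi : 1 - τ / 2 ≤ ‖x i‖)
    (hz : ‖z - x i‖ ≤ 3 / n) (hw : ‖w - x i‖ ≤ 3 / n) :
    ‖1 / otherSum x i z - 1 / otherSum x i w‖ ≤ 16 * otherEnergy x i / n ^ 2 * ‖z - w‖ := by
  have hn := h.n_pos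
  have hSz := h.otherSum_near_ge hi hz
  have hSw := h.otherSum_near_ge hi hw
  have hz0 : 0 < ‖otherSum x i z‖ := by linarith
  have hw0 : 0 < ‖otherSum x i w‖ := by linarith
  have hE := otherEnergy_nonneg x i
  have e : 1 / otherSum x i z - 1 / otherSum x i w =
      (otherSum x i w - otherSum x i z) / (otherSum x i z * otherSum x i w) := by
    have := norm_pos_iff.1 hz0
    have := norm_pos_iff.1 hw0
    field_simp
  rw [e, norm_div, norm_mul, norm_sub_rev, div_mul_eq_mul_div,
    div_le_div_iff₀ (by positivity) (by positivity)]
  have h1 := h.norm_otherSum_sub_otherSum_le hi hz hw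
  have h2 : (n : ℝ) ^ 2 ≤ 4 * (‖otherSum x i z‖ * ‖otherSum x i w‖) := by nlinarith
  calc ‖otherSum x i z - otherSum x i w‖ * (n : ℝ) ^ 2
      ≤ (4 * otherEnergy x i * ‖z - w‖) * (4 * (‖otherSum x i z‖ * ‖otherSum x i w‖)) := by gcongr
    _ = _ := by ring

/-- Banach's fixed point theorem for `z ↦ x i - 1 / S_i(z)`: the bound `|S_i| ≥ 0.98 n` keeps it
inside the ball, and the energy bound `n ^ 2 / 1000` makes its Lipschitz constant at most `16 /
1000`. -/
theorem exists_zero_near (h : EdgeRegular x τ ε₁ ε₃) (h3 : 0 ≤ ε₃) (hi : 1 - τ / 2 ≤ ‖x i‖) :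
    ∃ w : ℂ, ‖w - x i‖ ≤ 3 / n ∧ w - x i = -(1 / otherSum x i w) ∧
      ∀ v : ℂ, ‖v - x i‖ ≤ 3 / n → v - x i = -(1 / otherSum x i v) → v = w := by
  have hn := h.n_pos
  have hE := h.otherEnergy_le' h3 (i := i) (by linarith [h.tau_pos])
  set g : ℂ → ℂ := fun z => x i - 1 / otherSum x i z with hg
  have hmaps : Set.MapsTo g (Metric.closedBall (x i) (3 / n)) (Metric.closedBall (x i) (3 / n)) := by
    intro z hz
    rw [Metric.mem_closedBall, dist_eq_norm] at hz ⊢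
    have := h.otherSum_near_ge hi hz
    rw [hg, sub_sub_cancel_left, norm_neg, norm_div, norm_one,
      div_le_div_iff₀ (by linarith) hn]
    linarith
  have hlip : ∀ z w : ℂ, ‖z - x i‖ ≤ 3 / n → ‖w - x i‖ ≤ 3 / n → ‖g z - g w‖ ≤ 1 / 2 * ‖z - w‖ := by
    intro z w hz hw
    rw [hg, sub_sub_sub_cancel_left, norm_sub_rev]
    refine (h.norm_inv_otherSum_sub_le hi hz hw).trans ?_
    refine mul_le_mul_of_nonneg_right ?_ (norm_nonneg _)
    rw [div_le_iff₀ (by positivity)]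
    linarith [sq_nonneg (n : ℝ)]
  have hc : ContractingWith (1 / 2) (hmaps.restrict g _ _) := by
    refine ⟨by rw [← NNReal.coe_lt_coe]; norm_num, LipschitzWith.of_dist_le_mul fun z w => ?_⟩
    have h1 : ‖(z : ℂ) - x i‖ ≤ 3 / n := mem_closedBall_iff_norm.1 z.2
    have h2 : ‖(w : ℂ) - x i‖ ≤ 3 / n := mem_closedBall_iff_norm.1 w.2
    rw [Subtype.dist_eq, Subtype.dist_eq, dist_eq_norm, dist_eq_norm]
    simpa using hlip z w h1 h2
  obtain ⟨w, hws, hwf, -⟩ := hc.exists_fixedPoint' Metric.isClosed_closedBall.isComplete hmaps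
    (Metric.mem_closedBall_self (by positivity)) (edist_ne_top _ _)
  rw [Metric.mem_closedBall, dist_eq_norm] at hws
  have hwg : x i - 1 / otherSum x i w = w := hwf
  refine ⟨w, hws, by linear_combination -hwg, fun v hv hvg => ?_⟩
  have hvg' : g v = v := by rw [hg]; linear_combination -hvg
  have h5 := hlip v w hv hws
  rw [hvg', show g w = w from hwg] at h5
  have : ‖v - w‖ ≤ 0 := by linarith [norm_nonneg (v - w)]
  exact sub_eq_zero.1 (norm_le_zero_iff.1 this)

/-- Every root near the unit circle has exactly one critical point nearby. -/
theorem exists_critPt (h : EdgeRegular x τ ε₁ ε₃) (h3 : 0 ≤ ε₃) (hi : 1 - τ / 2 ≤ ‖x i‖) :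
    ∃ w : ℂ, (critPts x).filter (fun v => ‖v - x i‖ ≤ 3 / (n : ℝ)) = {w} ∧
      ‖w - x i + rootShift x i‖ ≤ 48 * otherEnergy x i / n ^ 3 + 2 / n ^ 2 ∧
      ‖w - x i * (1 - 1 / n)‖ ≤ 15 * ε₁ / n := by
  have hn := h.n_pos
  have hτ := h.tau_pos
  obtain ⟨w, hw, hw0, huniq⟩ := h.exists_zero_near h3 hi
  have hne : ∀ z : ℂ, ‖z - x i‖ ≤ 3 / n → ∀ j, j ≠ i → z ≠ x j := fun z hz j hj => by
    rintro rfl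
    have := h.sub_pos_of_near hi hz hj
    simp at this
  have hS0 : ∀ z : ℂ, ‖z - x i‖ ≤ 3 / n → otherSum x i z ≠ 0 := fun z hz => by
    have := h.otherSum_near_ge hi hz
    exact norm_pos_iff.1 (by linarith)
  have hcrit : ∀ z : ℂ, ‖z - x i‖ ≤ 3 / n → (z ∈ critPts x ↔ z - x i = -(1 / otherSum x i z)) := by
    intro z hz
    rw [mem_critPts_iff_of_ne (hne z hz)]
    have := hS0 z hz
    constructor
    · intro h0
      field_simp
      linear_combination h0
    · intro h0
      rw [h0]
      field_simp
      ring
  have hwc : w ∈ critPts x := (hcrit w hw).2 hw0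
  have hweq := (mem_critPts_iff_of_ne (hne w hw)).1 hwc
  have hxx : ‖x i - x i‖ ≤ 3 / n := by rw [sub_self, norm_zero]; positivity
  have hE := h.otherEnergy_le' h3 (i := i) (by linarith)
  refine ⟨w, ?_, ?_, ?_⟩
  -- Simplicity: up to a nonzero factor the second derivative at `w` is `S - T`, with `S` the value
  -- of `otherSum` and `T` the quantity bounded here. Since `|S| ≥ 0.98 n` and `|T| ≤ n / 10`, it
  -- cannot vanish.
  · have hT : ‖(w - x i) * ∑ j ∈ Finset.univ.erase i, 1 / (w - x j) ^ 2‖ ≤ n / 10 := by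
      have h1 : ‖∑ j ∈ Finset.univ.erase i, 1 / (w - x j) ^ 2‖ ≤ 4 * otherEnergy x i := by
        rw [otherEnergy, Finset.mul_sum]
        refine (norm_sum_le _ _).trans (Finset.sum_le_sum fun j hj => ?_)
        have hj := Finset.ne_of_mem_erase hj
        have hd := h.norm_sub_ge_half hi hw hj
        have hp : 0 < ‖x i - x j‖ := norm_pos_iff.2 (sub_ne_zero.2 (h.ne i j (by linarith) hj))
        have hq := h.sub_pos_of_near hi hw hj
        rw [norm_div, norm_one, norm_pow, mul_one_div, div_le_div_iff₀ (by positivity) (by positivity)]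
        nlinarith
      rw [norm_mul]
      calc _ ≤ 3 / n * (4 * ((n : ℝ) ^ 2 / 1000)) := by
            gcongr
            exact h1.trans (by linarith)
        _ = 12 / 1000 * n := by field_simp; norm_num
        _ ≤ _ := by linarith
    have hsimple : ¬ (Polynomial.derivative (Polynomial.derivative (rootPoly x))).IsRoot w := by
      rw [Polynomial.IsRoot, eval_derivative_derivative_rootPoly (hne w hw) hweq, mul_eq_zero,
        or_iff_right (eval_otherPoly_ne_zero (hne w hw))]
      intro h0
      rw [← sub_eq_zero.1 h0] at hT
      linarith [h.otherSum_near_ge hi hw]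
    have hcount : (critPts x).count w = 1 := by
      have hp := derivative_rootPoly_ne_zero i.pos x
      have h1 : ¬ 1 < (Polynomial.derivative (rootPoly x)).rootMultiplicity w := fun h1 =>
        hsimple ((Polynomial.one_lt_rootMultiplicity_iff_isRoot hp).1 h1).2
      have h2 : 0 < (critPts x).count w := Multiset.count_pos.2 hwc
      rw [critPts, Polynomial.count_roots] at h2 ⊢
      omega
    refine Multiset.ext.2 fun a => ?_
    rw [Multiset.count_filter, Multiset.count_singleton]
    by_cases haw : a = w
    · rw [haw, if_pos hw, if_pos rfl, hcount]
    · rw [if_neg haw]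
      split_ifs with ha
      · exact Multiset.count_eq_zero.2 fun hac => haw (huniq a ha ((hcrit a ha).1 hac))
      · rfl
  · have hn0 : (n : ℂ) ≠ 0 := by exact_mod_cast hn.ne'
    have hn1 : (n : ℂ) - 1 ≠ 0 := by
      have : (n : ℂ) ≠ 1 := by
        have := h.two_le
        exact_mod_cast (by omega : n ≠ 1)
      exact sub_ne_zero.2 this
    have hSx := hS0 _ hxx
    -- The normalisation by `n` and `n - 1` makes `rootShift` equal to `(1 - 1/n) / S_i(x i)`. The
    -- extra `1/n` costs the term `2 / n ^ 2`.
    have e : w - x i + rootShift x i = (1 / otherSum x i (x i) - 1 / otherSum x i w) -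
        1 / n * (1 / otherSum x i (x i)) := by
      have e1 : rootShift x i = 1 / n * (1 / (1 / ((n : ℂ) - 1) * otherSum x i (x i))) := rfl
      rw [hw0, e1]
      field_simp
      ring
    rw [e]
    refine (norm_sub_le _ _).trans (add_le_add ?_ ?_)
    · refine (h.norm_inv_otherSum_sub_le hi hxx hw).trans ?_
      rw [norm_sub_rev]
      have := otherEnergy_nonneg x i
      calc _ ≤ 16 * otherEnergy x i / n ^ 2 * (3 / n) := by gcongr
        _ = _ := by field_simp; ring
    · have := h.otherSum_near_ge hi hxx
      rw [norm_mul, norm_div, norm_div, norm_one, Complex.norm_natCast, one_div_mul_one_div,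
        div_le_div_iff₀ (by positivity) (by positivity)]
      nlinarith
  · obtain ⟨h1, h2, -⟩ := h.norm_mem_of_near hi hw
    exact h.approx_of_eq_zero h1 h2 (h.otherSum_near hi hw) hweq

end NearRoot

end EdgeRegular

/-! ### Order statistics of the roots -/

/-- The permutation that lists a configuration in decreasing spiral order. -/
noncomputable def descendingPerm {n : ℕ} (x : Fin n → ℂ) : Equiv.Perm (Fin n) :=
  Fin.revPerm.trans (Tuple.sort fun i => spiralKey (x i))

theorem descending_eq {n : ℕ} (x : Fin n → ℂ) (i : Fin n) : descending x i = x (descendingPerm x i) :=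
  rfl

theorem norm_descending_antitone {n : ℕ} (x : Fin n → ℂ) {i j : Fin n} (hij : i ≤ j) :
    ‖descending x j‖ ≤ ‖descending x i‖ := by
  have h := Tuple.monotone_sort (fun i => spiralKey (x i)) (Fin.rev_le_rev.2 hij)
  rcases Prod.Lex.toLex_le_toLex.1 h with h | h
  · exact h.le
  · exact h.1.le

theorem rootShift_descending {n : ℕ} (x : Fin n → ℂ) (i : Fin n) :
    rootShift (descending x) i = rootShift x (descendingPerm x i) := by
  refine congrArg (fun S : ℂ => 1 / (n : ℂ) * (1 / (1 / ((n : ℂ) - 1) * S))) (Finset.sum_bij'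
    (fun j _ => descendingPerm x j) (fun j _ => (descendingPerm x).symm j) ?_ ?_ ?_ ?_ ?_)
  · intro j hj
    simpa using hj
  · intro j hj
    rw [Finset.mem_erase] at hj ⊢
    refine ⟨fun h => hj.1 ?_, Finset.mem_univ _⟩
    rw [← h, Equiv.apply_symm_apply]
  · simp
  · simp
  · intro j _
    rfl

/-- Otherwise all of the at least `L` roots of modulus at least `r` would have rank below `i < L`.
-/
theorem le_norm_descending {n : ℕ} {x : Fin n → ℂ} {L : ℕ} {r : ℝ}
    (hc : L ≤ (Finset.univ.filter fun i => r ≤ ‖x i‖).card) {i : Fin n} (hi : (i : ℕ) < L) :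
    r ≤ ‖descending x i‖ := by
  by_contra hlt
  rw [not_le] at hlt
  have h1 : (Finset.univ.filter fun i => r ≤ ‖x i‖).card ≤ (Finset.range i).card := by
    refine Finset.card_le_card_of_injOn (fun j => ((descendingPerm x).symm j : ℕ)) ?_ ?_
    · intro j hj
      simp only [Finset.coe_filter, Finset.mem_univ, true_and, Set.mem_ofPred_eq] at hj
      simp only [Finset.coe_range, Set.mem_Iio]
      by_contra hij
      have h2 := norm_descending_antitone x (i := i) (j := (descendingPerm x).symm j) (not_lt.1 hij)
      rw [descending_eq, Equiv.apply_symm_apply] at h2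
      linarith
    · intro j _ k _ hjk
      exact (descendingPerm x).symm.injective (Fin.ext hjk)
  rw [Finset.card_range] at h1
  omega

/-- The pairing of the roots and critical points of `∏ i, (z - x i)` in the annulus of width `L / n`,
with error terms `t`, `B` and `η`. -/
def PairingHolds {n : ℕ} (x : Fin n → ℂ) (L : ℕ) (N B t s u η : ℝ) : Prop :=
    (N ≤ ({w : ℂ | w ∈ critPts x ∧ w ∈ edgeAnnulus (L / n)}.ncard : ℝ)) ∧
    (∀ i : Fin n, x i ∈ edgeAnnulus (L / n) →
      ∃ w : ℂ, (critPts x).filter (fun v => ‖v - x i‖ ≤ 3 / (n : ℝ)) = {w} ∧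
        ‖w - x i + rootShift x i‖ < B ∧ ‖w - x i * (1 - 1 / (n : ℂ))‖ < t) ∧
    (∃ ι : {w : ℂ // w ∈ critPts x ∧ w ∈ edgeAnnulus (L / n)} → Fin n,
      Function.Injective ι ∧
      ∀ w, x (ι w) ∈ edgeAnnulus (L / n) ∧
        (∃ e : ℂ, ‖e‖ ≤ η ∧ (w : ℂ) = x (ι w) * (1 - 1 / (n : ℂ) + e)) ∧
        ‖(w : ℂ) - x (ι w) * (1 - 1 / (n : ℂ))‖ < t ∧
        (∀ j : Fin n, x j ∈ edgeAnnulus (L / n) →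
          ‖(w : ℂ) - x j * (1 - 1 / (n : ℂ))‖ < t → j = ι w)) ∧
    (∀ i : Fin n, (i : ℕ) < L → 1 - s ≤ ‖descending x i‖ ∧ ‖descending x i‖ ≤ 1 - u) ∧
    (∀ W : Fin (n - 1) → ℂ, IsCritListing x W →
      ∀ (k : Fin (n - 1)) (i : Fin n), (k : ℕ) = i → (i : ℕ) < L →
        ‖W k - descending x i * (1 - 1 / (n : ℂ))‖ < t ∧
        ‖W k - descending x i + rootShift (descending x) i‖ < B ∧
        (critPts x).filter (fun v => ‖v - descending x i‖ ≤ 3 / (n : ℝ)) = {W k})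

/-! ### Matching roots with critical points and comparing their orders -/

namespace EdgeRegular

variable {n : ℕ} {x : Fin n → ℂ} {τ ε₁ ε₃ t : ℝ} {L : ℕ}

theorem norm_one_sub_inv (h : EdgeRegular x τ ε₁ ε₃) (z : ℂ) :
    ‖z * (1 - 1 / (n : ℂ))‖ = ‖z‖ * (1 - 1 / n) := by
  rw [norm_mul]
  congr 1
  rw [show (1 - 1 / (n : ℂ)) = ((1 - 1 / n : ℝ) : ℂ) by push_cast; rfl, Complex.norm_real,
    Real.norm_eq_abs, abs_of_nonneg]
  linarith [h.inv_le, h.tau_le, h.eps_le]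

theorem near_of_approx (h : EdgeRegular x τ ε₁ ε₃) (ht : t ≤ 1 / n) {w : ℂ} {i : Fin n}
    (hw : ‖w - x i * (1 - 1 / n)‖ ≤ t) : ‖w - x i‖ ≤ 3 / n := by
  have e : w - x i = (w - x i * (1 - 1 / n)) - x i / n := by ring
  have h1 : ‖x i / n‖ ≤ 1 / (n : ℝ) := by
    rw [norm_div, Complex.norm_natCast]
    have := h.n_pos
    gcongr
    exact h.norm_le i
  have e' : (3 : ℝ) / n = 3 * (1 / n) := by ring
  have : 0 < 1 / (n : ℝ) := by have := h.n_pos; positivity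
  rw [e, e']
  linarith [norm_sub_le (w - x i * (1 - 1 / n)) (x i / n)]

theorem eq_of_approx (h : EdgeRegular x τ ε₁ ε₃) {w : ℂ} {i j : Fin n}
    (hi : 1 - 5 * τ ≤ ‖x i‖) (hw : ‖w - x i‖ ≤ 3 / n) (hw' : ‖w - x j‖ ≤ 3 / n) : j = i := by
  by_contra hj
  have h1 := h.separation hi hj
  have h2 := norm_sub_le (w - x j) (w - x i)
  rw [sub_sub_sub_cancel_left] at h2
  have e' : (3 : ℝ) / n = 3 * (1 / n) := by ring
  have e : (80 : ℝ) / n = 80 * (1 / n) := by ring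
  have : 0 < 1 / (n : ℝ) := by have := h.n_pos; positivity
  rw [e] at h1
  rw [e'] at hw hw'
  linarith

theorem exists_root (h : EdgeRegular x τ ε₁ ε₃) (hLτ : (L : ℝ) / n ≤ τ / 2) (ht : 15 * ε₁ / n < t)
    (ht' : t ≤ 1 / n) {w : ℂ} (hw : w ∈ critPts x) (hwA : 1 - (L : ℝ) / n ≤ ‖w‖) :
    ∃ i, 1 - (L : ℝ) / n ≤ ‖x i‖ ∧ ‖w - x i * (1 - 1 / n)‖ ≤ 15 * ε₁ / n ∧ ‖w - x i‖ ≤ 3 / n := by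
  obtain ⟨i, hi, hwi⟩ := h.exists_root_of_mem_critPts hw (by linarith [h.tau_pos])
  exact ⟨i, hwA.trans hi, hwi, h.near_of_approx ht' (hwi.trans ht.le)⟩

theorem eq_of_near (h : EdgeRegular x τ ε₁ ε₃) (h3 : 0 ≤ ε₃) {i : Fin n} (hi : 1 - τ / 2 ≤ ‖x i‖)
    {v w : ℂ} (hv : v ∈ critPts x) (hw : w ∈ critPts x) (hvi : ‖v - x i‖ ≤ 3 / n)
    (hwi : ‖w - x i‖ ≤ 3 / n) : v = w := by
  obtain ⟨w₀, hf, -⟩ := h.exists_critPt h3 hi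
  have h1 : v ∈ (critPts x).filter (fun v => ‖v - x i‖ ≤ 3 / (n : ℝ)) := Multiset.mem_filter.2 ⟨hv, hvi⟩
  have h2 : w ∈ (critPts x).filter (fun v => ‖v - x i‖ ≤ 3 / (n : ℝ)) := Multiset.mem_filter.2 ⟨hw, hwi⟩
  rw [hf, Multiset.mem_singleton] at h1 h2
  rw [h1, h2]

theorem count_eq_one (h : EdgeRegular x τ ε₁ ε₃) (h3 : 0 ≤ ε₃) {i : Fin n} (hi : 1 - τ / 2 ≤ ‖x i‖)
    {v : ℂ} (hv : v ∈ critPts x) (hvi : ‖v - x i‖ ≤ 3 / n) : (critPts x).count v = 1 := by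
  obtain ⟨w₀, hf, -⟩ := h.exists_critPt h3 hi
  have h1 : v ∈ (critPts x).filter (fun v => ‖v - x i‖ ≤ 3 / (n : ℝ)) := Multiset.mem_filter.2 ⟨hv, hvi⟩
  have h2 := Multiset.count_filter_of_pos (s := critPts x) (p := fun v => ‖v - x i‖ ≤ 3 / (n : ℝ)) hvi
  rw [← h2, hf]
  rw [hf, Multiset.mem_singleton] at h1
  rw [h1, Multiset.count_singleton_self]

theorem listing_injOn {W : Fin (n - 1) → ℂ} (hW : IsCritListing x W) {k k' : Fin (n - 1)}
    (hc : (critPts x).count (W k) = 1) (hkk : W k = W k') : k = k' := by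
  rw [← hW.1, Multiset.count_map, Multiset.card_eq_one] at hc
  obtain ⟨a, ha⟩ := hc
  have h1 : k ∈ Multiset.filter (fun a => W k = W a) (Finset.univ : Finset (Fin (n - 1))).val :=
    Multiset.mem_filter.2 ⟨Finset.mem_univ k, rfl⟩
  have h2 : k' ∈ Multiset.filter (fun a => W k = W a) (Finset.univ : Finset (Fin (n - 1))).val :=
    Multiset.mem_filter.2 ⟨Finset.mem_univ k', hkk⟩
  rw [ha, Multiset.mem_singleton] at h1 h2
  rw [h1, h2]

/-- If the roots of largest modulus are well separated in modulus, then the ordering by modulus of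
the critical points follows that of the roots. -/
theorem listing_near (h : EdgeRegular x τ ε₁ ε₃) (h3 : 0 ≤ ε₃) (hLτ : (L : ℝ) / n ≤ τ / 2)
    (ht : 15 * ε₁ / n < t) (ht' : t ≤ 1 / n) {s : ℝ} (hs : s + 3 / n ≤ L / n)
    (htop : ∀ i : Fin n, (i : ℕ) < L → 1 - s ≤ ‖descending x i‖)
    (hgap : ∀ i j, i ≠ j → 1 - s ≤ ‖x i‖ → 8 * t < |‖x i‖ - ‖x j‖|)
    {W : Fin (n - 1) → ℂ} (hW : IsCritListing x W) {k : Fin (n - 1)} {i : Fin n} (hki : (k : ℕ) = i)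
    (hi : (i : ℕ) < L) : ‖W k - descending x i‖ ≤ 3 / n := by
  have hn := h.n_pos
  have : Nonempty (Fin n) := ⟨i⟩
  have : Nonempty (Fin (n - 1)) := ⟨k⟩
  have hn1 : 0 < 1 / (n : ℝ) := by positivity
  have hinv : 1 / (n : ℝ) ≤ 1 / 2 := by linarith [h.inv_le, h.tau_le, h.eps_le]
  have e3 : (3 : ℝ) / n = 3 * (1 / n) := by ring
  have hD : ∀ j : Fin n, (j : ℕ) < L → 1 - τ / 2 ≤ ‖x (descendingPerm x j)‖ := fun j hj => by
    have := htop j hj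
    rw [descending_eq] at this
    linarith
  have hex : ∀ j : Fin n, (j : ℕ) < L → ∃ m : Fin (n - 1), ‖W m - descending x j‖ ≤ 3 / n ∧
      ‖W m - descending x j * (1 - 1 / n)‖ < t := by
    intro j hj
    obtain ⟨w, hf, -, hw⟩ := h.exists_critPt h3 (hD j hj)
    have hwm : w ∈ (critPts x).filter (fun v => ‖v - x (descendingPerm x j)‖ ≤ 3 / (n : ℝ)) := by
      rw [hf]; exact Multiset.mem_singleton_self w
    rw [Multiset.mem_filter, ← hW.1, Multiset.mem_map] at hwm
    obtain ⟨⟨m, -, rfl⟩, hm⟩ := hwm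
    exact ⟨m, hm, hw.trans_lt ht⟩
  have hWc : ∀ m, W m ∈ critPts x := fun m => by
    rw [← hW.1]
    exact Multiset.mem_map_of_mem W (Finset.mem_univ m)
  have hbig : ∀ j : Fin n, (j : ℕ) < L → ∀ m, ‖W m - descending x j‖ ≤ 3 / n →
      1 - (L : ℝ) / n ≤ ‖W m‖ := by
    intro j hj m hm
    have h1 := htop j hj
    have h2 := abs_le.1 ((abs_norm_sub_norm_le _ _).trans hm)
    linarith
  have hnorm : ∀ (m : Fin (n - 1)) (a : ℂ), ‖W m - a * (1 - 1 / n)‖ < t →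
      |‖W m‖ - ‖a‖ * (1 - 1 / n)| < t := fun m a hm => by
    rw [← h.norm_one_sub_inv]
    exact (abs_norm_sub_norm_le _ _).trans_lt hm
  obtain ⟨m, hm, hmt⟩ := hex i hi
  have hmn := abs_lt.1 (hnorm m _ hmt)
  have hcount : ∀ m, 1 - (L : ℝ) / n ≤ ‖W m‖ → (critPts x).count (W m) = 1 := fun m hmA => by
    obtain ⟨r, hr, -, hr2⟩ := h.exists_root hLτ ht ht' (hWc m) hmA
    exact h.count_eq_one h3 (by linarith) (hWc m) hr2
  -- Here `m` is the position of the critical point near the root of rank `i`. Equality follows from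
  -- two injections: positions before `m` into ranks before `i`, and conversely.
  suffices hmi : (m : ℕ) = i by
    have : k = m := Fin.ext (hki.trans hmi.symm)
    rw [this]; exact hm
  have ht0 : 0 < t := by
    refine lt_of_le_of_lt ?_ ht
    have : 0 ≤ ε₁ := h3.trans h.eps_le'
    positivity
  refine le_antisymm ?_ ?_
  · have hroot : ∀ q : Fin (n - 1), q < m → ∃ r : Fin n, (r : ℕ) < i ∧
        ‖W q - descending x r‖ ≤ 3 / n := by
      intro q hq
      have hqn : ‖W m‖ ≤ ‖W q‖ := hW.2 hq.le
      have hqA : 1 - (L : ℝ) / n ≤ ‖W q‖ := (hbig i hi m hm).trans hqn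
      obtain ⟨r, hr, hrt, hr3⟩ := h.exists_root hLτ ht ht' (hWc q) hqA
      refine ⟨(descendingPerm x).symm r, ?_, by rwa [descending_eq, Equiv.apply_symm_apply]⟩
      have hrn := abs_lt.1 (hnorm q _ (hrt.trans_lt ht))
      by_contra hri
      have h1 := norm_descending_antitone x (i := i) (j := (descendingPerm x).symm r) (not_lt.1 hri)
      have h2 := htop i hi
      rw [descending_eq, Equiv.apply_symm_apply] at h1
      rw [descending_eq] at h1 h2 hmn
      -- If `q` belongs to the root of rank `i` itself, it repeats the simple critical point `W m`.
      -- Otherwise the modulus gap exceeds `8 t`; the factor `1 - 1/n ≥ 1/2` leaves more than `4 t`,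
      -- and two errors `t` cannot reverse the order.
      by_cases hr4 : descendingPerm x i = r
      · have hqm : W q = W m := by
          refine h.eq_of_near h3 (i := r) (by linarith) (hWc q) (hWc m) hr3 ?_
          rw [← hr4]; exact hm
        exact hq.ne (listing_injOn hW (hcount q hqA) hqm)
      · have h5 := hgap _ r hr4 h2
        rw [abs_of_nonneg (by linarith)] at h5
        nlinarith [norm_nonneg (x r)]
    choose! ρ hρ1 hρ2 using hroot
    have hcard : (Finset.univ.filter fun q : Fin (n - 1) => q < m).card ≤ (Finset.range i).card := by
      refine Finset.card_le_card_of_injOn (fun q => (ρ q : ℕ)) ?_ ?_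
      · intro q hq
        simpa using hρ1 q (by simpa using hq)
      · intro q hq q' hq' hqq
        have hq : q < m := by simpa using hq
        have hq' : q' < m := by simpa using hq'
        have hqA : 1 - (L : ℝ) / n ≤ ‖W q‖ := (hbig i hi m hm).trans (hW.2 hq.le)
        have e : ρ q = ρ q' := Fin.ext hqq
        refine listing_injOn hW (hcount q hqA) ?_
        refine h.eq_of_near h3 (hD (ρ q) ((hρ1 q hq).trans hi)) (hWc q) (hWc q') (hρ2 q hq) ?_
        rw [e]; exact hρ2 q' hq'
    rw [Finset.card_range] at hcard
    have : (Finset.univ.filter fun q : Fin (n - 1) => q < m) = Finset.Iio m := by ext; simp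
    rw [this, Fin.card_Iio] at hcard
    exact hcard
  · choose! κ hκ1 hκ2 using hex
    have hlt : ∀ j : Fin n, j < i → κ j < m := by
      intro j hj
      have hjL : (j : ℕ) < L := lt_trans hj hi
      have h1 := norm_descending_antitone x hj.le
      have h2 := htop i hi
      have h4 := abs_lt.1 (hnorm _ _ (hκ2 j hjL))
      by_contra hmk
      have h5 : ‖W (κ j)‖ ≤ ‖W m‖ := hW.2 (not_lt.1 hmk)
      rw [descending_eq] at h1 h2 h4 hmn
      rw [descending_eq] at h1
      have h6 := hgap _ (descendingPerm x j)
        (fun hc => hj.ne ((descendingPerm x).injective hc).symm) h2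
      rw [abs_sub_comm, abs_of_nonneg (by linarith)] at h6
      nlinarith
    have hcard : (Finset.univ.filter fun j : Fin n => j < i).card ≤ (Finset.range m).card := by
      refine Finset.card_le_card_of_injOn (fun j => (κ j : ℕ)) ?_ ?_
      · intro j hj
        simpa using hlt j (by simpa using hj)
      · intro j hj j' hj' hjj
        have hj : j < i := by simpa using hj
        have hj' : j' < i := by simpa using hj'
        have e : κ j = κ j' := Fin.ext hjj
        have hjL : (j : ℕ) < L := lt_trans hj hi
        have h1 := hκ1 j' (lt_trans hj' hi)
        rw [← e] at h1
        exact ((descendingPerm x).injective (h.eq_of_approx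
          (by linarith [hD j hjL, h.tau_pos]) (hκ1 j hjL) h1)).symm
    rw [Finset.card_range] at hcard
    have : (Finset.univ.filter fun q : Fin n => q < i) = Finset.Iio i := by ext; simp
    rw [this, Fin.card_Iio] at hcard
    exact hcard

/-- The pairing of roots and critical points near the unit circle for a regular configuration. -/
theorem pairing (h : EdgeRegular x τ ε₁ ε₃) (h3 : 0 ≤ ε₃) (hL : 4 ≤ L) (hLτ : (L : ℝ) / n ≤ τ / 2)
    (ht : 15 * ε₁ / n < t) (ht' : t ≤ 1 / n) {s u N B η : ℝ} (hs : s + 3 / n ≤ L / n)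
    (hη : 30 * ε₁ / n ≤ η)
    (hB : 48 * (3 * (ε₁ * n) / τ + (ε₃ * n) ^ 2) / n ^ 3 + 2 / (n : ℝ) ^ 2 < B)
    (hmany : N ≤ ((Finset.univ.filter fun i => 1 - 1 / (n : ℝ) ≤ ‖x i‖).card : ℝ))
    (hmax : ∀ i, ‖x i‖ ≤ 1 - u)
    (htop : L ≤ (Finset.univ.filter fun i => 1 - s ≤ ‖x i‖).card)
    (hgap : ∀ i j, i ≠ j → 1 - s ≤ ‖x i‖ → 8 * t < |‖x i‖ - ‖x j‖|) :
    PairingHolds x L N B t s u η := by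
  have hn := h.n_pos
  have hτ := h.tau_pos
  have hn1 : 0 < 1 / (n : ℝ) := by positivity
  have hε : 0 < ε₁ := hτ.trans_le h.tau_le
  have e3 : (3 : ℝ) / n = 3 * (1 / n) := by ring
  have key : ∀ i : Fin n, 1 - τ / 2 ≤ ‖x i‖ →
      ∃ w : ℂ, (critPts x).filter (fun v => ‖v - x i‖ ≤ 3 / (n : ℝ)) = {w} ∧
        ‖w - x i + rootShift x i‖ < B ∧ ‖w - x i * (1 - 1 / (n : ℂ))‖ < t := by
    intro i hi
    obtain ⟨w, h1, h2, h4⟩ := h.exists_critPt h3 hi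
    refine ⟨w, h1, lt_of_le_of_lt (h2.trans ?_) hB, h4.trans_lt ht⟩
    gcongr
    exact h.otherEnergy_le (by linarith)
  have hmem : ∀ {i : Fin n} {w : ℂ}, (critPts x).filter (fun v => ‖v - x i‖ ≤ 3 / (n : ℝ)) = {w} →
      w ∈ critPts x ∧ ‖w - x i‖ ≤ 3 / n := by
    intro i w hf
    rw [← Multiset.mem_filter (p := fun v => ‖v - x i‖ ≤ 3 / (n : ℝ)), hf]
    exact Multiset.mem_singleton_self w
  refine ⟨?_, fun i hi => key i (by linarith [hi.1]), ?_, fun i hi => ⟨?_, ?_⟩, ?_⟩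
  · refine hmany.trans ?_
    have hex : ∀ i, 1 - 1 / (n : ℝ) ≤ ‖x i‖ → ∃ w, w ∈ critPts x ∧ ‖w - x i‖ ≤ 3 / n := fun i hi => by
      obtain ⟨w, hf, -⟩ := key i (by linarith [h.inv_le])
      exact ⟨w, hmem hf⟩
    choose! ψ hψ1 hψ2 using hex
    rw [← Finset.card_image_of_injOn (f := ψ) (s := Finset.univ.filter fun i => 1 - 1 / (n : ℝ) ≤ ‖x i‖),
      ← Set.ncard_coe_finset]
    · refine Nat.cast_le.2 (Set.ncard_le_ncard ?_ ?_)
      · intro w hw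
        simp only [Finset.coe_image, Finset.coe_filter, Finset.mem_univ, true_and, Set.mem_image,
          Set.mem_ofPred_eq] at hw
        obtain ⟨i, hi, rfl⟩ := hw
        -- A root of modulus at least `1 - 1/n` has its critical point at modulus at least `1 -
        -- 4/n`, inside the annulus because `L ≥ 4`.
        have h5 : (4 : ℝ) * (1 / n) ≤ L / n := by
          rw [mul_one_div]
          gcongr
          exact_mod_cast hL
        have h6 := abs_le.1 ((abs_norm_sub_norm_le _ _).trans (hψ2 i hi))
        exact ⟨hψ1 i hi, by linarith, norm_le_one_of_mem_critPts h.two_le h.norm_le (hψ1 i hi)⟩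
      · refine (critPts x).toFinset.finite_toSet.subset fun w hw => ?_
        simpa using hw.1
    · intro i hi j hj hij
      have hi : 1 - 1 / (n : ℝ) ≤ ‖x i‖ := by simpa using hi
      have hj : 1 - 1 / (n : ℝ) ≤ ‖x j‖ := by simpa using hj
      have h7 := hψ2 j hj
      rw [← hij] at h7
      exact (h.eq_of_approx (by linarith [h.inv_le]) (hψ2 i hi) h7).symm
  · have hr : ∀ w : {w : ℂ // w ∈ critPts x ∧ w ∈ edgeAnnulus (L / n)}, ∃ i : Fin n,
        1 - (L : ℝ) / n ≤ ‖x i‖ ∧ ‖(w : ℂ) - x i * (1 - 1 / n)‖ ≤ 15 * ε₁ / n ∧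
          ‖(w : ℂ) - x i‖ ≤ 3 / n := fun w => h.exists_root hLτ ht ht' w.2.1 w.2.2.1
    choose ι h1 h2 h4 using hr
    refine ⟨ι, fun w w' hww => ?_, fun w => ⟨⟨h1 w, h.norm_le _⟩, ?_, (h2 w).trans_lt ht,
      fun j hj hjt => ?_⟩⟩
    · refine Subtype.ext (h.eq_of_near h3 (i := ι w) (by linarith [h1 w]) w.2.1 w'.2.1 (h4 w) ?_)
      rw [hww]; exact h4 w'
    · have hx2 : 1 / 2 ≤ ‖x (ι w)‖ := by linarith [h1 w, h.tau_le, h.eps_le]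
      have hx0 : x (ι w) ≠ 0 := norm_pos_iff.1 (by linarith)
      -- The error relative to the root; since `|x (ι w)| ≥ 1/2`, the constant `15` becomes at most
      -- `30`.
      refine ⟨((w : ℂ) - x (ι w) * (1 - 1 / n)) / x (ι w), ?_, ?_⟩
      · refine le_trans ?_ hη
        rw [norm_div, div_le_iff₀ (by linarith)]
        have h5 := h2 w
        have e : 30 * ε₁ / (n : ℝ) = 2 * (15 * ε₁ / n) := by ring
        have h6 : 0 ≤ 15 * ε₁ / (n : ℝ) := by positivity
        rw [e]
        nlinarith
      · field_simp
        ring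
    · exact h.eq_of_approx (by linarith [h1 w]) (h4 w) (h.near_of_approx ht' hjt.le)
  · exact le_norm_descending htop hi
  · exact hmax _
  · intro W hW k i hki hi
    have hnear := h.listing_near h3 hLτ ht ht' hs (fun i hi => le_norm_descending htop hi) hgap hW hki hi
    have h1 := le_norm_descending htop hi
    rw [descending_eq] at hnear h1 ⊢
    obtain ⟨w, hf, hB', ht2⟩ := key (descendingPerm x i) (by linarith)
    have hWk : W k = w := by
      have hWc : W k ∈ critPts x := by
        rw [← hW.1]
        exact Multiset.mem_map_of_mem W (Finset.mem_univ k)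
      have := (Multiset.mem_filter
        (p := fun v => ‖v - x (descendingPerm x i)‖ ≤ 3 / (n : ℝ))).2 ⟨hWc, hnear⟩
      rw [hf] at this
      exact Multiset.mem_singleton.1 this
    rw [hWk, rootShift_descending]
    exact ⟨ht2, hB', hf⟩

end EdgeRegular

/-! ### Probabilities of the exceptional events -/

/-- Quantitative consequences of `RadialEdgeLaw` with common constants. -/
structure EdgeBounds (μ : Measure ℂ) (α c K ρ : ℝ) : Prop where
  isProbability : IsProbabilityMeasure μ
  c_pos : 0 < c
  K_pos : 0 < K
  rho_pos : 0 < ρ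
  alpha_gt : -1 < α
  alpha_lt : α < 0
  rotation_invariant : ∀ u : ℂ, ‖u‖ = 1 → μ.map (fun z => u * z) = μ
  supported : μ (Metric.closedBall (0 : ℂ) 1)ᶜ = 0
  tail : ∀ h : ℝ, 0 ≤ h → μ {z | 1 - h ≤ ‖z‖} ≤ ENNReal.ofReal (K * h ^ (α + 1))
  shell : ∀ u v : ℝ, 1 - ρ ≤ u → u ≤ v → μ {z | u ≤ ‖z‖ ∧ ‖z‖ ≤ v} ≤
    ENNReal.ofReal (K * (v - u) ^ (α + 1))
  lower : ∀ h : ℝ, 0 ≤ h → h ≤ ρ → ENNReal.ofReal (c * h ^ (α + 1)) ≤ μ {z | 1 - h ≤ ‖z‖}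
  edge : ∀ τ : ℝ, 0 < τ → ∫⁻ z, ENNReal.ofReal (τ / (τ + 1 - ‖z‖)) ∂μ ≤
    ENNReal.ofReal (K * τ ^ (α + 1))
  near : ∀ (x : ℂ) (t : ℝ), 0 < t → t ≤ ρ → 1 - ρ ≤ ‖x‖ →
    ∫⁻ y, nearKernel t x y ∂μ ≤ ENNReal.ofReal (K * t ^ (α + 1))

theorem RadialEdgeLaw.exists_edgeBounds {μ : Measure ℂ} {α : ℝ} (hμ : RadialEdgeLaw μ α)
    (hα' : α < 0) : ∃ c K ρ : ℝ, EdgeBounds μ α c K ρ := by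
  have := hμ.isProbability
  have hα := hμ.alpha_gt
  obtain ⟨c, C, ε, hM⟩ := hμ.exists_radialMass hα'
  obtain ⟨K₁, hK₁, htail⟩ := hM.exists_tail_le hμ.supported hα
  have hε := hM.eps_pos
  have hC := hM.C_pos
  have hr1 : (2 : ℝ) ^ α < 1 := Real.rpow_lt_one_of_one_lt_of_neg (by norm_num) (by linarith)
  have hr2 : (2 : ℝ) ^ (-(α + 1)) < 1 := Real.rpow_lt_one_of_one_lt_of_neg (by norm_num) (by linarith)
  set K₂ := 2 * K₁ / (1 - 2 ^ α) with hK₂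
  set K₃ := 72 * C / (1 - 2 ^ (-(α + 1))) with hK₃
  have hK₂0 : 0 < K₂ := div_pos (by positivity) (by linarith)
  have hK₃0 : 0 < K₃ := div_pos (by positivity) (by linarith)
  have mono : ∀ {k h : ℝ}, k ≤ K₁ + K₂ + K₃ + C → 0 ≤ h →
      ENNReal.ofReal (k * h ^ (α + 1)) ≤ ENNReal.ofReal ((K₁ + K₂ + K₃ + C) * h ^ (α + 1)) :=
    fun hk hh => ENNReal.ofReal_le_ofReal (mul_le_mul_of_nonneg_right hk (Real.rpow_nonneg hh _))
  have hρ1 : min (ε / 2) (1 / 18) ≤ ε / 2 := min_le_left _ _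
  have hρ2 : min (ε / 2) (1 / 18) ≤ 1 / 18 := min_le_right _ _
  -- Half of `ε` leaves room for a ball of radius `ρ` about a point of modulus at least `1 - ρ`; `1
  -- / 18` is the radius allowed by the small-ball bound.
  refine ⟨c, K₁ + K₂ + K₃ + C, min (ε / 2) (1 / 18), this, hM.c_pos, by positivity, by positivity, hα,
    hα', hμ.rotation_invariant, hμ.supported, fun h hh => ?_, fun u v hu huv => ?_, fun h h0 hh => ?_,
    fun τ hτ => ?_, fun x t ht ht1 hx => ?_⟩
  · exact (htail h hh).trans (mono (by linarith) hh)
  · exact (hM.upper u v (by linarith) huv).trans (mono (by linarith) (by linarith))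
  · exact (hM.lower h h0 (by linarith)).trans (measure_mono fun z hz => hz.1)
  · exact (lintegral_edge_le hK₁ htail hμ.supported hα' hτ).trans (mono (by linarith) hτ.le)
  · exact (hM.lintegral_nearKernel_le hμ.rotation_invariant hα hα' ht (by linarith) (by linarith)
      (by linarith)).trans (mono (by linarith) ht.le)

/-- The interaction kernel, restricted to pairs whose first point is close to the unit circle. -/
noncomputable def edgeKernel (τ : ℝ) (p : ℂ × ℂ) : ℝ≥0∞ :=
  {p : ℂ × ℂ | 1 - 5 * τ ≤ ‖p.1‖}.indicator (fun p => nearKernel (8 * τ) p.1 p.2) p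

theorem measurable_edgeKernel (τ : ℝ) : Measurable (edgeKernel τ) :=
  (measurable_nearKernel (8 * τ)).indicator (measurableSet_le measurable_const (by fun_prop))

/-- The total interaction of the points near the unit circle with the points nearby. -/
noncomputable def pairSum {n : ℕ} (τ : ℝ) (x : Fin n → ℂ) : ℝ≥0∞ :=
  ∑ i, ∑ j ∈ Finset.univ.erase i, edgeKernel τ (x i, x j)

/-- The kernel is infinite on the diagonal, so a finite total already forces the roots near the
circle to differ from all others; no separate almost sure argument is needed. -/
theorem pairSum_spec {n : ℕ} {τ B : ℝ} {x : Fin n → ℂ} (hB : 0 ≤ B)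
    (h : pairSum τ x ≤ ENNReal.ofReal B) (hτ : 0 < τ) {i : Fin n} (hi : 1 - 5 * τ ≤ ‖x i‖) :
    (∀ j, j ≠ i → x i ≠ x j) ∧
    ∑ j ∈ (Finset.univ.erase i).filter (fun j => ‖x i - x j‖ ≤ 8 * τ), 1 / ‖x i - x j‖ ≤ B := by
  have h1 : ∑ j ∈ Finset.univ.erase i, edgeKernel τ (x i, x j) ≤ ENNReal.ofReal B :=
    (Finset.single_le_sum (f := fun i => ∑ j ∈ Finset.univ.erase i, edgeKernel τ (x i, x j))
      (fun _ _ => zero_le) (Finset.mem_univ i)).trans h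
  have hk : ∀ j, ‖x i - x j‖ ≤ 8 * τ → edgeKernel τ (x i, x j) = ‖x i - x j‖ₑ⁻¹ := by
    intro j hj
    rw [edgeKernel, Set.indicator_of_mem (by exact hi), nearKernel, Set.indicator_of_mem (by exact hj)]
  have hne : ∀ j, j ≠ i → x i ≠ x j := by
    intro j hj hij
    have h2 := (Finset.single_le_sum (f := fun j => edgeKernel τ (x i, x j))
      (fun _ _ => zero_le) (Finset.mem_erase.2 ⟨hj, Finset.mem_univ j⟩)).trans h1
    rw [hk j (by rw [hij, sub_self, norm_zero]; positivity), hij, sub_self, enorm_zero,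
      ENNReal.inv_zero] at h2
    exact ENNReal.ofReal_ne_top (top_le_iff.1 h2)
  refine ⟨hne, ?_⟩
  rw [← ENNReal.ofReal_le_ofReal_iff hB, ENNReal.ofReal_sum_of_nonneg fun j _ => by positivity]
  refine le_trans ?_ h1
  refine le_trans (Finset.sum_le_sum fun j hj => ?_)
    (Finset.sum_le_sum_of_subset (Finset.filter_subset (fun j => ‖x i - x j‖ ≤ 8 * τ) _))
  rw [Finset.mem_filter, Finset.mem_erase] at hj
  rw [hk j hj.2, one_div, ENNReal.ofReal_inv_of_pos
    (norm_pos_iff.2 (sub_ne_zero.2 (hne j hj.1.1))), ofReal_norm]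

section Events

variable {Ω : Type*} [MeasurableSpace Ω] {P : Measure Ω} {μ : Measure ℂ}
  {α c K ρ : ℝ} {n : ℕ} {X : Fin n → Ω → ℂ}

theorem measure_lt_le_div {f : Ω → ℝ≥0∞} (hf : AEMeasurable f P) {a b : ℝ} (hb : 0 < b)
    (h : ∫⁻ ω, f ω ∂P ≤ ENNReal.ofReal a) :
    P {ω | ENNReal.ofReal b < f ω} ≤ ENNReal.ofReal (a / b) := by
  refine (measure_mono fun ω (hω : ENNReal.ofReal b < f ω) => hω.le).trans
    ((meas_ge_le_lintegral_div hf (by simpa using hb) ENNReal.ofReal_ne_top).trans ?_)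
  rw [ENNReal.ofReal_div_of_pos hb]
  gcongr

theorem aemeasurable_powerEnergy (hlaw : ∀ i, HasLaw (X i) μ P) {b : ℝ → ℝ} (hb : Measurable b) (τ : ℝ) :
    AEMeasurable (fun ω => powerEnergy b τ fun i => X i ω) P := by
  refine AEMeasurable.tsum fun k => AEMeasurable.ennreal_ofReal ?_
  refine AEMeasurable.const_mul (AEMeasurable.pow_const (AEMeasurable.norm ?_) 2) _
  refine Finset.aemeasurable_fun_sum _ fun i _ => ?_
  have hm : Measurable fun z : ℂ => (b ‖z‖ : ℂ) * z ^ (k + 1) := by fun_prop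
  exact hm.comp_aemeasurable (hlaw i).aemeasurable

theorem measure_powerEnergy_le [IsProbabilityMeasure P] (hμ : EdgeBounds μ α c K ρ) (hlaw : ∀ i, HasLaw (X i) μ P)
    (hind : Pairwise fun i j => IndepFun (X i) (X j) P) {b : ℝ → ℝ} (hb : Measurable b)
    (hb1 : ∀ r, 0 ≤ r → r ≤ 1 → |b r| ≤ 1) {τ D : ℝ} (hτ : 0 < τ) (hD : 0 < D) :
    P {ω | ENNReal.ofReal (D ^ 2 * τ) < powerEnergy b τ fun i => X i ω} ≤
      ENNReal.ofReal (n * K * τ ^ (α + 1) / (τ * D) ^ 2) := by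
  have := hμ.isProbability
  have hK := hμ.K_pos
  have h := lintegral_powerEnergy_le hlaw hind hμ.rotation_invariant hμ.supported hb hb1 hτ
  have h2 : ∫⁻ ω, powerEnergy b τ (fun i => X i ω) ∂P ≤
      ENNReal.ofReal (n * (1 / τ * (K * τ ^ (α + 1)))) := by
    refine h.trans ?_
    rw [ENNReal.ofReal_mul (by positivity), ENNReal.ofReal_mul (by positivity), ENNReal.ofReal_natCast,
      Fintype.card_fin]
    gcongr
    exact hμ.edge τ hτ
  refine (measure_lt_le_div (aemeasurable_powerEnergy hlaw hb τ) (by positivity) h2).trans (le_of_eq ?_)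
  congr 1
  field_simp

theorem measure_sum_edge_le (hμ : EdgeBounds μ α c K ρ) (hlaw : ∀ i, HasLaw (X i) μ P) {τ D : ℝ}
    (hτ : 0 < τ) (hD : 0 < D) :
    P {ω | ENNReal.ofReal D < ∑ i, ENNReal.ofReal (τ / (τ + 1 - ‖X i ω‖))} ≤
      ENNReal.ofReal (n * (K * τ ^ (α + 1)) / D) := by
  have hg : Measurable fun z : ℂ => ENNReal.ofReal (τ / (τ + 1 - ‖z‖)) := by fun_prop
  refine measure_lt_le_div ?_ hD ?_
  · exact Finset.aemeasurable_fun_sum _ fun i _ => hg.comp_aemeasurable (hlaw i).aemeasurable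
  · rw [lintegral_sum_comp hlaw hg, Fintype.card_fin, ENNReal.ofReal_mul (by positivity),
      ENNReal.ofReal_natCast]
    gcongr
    exact hμ.edge τ hτ

theorem lintegral_pair [IsProbabilityMeasure P] (hμ : IsProbabilityMeasure μ) (hlaw : ∀ i, HasLaw (X i) μ P)
    (hind : Pairwise fun i j => IndepFun (X i) (X j) P) {F : ℂ × ℂ → ℝ≥0∞} (hF : Measurable F)
    {i j : Fin n} (hij : i ≠ j) :
    ∫⁻ ω, F (X i ω, X j ω) ∂P = ∫⁻ x, ∫⁻ y, F (x, y) ∂μ ∂μ := by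
  have hm := (indepFun_iff_map_prod_eq_prod_map_map (hlaw i).aemeasurable (hlaw j).aemeasurable).1
    (hind hij)
  rw [(hlaw i).map_eq, (hlaw j).map_eq] at hm
  rw [← lintegral_prod _ hF.aemeasurable, ← hm,
    lintegral_map' hF.aemeasurable ((hlaw i).aemeasurable.prodMk (hlaw j).aemeasurable)]

/-- Markov's inequality for ordered pairs: one factor is the kernel integral, uniform in the first
point, the other the mass of the edge region containing that point. -/
theorem measure_pairSum_le [IsProbabilityMeasure P] (hμ : EdgeBounds μ α c K ρ) (hlaw : ∀ i, HasLaw (X i) μ P)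
    (hind : Pairwise fun i j => IndepFun (X i) (X j) P) {τ B : ℝ}
    (hτ : 0 < τ) (hτρ : 8 * τ ≤ ρ) (hB : 0 < B) :
    P {ω | ENNReal.ofReal B < pairSum τ fun i => X i ω} ≤
      ENNReal.ofReal (n ^ 2 * (K * (8 * τ) ^ (α + 1)) ^ 2 / B) := by
  have hprob := hμ.isProbability
  have hK := hμ.K_pos
  have hα := hμ.alpha_gt
  have hmeas : ∀ i j, AEMeasurable (fun ω => edgeKernel τ (X i ω, X j ω)) P := fun i j =>
    (measurable_edgeKernel τ).comp_aemeasurable ((hlaw i).aemeasurable.prodMk (hlaw j).aemeasurable)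
  have hpair : ∫⁻ x, ∫⁻ y, edgeKernel τ (x, y) ∂μ ∂μ ≤
      ENNReal.ofReal ((K * (8 * τ) ^ (α + 1)) ^ 2) := by
    have hms : MeasurableSet {z : ℂ | 1 - 5 * τ ≤ ‖z‖} := measurableSet_le measurable_const measurable_norm
    calc ∫⁻ x, ∫⁻ y, edgeKernel τ (x, y) ∂μ ∂μ
        ≤ ∫⁻ x, {z : ℂ | 1 - 5 * τ ≤ ‖z‖}.indicator
            (fun _ => ENNReal.ofReal (K * (8 * τ) ^ (α + 1))) x ∂μ := by
          refine lintegral_mono fun x => ?_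
          by_cases hx : 1 - 5 * τ ≤ ‖x‖
          · rw [Set.indicator_of_mem (by exact hx)]
            have e : ∀ y, edgeKernel τ (x, y) = nearKernel (8 * τ) x y := fun y => by
              rw [edgeKernel, Set.indicator_of_mem (by exact hx)]
            simp only [e]
            exact hμ.near x (8 * τ) (by positivity) hτρ (by linarith)
          · have e : ∀ y, edgeKernel τ (x, y) = 0 := fun y => by
              rw [edgeKernel, Set.indicator_of_notMem (by exact hx)]
            simp [e]
      _ = ENNReal.ofReal (K * (8 * τ) ^ (α + 1)) * μ {z : ℂ | 1 - 5 * τ ≤ ‖z‖} :=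
          lintegral_indicator_const hms _
      _ ≤ ENNReal.ofReal (K * (8 * τ) ^ (α + 1)) * ENNReal.ofReal (K * (8 * τ) ^ (α + 1)) := by
          gcongr
          refine (hμ.tail (5 * τ) (by positivity)).trans (ENNReal.ofReal_le_ofReal ?_)
          gcongr
          · linarith
          · norm_num
      _ = _ := by rw [← ENNReal.ofReal_mul (by positivity), sq]
  refine measure_lt_le_div ?_ hB ?_
  · exact Finset.aemeasurable_fun_sum _ fun i _ => Finset.aemeasurable_fun_sum _ fun j _ => hmeas i j
  · unfold pairSum
    rw [lintegral_finsetSum' _ fun i _ => Finset.aemeasurable_fun_sum _ fun j _ => hmeas i j]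
    calc _ = ∑ i : Fin n, ∑ j ∈ Finset.univ.erase i, ∫⁻ x, ∫⁻ y, edgeKernel τ (x, y) ∂μ ∂μ := by
          refine Finset.sum_congr rfl fun i _ => ?_
          rw [lintegral_finsetSum' _ fun j _ => hmeas i j]
          refine Finset.sum_congr rfl fun j hj => ?_
          exact lintegral_pair hprob hlaw hind (measurable_edgeKernel τ) (Finset.ne_of_mem_erase hj).symm
      _ ≤ ∑ i : Fin n, ∑ j : Fin n, ENNReal.ofReal ((K * (8 * τ) ^ (α + 1)) ^ 2) :=
          Finset.sum_le_sum fun i _ => (Finset.sum_le_sum fun j _ => hpair).trans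
            (Finset.sum_le_sum_of_subset (Finset.subset_univ _))
      _ = _ := by
          rw [ENNReal.ofReal_mul (p := (n : ℝ) ^ 2) (by positivity),
            ENNReal.ofReal_pow (p := (n : ℝ)) (by positivity), ENNReal.ofReal_natCast]
          simp only [Finset.sum_const, Finset.card_univ, Fintype.card_fin, nsmul_eq_mul]
          ring

/-- Chebyshev: the count has variance at most its mean `M ≥ m`, and falling below `m / 2` is a
deviation of at least `M / 2`, of probability at most `4 / M`. -/
theorem measure_card_lt_le [IsProbabilityMeasure P] (hμ : IsProbabilityMeasure μ)
    (hlaw : ∀ i, HasLaw (X i) μ P)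
    (hind : Pairwise fun i j => IndepFun (X i) (X j) P) (hn : 0 < n) {r m b : ℝ} (hm : 0 < m)
    (hbm : b ≤ m / 2) (hmass : ENNReal.ofReal (m / n) ≤ μ {z | r ≤ ‖z‖}) :
    P {ω | ((Finset.univ.filter fun i => r ≤ ‖X i ω‖).card : ℝ) < b} ≤ ENNReal.ofReal (4 / m) := by
  have hn' : (0 : ℝ) < n := by exact_mod_cast hn
  set A : Set ℂ := {z | r ≤ ‖z‖} with hA
  have hAm : MeasurableSet A := measurableSet_le measurable_const measurable_norm
  set g : ℂ → ℝ := A.indicator 1 with hg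
  have hgm : Measurable g := measurable_one.indicator hAm
  have hg2 : MemLp g 2 μ := by
    refine MemLp.of_bound hgm.aestronglyMeasurable 1 (ae_of_all _ fun z => ?_)
    by_cases hz : z ∈ A <;> simp [hg, hz]
  have hgi : ∫ z, g z ∂μ = μ.real A := integral_indicator_one hAm
  have hsum : ∀ ω, ((Finset.univ.filter fun i => r ≤ ‖X i ω‖).card : ℝ) = ∑ i, g (X i ω) := by
    intro ω
    rw [Finset.card_filter]
    push_cast
    refine Finset.sum_congr rfl fun i _ => ?_
    by_cases hz : r ≤ ‖X i ω‖ <;> simp [hg, hA, hz]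
  set M : ℝ := n * μ.real A with hM
  have hmM : m ≤ M := by
    have h1 : m / n ≤ μ.real A := by
      rwa [Measure.real, ← ENNReal.ofReal_le_iff_le_toReal (measure_ne_top μ A)]
    rw [div_le_iff₀ hn'] at h1
    linarith
  have hmean : ∫ ω, ∑ i, g (X i ω) ∂P = M := by
    rw [integral_sum_comp hlaw (hg2.integrable (by norm_num)), hgi, Fintype.card_fin]
  have hvar : variance (fun ω => ∑ i, g (X i ω)) P ≤ M := by
    rw [variance_sum_comp hlaw hind hgm hg2, Fintype.card_fin, hM]
    refine mul_le_mul_of_nonneg_left ((variance_le_expectation_sq hgm.aestronglyMeasurable).trans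
      (le_of_eq ?_)) hn'.le
    rw [← hgi]
    congr 1
    ext z
    by_cases hz : z ∈ A <;> simp [hg, hz]
  have hL : MemLp (fun ω => ∑ i, g (X i ω)) 2 P := by
    refine memLp_finsetSum _ fun i _ => ?_
    exact MemLp.comp_of_map (g := g) ((hlaw i).map_eq.symm ▸ hg2) (hlaw i).aemeasurable
  have hM0 : 0 < M := hm.trans_le hmM
  refine le_trans (measure_mono ?_) ((meas_ge_le_variance_div_sq hL (c := M / 2) (by positivity)).trans
    (ENNReal.ofReal_le_ofReal ?_))
  · intro ω hω
    have hω : ((Finset.univ.filter fun i => r ≤ ‖X i ω‖).card : ℝ) < b := hω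
    rw [hsum] at hω
    change M / 2 ≤ |∑ i, g (X i ω) - ∫ ω, ∑ i, g (X i ω) ∂P|
    rw [hmean, abs_sub_comm]
    exact le_trans (by linarith) (le_abs_self _)
  · rw [div_le_div_iff₀ (by positivity) hm]
    nlinarith

theorem measure_exists_norm_gt_le (hμ : EdgeBounds μ α c K ρ) (hlaw : ∀ i, HasLaw (X i) μ P) {u : ℝ}
    (hu : 0 ≤ u) : P {ω | ∃ i, 1 - u < ‖X i ω‖} ≤ ENNReal.ofReal (n * (K * u ^ (α + 1))) := by
  have hms : MeasurableSet {z : ℂ | 1 - u ≤ ‖z‖} := measurableSet_le measurable_const measurable_norm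
  calc P {ω | ∃ i, 1 - u < ‖X i ω‖} ≤ P (⋃ i, {ω | 1 - u ≤ ‖X i ω‖}) := by
        refine measure_mono fun ω hω => ?_
        obtain ⟨i, hi⟩ := hω
        exact Set.mem_iUnion.2 ⟨i, hi.le⟩
    _ ≤ ∑ i, P {ω | 1 - u ≤ ‖X i ω‖} := by
        rw [← tsum_fintype (L := .unconditional _)]
        exact measure_iUnion_le _
    _ ≤ ∑ _ : Fin n, ENNReal.ofReal (K * u ^ (α + 1)) := by
        refine Finset.sum_le_sum fun i _ => ?_
        rw [(hlaw i).measure_eq (p := fun z => 1 - u ≤ ‖z‖) hms]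
        exact hμ.tail u hu
    _ = _ := by
        rw [ENNReal.ofReal_mul (p := (n : ℝ)) (by positivity), ENNReal.ofReal_natCast]
        simp

/-- Given the first point, the modulus of the second lies in an interval of length `2 d`, so `shell`
applies; a union bound over ordered pairs follows. -/
theorem measure_exists_gap_le [IsProbabilityMeasure P] (hμ : EdgeBounds μ α c K ρ) (hlaw : ∀ i, HasLaw (X i) μ P)
    (hind : Pairwise fun i j => IndepFun (X i) (X j) P) {s d : ℝ} (hs : 0 ≤ s) (hd : 0 ≤ d)
    (hsd : s + d ≤ ρ) :
    P {ω | ∃ i j, i ≠ j ∧ 1 - s ≤ ‖X i ω‖ ∧ |‖X i ω‖ - ‖X j ω‖| ≤ d} ≤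
      ENNReal.ofReal (n ^ 2 * ((K * s ^ (α + 1)) * (K * (2 * d) ^ (α + 1)))) := by
  have hprob := hμ.isProbability
  have hK := hμ.K_pos
  set S : Set (ℂ × ℂ) := {p | 1 - s ≤ ‖p.1‖ ∧ |‖p.1‖ - ‖p.2‖| ≤ d} with hS
  have hSm : MeasurableSet S := by
    have h1 : MeasurableSet {p : ℂ × ℂ | 1 - s ≤ ‖p.1‖} :=
      measurableSet_le measurable_const (by fun_prop)
    have h2 : MeasurableSet {p : ℂ × ℂ | |‖p.1‖ - ‖p.2‖| ≤ d} :=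
      measurableSet_le (by fun_prop) measurable_const
    exact h1.inter h2
  have hms : MeasurableSet {z : ℂ | 1 - s ≤ ‖z‖} := measurableSet_le measurable_const measurable_norm
  have hpair : ∀ i j : Fin n, i ≠ j → P {ω | (X i ω, X j ω) ∈ S} ≤
      ENNReal.ofReal ((K * s ^ (α + 1)) * (K * (2 * d) ^ (α + 1))) := by
    intro i j hij
    have h1 : P {ω | (X i ω, X j ω) ∈ S} ≤ ∫⁻ ω, S.indicator 1 (X i ω, X j ω) ∂P := by
      have hm : NullMeasurableSet {ω | (X i ω, X j ω) ∈ S} P :=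
        ((hlaw i).aemeasurable.prodMk (hlaw j).aemeasurable).nullMeasurableSet_preimage hSm
      rw [← lintegral_indicator_one₀ hm]
      exact le_of_eq rfl
    refine h1.trans ?_
    rw [lintegral_pair hprob hlaw hind (measurable_one.indicator hSm) hij]
    calc ∫⁻ x, ∫⁻ y, S.indicator 1 (x, y) ∂μ ∂μ
        ≤ ∫⁻ x, {z : ℂ | 1 - s ≤ ‖z‖}.indicator
            (fun _ => ENNReal.ofReal (K * (2 * d) ^ (α + 1))) x ∂μ := by
          refine lintegral_mono fun x => ?_
          by_cases hx : 1 - s ≤ ‖x‖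
          · rw [Set.indicator_of_mem (by exact hx)]
            have hm2 : MeasurableSet {y : ℂ | (x, y) ∈ S} := measurable_prodMk_left hSm
            calc ∫⁻ y, S.indicator 1 (x, y) ∂μ = μ {y : ℂ | (x, y) ∈ S} := by
                  rw [← lintegral_indicator_one hm2]; rfl
              _ ≤ μ {z | ‖x‖ - d ≤ ‖z‖ ∧ ‖z‖ ≤ ‖x‖ + d} := by
                  refine measure_mono fun y hy => ?_
                  have := abs_le.1 hy.2
                  exact ⟨by linarith [this.2], by linarith [this.1]⟩
              _ ≤ _ := by
                  refine (hμ.shell _ _ (by linarith) (by linarith)).trans (le_of_eq ?_)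
                  congr 3
                  ring
          · have e : ∀ y, S.indicator (1 : ℂ × ℂ → ℝ≥0∞) (x, y) = 0 := fun y =>
              Set.indicator_of_notMem (fun h => hx h.1) _
            simp [e]
      _ = ENNReal.ofReal (K * (2 * d) ^ (α + 1)) * μ {z : ℂ | 1 - s ≤ ‖z‖} :=
          lintegral_indicator_const hms _
      _ ≤ ENNReal.ofReal (K * (2 * d) ^ (α + 1)) * ENNReal.ofReal (K * s ^ (α + 1)) := by
          gcongr
          exact hμ.tail s hs
      _ = _ := by rw [← ENNReal.ofReal_mul (by positivity), mul_comm]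
  calc P {ω | ∃ i j, i ≠ j ∧ 1 - s ≤ ‖X i ω‖ ∧ |‖X i ω‖ - ‖X j ω‖| ≤ d}
      ≤ P (⋃ i, ⋃ j, {ω | i ≠ j ∧ (X i ω, X j ω) ∈ S}) := by
        refine measure_mono fun ω hω => ?_
        obtain ⟨i, j, hij, h⟩ := hω
        exact Set.mem_iUnion.2 ⟨i, Set.mem_iUnion.2 ⟨j, hij, h⟩⟩
    _ ≤ ∑ i, P (⋃ j, {ω | i ≠ j ∧ (X i ω, X j ω) ∈ S}) := by
        rw [← tsum_fintype (L := .unconditional _)]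
        exact measure_iUnion_le _
    _ ≤ ∑ i, ∑ j, P {ω | i ≠ j ∧ (X i ω, X j ω) ∈ S} := by
        refine Finset.sum_le_sum fun i _ => ?_
        rw [← tsum_fintype (L := .unconditional _)]
        exact measure_iUnion_le _
    _ ≤ ∑ _ : Fin n, ∑ _ : Fin n, ENNReal.ofReal ((K * s ^ (α + 1)) * (K * (2 * d) ^ (α + 1))) := by
        refine Finset.sum_le_sum fun i _ => Finset.sum_le_sum fun j _ => ?_
        by_cases hij : i = j
        · simp [hij]
        · exact (measure_mono fun ω hω => hω.2).trans (hpair i j hij)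
    _ = _ := by
        rw [ENNReal.ofReal_mul (p := (n : ℝ) ^ 2) (by positivity),
          ENNReal.ofReal_pow (p := (n : ℝ)) (by positivity), ENNReal.ofReal_natCast]
        simp only [Finset.sum_const, Finset.card_univ, Fintype.card_fin, nsmul_eq_mul]
        ring

end Events

theorem measure_not_edgeRegular_le {Ω : Type*} [MeasurableSpace Ω] {P : Measure Ω}
    [IsProbabilityMeasure P] {μ : Measure ℂ} {α c K ρ : ℝ} {n : ℕ} {X : Fin n → Ω → ℂ}
    (hμ : EdgeBounds μ α c K ρ) (hlaw : ∀ i, HasLaw (X i) μ P)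
    (hind : Pairwise fun i j => IndepFun (X i) (X j) P) {τ ε₁ ε₃ : ℝ} (hτ : 0 < τ) (hτ1 : τ ≤ ε₁)
    (hε₁ : ε₁ ≤ 1 / 1000) (hε₃ : 0 < ε₃) (hε₃₁ : ε₃ ≤ ε₁) (hnτ : 10 ≤ n * τ) (hτρ : 8 * τ ≤ ρ) :
    P {ω | ¬ EdgeRegular (fun i => X i ω) τ ε₁ ε₃} ≤
      ENNReal.ofReal (n * K * τ ^ (α + 1) / (τ * (ε₁ * n / 3)) ^ 2) +
      ENNReal.ofReal (n * K * τ ^ (α + 1) / (τ * (ε₁ * n / 3)) ^ 2) +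
      ENNReal.ofReal (n * (K * τ ^ (α + 1)) / (ε₁ * n / 3)) +
      ENNReal.ofReal (n ^ 2 * (K * (8 * τ) ^ (α + 1)) ^ 2 / (ε₃ * n)) := by
  have hn : (0 : ℝ) < n := by
    by_contra h
    have : (n : ℝ) * τ ≤ 0 := mul_nonpos_of_nonpos_of_nonneg (not_lt.1 h) hτ.le
    linarith
  have hε : 0 < ε₁ := hτ.trans_le hτ1
  -- The Poisson sum is bounded by the sum of the weights plus `2 D`; with the weights at most `D`
  -- this is `ε₁ n`.
  set D := ε₁ * n / 3 with hD
  have hD0 : 0 < D := by positivity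
  have hPW : Measurable (poissonWeight τ) := by unfold poissonWeight; fun_prop
  have hPWle : ∀ r, 0 ≤ r → r ≤ 1 → 0 ≤ poissonWeight τ r ∧ poissonWeight τ r ≤ τ / (τ + 1 - r) := by
    intro r h0 h1
    have h2 : τ + 1 - r ≤ (1 + τ) ^ 2 - r ^ 2 := by nlinarith
    have h3 : 0 < τ + 1 - r := by linarith
    exact ⟨div_nonneg hτ.le (by linarith), div_le_div_of_nonneg_left hτ.le h3 h2⟩
  have hPW1 : ∀ r, 0 ≤ r → r ≤ 1 → |poissonWeight τ r| ≤ 1 := by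
    intro r h0 h1
    obtain ⟨h2, h3⟩ := hPWle r h0 h1
    rw [abs_of_nonneg h2]
    exact h3.trans ((div_le_one (by linarith)).2 (by linarith))
  have hsupp : P {ω | ∃ i, 1 < ‖X i ω‖} = 0 := by
    have hae : ∀ i, ∀ᵐ ω ∂P, ‖X i ω‖ ≤ 1 := fun i => by
      have hae : ∀ᵐ z ∂μ, ‖z‖ ≤ 1 := by
        rw [ae_iff]; convert hμ.supported using 2; ext z; simp
      rw [← (hlaw i).map_eq] at hae
      exact ae_of_ae_map (hlaw i).aemeasurable hae
    have := ae_all_iff.2 hae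
    rw [ae_iff] at this
    convert this using 2
    ext ω; simp
  have h1 := measure_powerEnergy_le hμ hlaw hind (b := fun _ => 1) measurable_const
    (fun r _ _ => by simp) hτ hD0
  have h2 := measure_powerEnergy_le hμ hlaw hind hPW hPW1 hτ hD0
  have h3 := measure_sum_edge_le hμ hlaw hτ hD0
  have h4 := measure_pairSum_le hμ hlaw hind hτ hτρ (B := ε₃ * n) (by positivity)
  refine le_trans ?_ (add_le_add (add_le_add (add_le_add h1 h2) h3) h4)
  -- The zero added is the probability that some root lies outside the disk, the fifth event of the
  -- union.
  rw [← add_zero (P {ω | ENNReal.ofReal (ε₃ * n) < _}), ← hsupp]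
  rw [← add_assoc]
  refine le_trans (measure_mono ?_) ((measure_union_le _ _).trans (add_le_add
    ((measure_union_le _ _).trans (add_le_add ((measure_union_le _ _).trans (add_le_add
      (measure_union_le _ _) le_rfl)) le_rfl)) le_rfl))
  intro ω hω
  by_contra hc
  simp only [Set.mem_union, Set.mem_ofPred_eq, not_or, not_lt, not_exists] at hc
  obtain ⟨⟨⟨⟨hc1, hc2⟩, hc3⟩, hc4⟩, hc5⟩ := hc
  refine hω ⟨hτ, hτ1, hε₁, hε₃₁, hnτ, hc5, fun z hz => ?_, fun z hz => ?_, fun i j hi hj => ?_,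
    fun i hi => ?_⟩
  · have := norm_sum_inv_sub_le hτ hc5 hD0 hc1 hz
    rw [Fintype.card_fin] at this
    linarith
  · have h5 := sum_div_norm_sq_le hτ hc5 hD0 hc2 hz
    have h6 : ∑ j, poissonWeight τ ‖X j ω‖ ≤ D := by
      refine (Finset.sum_le_sum fun j _ => (hPWle _ (norm_nonneg _) (hc5 j)).2).trans ?_
      rw [← ENNReal.ofReal_le_ofReal_iff hD0.le, ENNReal.ofReal_sum_of_nonneg]
      · exact hc3
      · exact fun j _ => div_nonneg hτ.le (by linarith [hc5 j])
    linarith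
  · exact (pairSum_spec (by positivity) hc4 hτ hi).1 j hj
  · exact (pairSum_spec (by positivity) hc4 hτ hi).2

/-! ### Asymptotics of the parameters -/

theorem eventually_mul_pow_mul_rpow_lt_one {ℓ : ℕ → ℕ}
    (hℓ : ∀ᶠ n : ℕ in atTop, (ℓ n : ℝ) < Real.sqrt (Real.log n)) (A : ℝ) (m : ℕ) {κ : ℝ} (hκ : κ < 0) :
    ∀ᶠ n : ℕ in atTop, A * (ℓ n : ℝ) ^ m * (n : ℝ) ^ κ < 1 := by
  -- With this exponent, `m` logarithmic factors use up at most half of the decay `n ^ κ`.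
  have hκ' : 0 < -κ / (2 * (m + 1)) := by have : 0 < -κ := by linarith
                                          positivity
  have h1 : ∀ᶠ n : ℕ in atTop, ‖Real.log (n : ℝ)‖ ≤ 1 * ‖(n : ℝ) ^ (-κ / (2 * (m + 1)))‖ :=
    tendsto_natCast_atTop_atTop.eventually ((isLittleO_log_rpow_atTop hκ').bound one_pos)
  have h2 : Tendsto (fun n : ℕ => |A| * (n : ℝ) ^ (κ / 2)) atTop (𝓝 (|A| * 0)) := by
    have := (tendsto_rpow_neg_atTop (y := -κ / 2) (by linarith)).comp (tendsto_natCast_atTop_atTop (R := ℝ))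
    refine Tendsto.const_mul _ (this.congr fun n => ?_)
    rw [Function.comp_apply]
    congr 1
    ring
  rw [mul_zero] at h2
  have h3 : ∀ᶠ n : ℕ in atTop, 1 ≤ Real.log (n : ℝ) :=
    (Real.tendsto_log_atTop.comp tendsto_natCast_atTop_atTop).eventually_ge_atTop 1
  filter_upwards [hℓ, h1, h2.eventually_lt_const one_pos, h3, eventually_ge_atTop 1]
    with n hn1 hn2 hn3 hn4 hn5
  have hN : (0 : ℝ) < n := by exact_mod_cast hn5
  have hN1 : (1 : ℝ) ≤ n := by exact_mod_cast hn5
  have h5 : (ℓ n : ℝ) ≤ (n : ℝ) ^ (-κ / (2 * (m + 1))) := by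
    rw [one_mul, Real.norm_of_nonneg (by linarith), Real.norm_of_nonneg (by positivity)] at hn2
    refine hn1.le.trans (le_trans ?_ hn2)
    rw [Real.sqrt_le_left (by linarith)]
    nlinarith
  refine lt_of_le_of_lt ?_ hn3
  calc A * (ℓ n : ℝ) ^ m * (n : ℝ) ^ κ
      ≤ |A| * ((n : ℝ) ^ (-κ / (2 * (m + 1)))) ^ m * (n : ℝ) ^ κ := by
        gcongr
        exact le_abs_self A
    _ = |A| * (n : ℝ) ^ (-κ / (2 * (m + 1)) * m + κ) := by
        rw [← Real.rpow_natCast, ← Real.rpow_mul hN.le, mul_assoc, ← Real.rpow_add hN]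
    _ ≤ |A| * (n : ℝ) ^ (κ / 2) := by
        refine mul_le_mul_of_nonneg_left (Real.rpow_le_rpow_of_exponent_le hN1 ?_) (abs_nonneg A)
        have : -κ / (2 * (m + 1)) * m ≤ -κ / 2 := by
          rw [div_mul_eq_mul_div, div_le_div_iff₀ (by positivity) two_pos]
          nlinarith
        linarith

theorem energy_term {N α K : ℝ} (hN : 0 < N) :
    N * K * (N ^ (-(2 / 3) : ℝ)) ^ (α + 1) /
      (N ^ (-(2 / 3) : ℝ) * (N ^ (-(1 / 6 + α / 2)) * N / 3)) ^ 2 = 9 * K * N ^ (α / 3) := by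
  -- Writing `N = exp L` turns the power identity into a linear identity between exponents.
  obtain ⟨L, rfl⟩ : ∃ L, N = Real.exp L := ⟨Real.log N, (Real.exp_log hN).symm⟩
  simp only [← Real.exp_mul]
  rw [div_eq_iff (by positivity)]
  have h : Real.exp L * Real.exp (L * -(2 / 3) * (α + 1)) =
      Real.exp (L * (α / 3)) * Real.exp (L * -(2 / 3)) * Real.exp (L * -(2 / 3)) *
      Real.exp (L * -(1 / 6 + α / 2)) * Real.exp (L * -(1 / 6 + α / 2)) * Real.exp L * Real.exp L := by
    simp only [← Real.exp_add]
    congr 1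
    ring
  linear_combination K * h

theorem edge_term {N α K : ℝ} (hN : 0 < N) :
    N * (K * (N ^ (-(2 / 3) : ℝ)) ^ (α + 1)) / (N ^ (-(1 / 6 + α / 2)) * N / 3) =
      3 * K * N ^ (-(1 / 2 + α / 6)) := by
  obtain ⟨L, rfl⟩ : ∃ L, N = Real.exp L := ⟨Real.log N, (Real.exp_log hN).symm⟩
  simp only [← Real.exp_mul]
  rw [div_eq_iff (by positivity)]
  have h : Real.exp L * Real.exp (L * -(2 / 3) * (α + 1)) =
      Real.exp (L * -(1 / 2 + α / 6)) * Real.exp (L * -(1 / 6 + α / 2)) * Real.exp L := by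
    simp only [← Real.exp_add]
    congr 1
    ring
  linear_combination K * h

/-- The power of `N` decays exactly when `α > -1/10`. -/
theorem pair_term {N α K : ℝ} (hN : 0 < N) (hα : α ≤ 0) :
    N ^ 2 * (K * (8 * N ^ (-(2 / 3) : ℝ)) ^ (α + 1)) ^ 2 / (N ^ (-(1 / 4 + α / 2)) * N) ≤
      64 * K ^ 2 * N ^ (-(1 / 12 + 5 * α / 6)) := by
  have h8 : (8 : ℝ) ^ (α + 1) ≤ 8 := by
    calc (8 : ℝ) ^ (α + 1) ≤ 8 ^ (1 : ℝ) :=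
          Real.rpow_le_rpow_of_exponent_le (by norm_num) (by linarith)
      _ = 8 := Real.rpow_one 8
  rw [Real.mul_rpow (by norm_num) (by positivity)]
  obtain ⟨L, rfl⟩ : ∃ L, N = Real.exp L := ⟨Real.log N, (Real.exp_log hN).symm⟩
  simp only [← Real.exp_mul]
  rw [div_le_iff₀ (by positivity)]
  have h : Real.exp L * Real.exp L * Real.exp (L * -(2 / 3) * (α + 1)) *
      Real.exp (L * -(2 / 3) * (α + 1)) =
      Real.exp (L * -(1 / 12 + 5 * α / 6)) * Real.exp (L * -(1 / 4 + α / 2)) * Real.exp L := by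
    simp only [← Real.exp_add]
    congr 1
    ring
  calc Real.exp L ^ 2 * (K * (8 ^ (α + 1) * Real.exp (L * -(2 / 3) * (α + 1)))) ^ 2
      = K ^ 2 * (8 ^ (α + 1)) ^ 2 * (Real.exp L * Real.exp L * Real.exp (L * -(2 / 3) * (α + 1)) *
        Real.exp (L * -(2 / 3) * (α + 1))) := by ring
    _ ≤ K ^ 2 * 8 ^ 2 * (Real.exp L * Real.exp L * Real.exp (L * -(2 / 3) * (α + 1)) *
        Real.exp (L * -(2 / 3) * (α + 1))) := by gcongr
    _ = _ := by rw [h]; ring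

/-- Factoring out the target rate leaves three powers whose exponents are negative for `-1/2 < α <
0`, so their sum eventually lies below `ℓ`. -/
theorem shift_term {N α : ℝ} (hN : 0 < N) (hα : α + 1 ≠ 0) :
    48 * (3 * (N ^ (-(1 / 6 + α / 2)) * N) / N ^ (-(2 / 3) : ℝ) +
      (N ^ (-(1 / 4 + α / 2)) * N) ^ 2) / N ^ 3 + 2 / N ^ 2 =
    (144 * N ^ (α * (1 - α) / (2 * (α + 1))) + 48 * N ^ (-(α ^ 2 / (α + 1))) +
      2 * N ^ (α / (α + 1) - 1 / 2)) * N ^ (-((5 * α + 3) / (2 * (α + 1)))) := by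
  obtain ⟨L, rfl⟩ : ∃ L, N = Real.exp L := ⟨Real.log N, (Real.exp_log hN).symm⟩
  simp only [← Real.exp_mul]
  have h1 : Real.exp (L * -(1 / 6 + α / 2)) * Real.exp L / Real.exp (L * -(2 / 3)) / Real.exp L ^ 3 =
      Real.exp (L * (α * (1 - α) / (2 * (α + 1)))) * Real.exp (L * -((5 * α + 3) / (2 * (α + 1)))) := by
    rw [← Real.exp_nat_mul]
    simp only [← Real.exp_add, ← Real.exp_sub]
    congr 1
    push_cast
    field_simp
    ring
  have h2 : (Real.exp (L * -(1 / 4 + α / 2)) * Real.exp L) ^ 2 / Real.exp L ^ 3 =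
      Real.exp (L * -(α ^ 2 / (α + 1))) * Real.exp (L * -((5 * α + 3) / (2 * (α + 1)))) := by
    rw [← Real.exp_nat_mul L, ← Real.exp_add, ← Real.exp_nat_mul]
    simp only [← Real.exp_add, ← Real.exp_sub]
    congr 1
    push_cast
    field_simp
    ring
  have h3 : 1 / Real.exp L ^ 2 =
      Real.exp (L * (α / (α + 1) - 1 / 2)) * Real.exp (L * -((5 * α + 3) / (2 * (α + 1)))) := by
    rw [← Real.exp_nat_mul L, one_div, ← Real.exp_neg, ← Real.exp_add]
    congr 1
    push_cast
    field_simp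
    ring
  rw [add_mul, add_mul, mul_assoc 144, mul_assoc 48, mul_assoc 2, ← h1, ← h2, ← h3]
  ring

theorem rpow_inv_le_pow_mul {L : ℕ} {N p : ℝ} (hN : 0 < N) (hp : 1 / 2 ≤ p) (hp1 : 0 < p) {k : ℕ}
    (hL : 1 ≤ L) : ((L : ℝ) ^ k / N) ^ (1 / p) ≤ (L : ℝ) ^ (2 * k) * N ^ (-(1 / p)) := by
  have hL' : (1 : ℝ) ≤ L := by exact_mod_cast hL
  rw [Real.div_rpow (by positivity) hN.le, Real.rpow_neg hN.le, div_eq_mul_inv]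
  gcongr
  calc ((L : ℝ) ^ k) ^ (1 / p) ≤ ((L : ℝ) ^ k) ^ (2 : ℝ) := by
        refine Real.rpow_le_rpow_of_exponent_le (one_le_pow₀ hL') ?_
        rw [div_le_iff₀ hp1]; linarith
    _ = _ := by rw [Real.rpow_two, ← pow_mul, mul_comm]

/-! ### Choice of parameters and conclusion -/

set_option maxHeartbeats 1000000 in
theorem eventually_measure_not_pairingHolds_le {Ω : Type*} [MeasurableSpace Ω] {P : Measure Ω}
    [IsProbabilityMeasure P] {μ : Measure ℂ} {α c K ρ : ℝ} (hμ : EdgeBounds μ α c K ρ)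
    (hα : -0.095 < α) {X : ℕ → Ω → ℂ} (hlaw : ∀ i, HasLaw (X i) μ P)
    (hind : Pairwise fun i j => IndepFun (X i) (X j) P) {ℓ : ℕ → ℕ} (hℓ : Tendsto ℓ atTop atTop)
    (hℓ' : ∀ᶠ n : ℕ in atTop, (ℓ n : ℝ) < Real.sqrt (Real.log n)) {δ : ℝ} (hδ' : δ < -α) :
    ∀ᶠ n : ℕ in atTop, P {ω | ¬ PairingHolds (fun i : Fin n => X i ω) (ℓ n) ((n : ℝ) ^ δ)
      (1 * ℓ n * (n : ℝ) ^ (-((5 * α + 3) / (2 * (α + 1)))))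
      (1 * (1 / ((ℓ n : ℝ) ^ 4 * n)) ^ (1 / (α + 1)))
      (((ℓ n : ℝ) ^ 2 / n) ^ (1 / (α + 1))) ((1 / ((n : ℝ) * ℓ n)) ^ (1 / (α + 1)))
      (30 * (n : ℝ) ^ (-(1 / 6 + α / 2)) / n)} ≤
      ENNReal.ofReal ((5 + K + 4 / c + 16 * K ^ 2) / ℓ n) := by
  have hα0 := hμ.alpha_lt
  have hc := hμ.c_pos
  have hK := hμ.K_pos
  have hρ := hμ.rho_pos
  norm_num at hα
  have hp : 0 < α + 1 := by linarith
  have hp1 : α + 1 ≤ 1 := by linarith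
  have hp2 : 1 / 2 ≤ α + 1 := by linarith
  have hip : 1 ≤ 1 / (α + 1) := by rw [le_div_iff₀ hp]; linarith
  have hnp : -(1 / (α + 1)) + 1 < 0 := by
    rw [neg_add_lt_iff_lt_add, add_zero, lt_div_iff₀ hp]; linarith
  -- This is the scale condition `ε₁ / n ≪ t`: the pairing error must be smaller than the resolution
  -- of the ordered moduli.
  have hkey : -(1 / 6 + α / 2) + -1 + 1 / (α + 1) < 0 := by
    have : 1 / (α + 1) < 1 + (1 / 6 + α / 2) := by
      rw [div_lt_iff₀ hp]; nlinarith
    linarith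
  have asy := fun A m κ hκ => eventually_mul_pow_mul_rpow_lt_one hℓ' A m (κ := κ) hκ
  filter_upwards [eventually_ge_atTop 1, hℓ.eventually_ge_atTop 4,
    (tendsto_natCast_atTop_atTop.comp hℓ).eventually_ge_atTop (2 / c),
    asy 1000 0 (-(1 / 6 + α / 2)) (by linarith), asy 10 0 (-(1 / 3)) (by norm_num),
    asy (8 / ρ) 0 (-(2 / 3)) (by norm_num), asy (9 * K) 1 (α / 3) (by linarith),
    asy (3 * K) 1 (-(1 / 2 + α / 6)) (by linarith),
    asy (64 * K ^ 2) 1 (-(1 / 12 + 5 * α / 6)) (by linarith), asy (2 / c) 0 (α + δ) (by linarith),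
    asy (4 / c) 1 α hα0, asy 2 1 (-(1 / 3)) (by norm_num),
    asy 15 8 (-(1 / 6 + α / 2) + -1 + 1 / (α + 1)) hkey, asy 1 4 (-(1 / (α + 1)) + 1) hnp,
    asy 144 0 (α * (1 - α) / (2 * (α + 1)))
      (div_neg_of_neg_of_pos (mul_neg_of_neg_of_pos hα0 (by linarith)) (by linarith)),
    asy 48 0 (-(α ^ 2 / (α + 1))) (by rw [neg_lt_zero]; exact div_pos (by nlinarith) hp),
    asy 2 0 (α / (α + 1) - 1 / 2) (by linarith [div_neg_of_neg_of_pos hα0 hp]),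
    asy (9 / ρ) 0 (-1) (by norm_num)]
    with n hn1 hL4 hLc a1 a2 a3 a4 a5 a6 a7 a8 a9 a10 a11 a12 a13 a14 a15
  simp only [pow_zero, pow_one, mul_one] at a1 a2 a3 a4 a5 a6 a7 a8 a9 a12 a13 a14 a15
  rw [Function.comp_apply] at hLc
  set N : ℝ := (n : ℝ) with hNdef
  set L : ℝ := (ℓ n : ℝ) with hLdef
  have hN : 0 < N := by rw [hNdef]; exact_mod_cast hn1
  have hN1 : 1 ≤ N := by rw [hNdef]; exact_mod_cast hn1
  have hL : 4 ≤ L := by rw [hLdef]; exact_mod_cast hL4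
  have hL0 : 0 < L := by linarith
  set τ := N ^ (-(2 / 3) : ℝ) with hτ
  set ε₁ := N ^ (-(1 / 6 + α / 2)) with hε₁
  set ε₃ := N ^ (-(1 / 4 + α / 2)) with hε₃
  have hτ0 : 0 < τ := by positivity
  have hε₁0 : 0 < ε₁ := by positivity
  have hε₃0 : 0 < ε₃ := by positivity
  have hτε : τ ≤ ε₁ := Real.rpow_le_rpow_of_exponent_le hN1 (by linarith)
  have hεε : ε₃ ≤ ε₁ := Real.rpow_le_rpow_of_exponent_le hN1 (by linarith)
  have hε1000 : ε₁ ≤ 1 / 1000 := by linarith only [a1]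
  have hNτ : N * τ * N ^ (-(1 / 3) : ℝ) = 1 := by
    rw [hτ]
    nth_rewrite 1 [← Real.rpow_one N]
    rw [← Real.rpow_add hN, ← Real.rpow_add hN]
    norm_num
  have hq0 : 0 < N ^ (-(1 / 3) : ℝ) := by positivity
  have h10 : 10 ≤ N * τ := by
    have h : 10 * N ^ (-(1 / 3) : ℝ) ≤ N * τ * N ^ (-(1 / 3) : ℝ) := by linarith only [a2, hNτ]
    exact le_of_mul_le_mul_right h hq0
  have h8τ : 8 * τ ≤ ρ := by
    rw [div_mul_eq_mul_div, div_lt_one hρ] at a3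
    exact a3.le
  have hLτ : L / N ≤ τ / 2 := by
    rw [div_le_div_iff₀ hN two_pos]
    have h : (L * 2) * N ^ (-(1 / 3) : ℝ) ≤ (τ * N) * N ^ (-(1 / 3) : ℝ) := by
      rw [mul_comm τ, hNτ]; linarith only [a9]
    exact le_of_mul_le_mul_right h hq0
  have h9ρ : 9 / N ≤ ρ := by
    rw [Real.rpow_neg_one, div_mul_eq_mul_div, div_lt_one hρ] at a15
    rw [div_eq_mul_inv]; exact a15.le
  set s := (L ^ 2 / N) ^ (1 / (α + 1)) with hs
  set u := (1 / (N * L)) ^ (1 / (α + 1)) with hu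
  set t := 1 * (1 / (L ^ 4 * N)) ^ (1 / (α + 1)) with ht
  have hs0 : 0 ≤ s := by positivity
  have hu0 : 0 ≤ u := by positivity
  have ht0 : 0 ≤ t := by positivity
  have hinv : ∀ y : ℝ, 0 ≤ y → (y ^ (1 / (α + 1))) ^ (α + 1) = y := fun y hy => by
    rw [← Real.rpow_mul hy, one_div_mul_cancel hp.ne', Real.rpow_one]
  have hsp : s ^ (α + 1) = L ^ 2 / N := hinv _ (by positivity)
  have hup : u ^ (α + 1) = 1 / (N * L) := hinv _ (by positivity)
  have htp : t ^ (α + 1) = 1 / (L ^ 4 * N) := by rw [ht, one_mul]; exact hinv _ (by positivity)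
  have hsN : s ≤ 1 / N := by
    have h1 := rpow_inv_le_pow_mul (L := ℓ n) (k := 2) hN hp2 hp (by omega)
    rw [← hLdef] at h1
    refine h1.trans ?_
    rw [le_div_iff₀ hN]
    have e : N ^ (-(1 / (α + 1)) + 1) = N ^ (-(1 / (α + 1))) * N := by
      rw [Real.rpow_add hN, Real.rpow_one]
    rw [e] at a11
    calc L ^ (2 * 2) * N ^ (-(1 / (α + 1))) * N = 1 * L ^ 4 * (N ^ (-(1 / (α + 1))) * N) := by ring
      _ ≤ 1 := a11.le
  have htN : t ≤ 1 / N := by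
    rw [ht, one_mul]
    have hL41 : 1 ≤ L ^ 4 := one_le_pow₀ (by linarith)
    have h1 : 1 / (L ^ 4 * N) ≤ 1 / N := by
      refine one_div_le_one_div_of_le hN ?_
      nlinarith only [hL41, hN]
    calc (1 / (L ^ 4 * N)) ^ (1 / (α + 1)) ≤ (1 / N) ^ (1 / (α + 1)) :=
          Real.rpow_le_rpow (by positivity) h1 (by linarith)
      _ ≤ (1 / N) ^ (1 : ℝ) := Real.rpow_le_rpow_of_exponent_ge (by positivity)
          ((div_le_one hN).2 hN1) hip
      _ = _ := Real.rpow_one _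
  have hεt : 15 * ε₁ / N < t := by
    have hL1 : 1 ≤ L := by linarith
    have h1 : (L ^ 4 * N) ^ (1 / (α + 1)) ≤ L ^ 8 * N ^ (1 / (α + 1)) := by
      rw [Real.mul_rpow (by positivity) hN.le]
      gcongr
      calc (L ^ 4) ^ (1 / (α + 1)) ≤ (L ^ 4) ^ (2 : ℝ) := by
            refine Real.rpow_le_rpow_of_exponent_le (one_le_pow₀ hL1) ?_
            rw [div_le_iff₀ hp]; linarith
        _ = L ^ 8 := by rw [Real.rpow_two, ← pow_mul]
    have h2 : 0 < (L ^ 4 * N) ^ (1 / (α + 1)) := by positivity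
    rw [ht, one_mul, one_div (L ^ 4 * N), Real.inv_rpow (by positivity), ← one_div, lt_div_iff₀ h2]
    refine lt_of_le_of_lt ?_ a10
    rw [Real.rpow_add hN, Real.rpow_add hN, Real.rpow_neg_one, ← hε₁]
    calc 15 * ε₁ / N * (L ^ 4 * N) ^ (1 / (α + 1)) ≤ 15 * ε₁ / N * (L ^ 8 * N ^ (1 / (α + 1))) := by
          gcongr
      _ = _ := by ring
  have hB : 48 * (3 * (ε₁ * N) / τ + (ε₃ * N) ^ 2) / N ^ 3 + 2 / N ^ 2 <
      1 * L * N ^ (-((5 * α + 3) / (2 * (α + 1)))) := by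
    rw [shift_term hN hp.ne', one_mul]
    refine mul_lt_mul_of_pos_right ?_ (by positivity)
    linarith only [a12, a13, a14, hL]
  have h1N : 1 / N ≤ ρ := le_trans (by gcongr; norm_num) h9ρ
  have hlaw' : ∀ i : Fin n, HasLaw (X i) μ P := fun i => hlaw i
  have hind' : Pairwise fun i j : Fin n => IndepFun (X i) (X j) P := fun i j hij =>
    hind (fun h => hij (Fin.ext h))
  have b1 := measure_not_edgeRegular_le hμ hlaw' hind' hτ0 hτε hε1000 hε₃0 hεε h10 h8τ
  rw [← hNdef, energy_term hN, edge_term hN] at b1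
  -- The expected number of roots beyond `1 - 1/n` is at least `c n ^ (-α)`, which outgrows `n ^ δ`
  -- since `δ < -α`.
  have b2 : P {ω | ((Finset.univ.filter fun i : Fin n => 1 - 1 / N ≤ ‖X i ω‖).card : ℝ) < N ^ δ} ≤
      ENNReal.ofReal (4 / (c * N ^ (-α))) := by
    refine measure_card_lt_le hμ.isProbability hlaw' hind' (by omega) (by positivity) ?_ ?_
    · rw [div_mul_eq_mul_div, div_lt_one hc] at a7
      have e : N ^ δ = N ^ (α + δ) * N ^ (-α) := by rw [← Real.rpow_add hN]; congr 1; ring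
      rw [e]
      have : 0 < N ^ (-α) := by positivity
      nlinarith only [this, a7]
    · refine le_trans (le_of_eq ?_) (hμ.lower (1 / N) (by positivity) h1N)
      congr 1
      rw [← hNdef, one_div, Real.inv_rpow hN.le, Real.rpow_add hN, Real.rpow_one, Real.rpow_neg hN.le]
      field_simp
  have b3 := measure_exists_norm_gt_le hμ hlaw' hu0
  -- The width `s` is chosen so that at least `c ℓ ^ 2` roots are expected beyond `1 - s`; `ℓ ≥ 2 /
  -- c` puts `ℓ` below half of that.
  have b4 : P {ω | ((Finset.univ.filter fun i : Fin n => 1 - s ≤ ‖X i ω‖).card : ℝ) < L} ≤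
      ENNReal.ofReal (4 / (c * L ^ 2)) := by
    refine measure_card_lt_le hμ.isProbability hlaw' hind' (by omega) (by positivity) ?_ ?_
    · rw [div_le_iff₀ hc] at hLc
      nlinarith only [hLc, hL0]
    · refine le_trans (le_of_eq ?_) (hμ.lower s hs0 (hsN.trans h1N))
      rw [hsp, ← hNdef, mul_div_assoc]
  have b5 := measure_exists_gap_le hμ hlaw' hind' (s := s) (d := 8 * t) hs0 (by positivity) (by
    have e : 9 / N = 9 * (1 / N) := by ring
    linarith only [e, hsN, htN, h9ρ])
  have hsub : {ω | ¬ PairingHolds (fun i : Fin n => X i ω) (ℓ n) (N ^ δ)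
      (1 * L * N ^ (-((5 * α + 3) / (2 * (α + 1))))) t s u (30 * ε₁ / N)} ⊆
      ((({ω | ¬ EdgeRegular (fun i : Fin n => X i ω) τ ε₁ ε₃} ∪
        {ω | ((Finset.univ.filter fun i : Fin n => 1 - 1 / N ≤ ‖X i ω‖).card : ℝ) < N ^ δ}) ∪
        {ω | ∃ i : Fin n, 1 - u < ‖X i ω‖}) ∪
        {ω | ((Finset.univ.filter fun i : Fin n => 1 - s ≤ ‖X i ω‖).card : ℝ) < L}) ∪
        {ω | ∃ i j : Fin n, i ≠ j ∧ 1 - s ≤ ‖X i ω‖ ∧ |‖X i ω‖ - ‖X j ω‖| ≤ 8 * t} := by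
    intro ω hω
    by_contra hcon
    simp only [Set.mem_union, Set.mem_ofPred_eq, not_or, not_not, not_lt, not_exists, not_and,
      not_le] at hcon
    obtain ⟨⟨⟨⟨g1, g2⟩, g3⟩, g4⟩, g5⟩ := hcon
    refine hω (g1.pairing hε₃0.le hL4 hLτ hεt htN ?_ le_rfl hB g2 g3 ?_ fun i j hij hi => g5 i j hij hi)
    · have e : 3 / N = 3 * (1 / N) := by ring
      have e4 : 4 * (1 / N) ≤ L / N := by rw [mul_one_div]; gcongr
      change s + 3 / N ≤ L / N
      linarith only [e, e4, hsN]
    · exact (Nat.cast_le (α := ℝ)).1 g4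
  refine (measure_mono hsub).trans ((measure_union_le _ _).trans ((add_le_add
    ((measure_union_le _ _).trans (add_le_add ((measure_union_le _ _).trans (add_le_add
      ((measure_union_le _ _).trans (add_le_add b1 b2)) b3)) b4)) b5).trans ?_))
  rw [hup, hsp, ← hNdef]
  have hX1 : 0 < N ^ (α / 3) := by positivity
  rw [← ENNReal.ofReal_add (by positivity) (by positivity),
    ← ENNReal.ofReal_add (by positivity) (by positivity),
    ← ENNReal.ofReal_add (by positivity) (by positivity),
    ← ENNReal.ofReal_add (by positivity) (by positivity),
    ← ENNReal.ofReal_add (by positivity) (by positivity),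
    ← ENNReal.ofReal_add (by positivity) (by positivity),
    ← ENNReal.ofReal_add (by positivity) (by positivity)]
  refine ENNReal.ofReal_le_ofReal ?_
  have t1 : 9 * K * N ^ (α / 3) ≤ 1 / L := by rw [le_div_iff₀ hL0]; linarith only [a4]
  have t2 : 3 * K * N ^ (-(1 / 2 + α / 6)) ≤ 1 / L := by rw [le_div_iff₀ hL0]; linarith only [a5]
  have t3 : N ^ 2 * (K * (8 * τ) ^ (α + 1)) ^ 2 / (ε₃ * N) ≤ 1 / L := by
    have h := pair_term (K := K) hN hα0.le
    rw [← hτ, ← hε₃] at h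
    refine h.trans ?_
    rw [le_div_iff₀ hL0]; linarith only [a6]
  have t4 : 4 / (c * N ^ (-α)) ≤ 1 / L := by
    rw [Real.rpow_neg hN.le, le_div_iff₀ hL0]
    have : 4 / (c * (N ^ α)⁻¹) = 4 / c * N ^ α := by field_simp
    rw [this]; linarith only [a8]
  have t5 : N * (K * (1 / (N * L))) = K / L := by field_simp
  have t6 : 4 / (c * L ^ 2) ≤ 4 / c / L := by
    rw [div_div, sq]
    gcongr
    exact le_mul_of_one_le_right hL0.le (by linarith only [hL])
  have t7 : N ^ 2 * (K * (L ^ 2 / N) * (K * (2 * (8 * t)) ^ (α + 1))) ≤ 16 * K ^ 2 / L := by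
    have h16 : (16 : ℝ) ^ (α + 1) ≤ 16 := by
      calc (16 : ℝ) ^ (α + 1) ≤ 16 ^ (1 : ℝ) :=
            Real.rpow_le_rpow_of_exponent_le (by norm_num) hp1
        _ = 16 := Real.rpow_one 16
    rw [show 2 * (8 * t) = 16 * t by ring, Real.mul_rpow (by norm_num) ht0, htp]
    calc N ^ 2 * (K * (L ^ 2 / N) * (K * (16 ^ (α + 1) * (1 / (L ^ 4 * N)))))
        ≤ N ^ 2 * (K * (L ^ 2 / N) * (K * (16 * (1 / (L ^ 4 * N))))) := by gcongr
      _ = 16 * K ^ 2 / L ^ 2 := by field_simp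
      _ ≤ 16 * K ^ 2 / L := by
        gcongr
        nlinarith only [hL]
  have hsum : (5 + K + 4 / c + 16 * K ^ 2) / L =
      5 * (1 / L) + K / L + 4 / c / L + 16 * K ^ 2 / L := by ring
  rw [hsum, t5]
  linarith only [t1, t2, t3, t4, t6, t7]

theorem theorem2p5 {Ω : Type*} [MeasurableSpace Ω] (P : Measure Ω) [IsProbabilityMeasure P]
    (μ : Measure ℂ) (α : ℝ) (hμ : RadialEdgeLaw μ α)
    (hα : -0.095 < α) (hα' : α < 0)
    (X : ℕ → Ω → ℂ) (hlaw : ∀ i, HasLaw (X i) μ P) (hindep : iIndepFun X P)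
    (ℓ : ℕ → ℕ) (hℓ : Tendsto ℓ atTop atTop)
    (hℓ' : ∀ᶠ n : ℕ in atTop, (ℓ n : ℝ) < Real.sqrt (Real.log n))
    (δ : ℝ) (hδ : 0 < δ) (hδ' : δ < -α) :
    ∃ C : ℝ, 0 < C ∧ ∃ K : ℝ, 0 < K ∧
    ∃ η : ℕ → ℝ, (η =o[atTop] fun n : ℕ => 1 / (n : ℝ)) ∧
    ∃ G : ℕ → Set Ω, ∀ᶠ n : ℕ in atTop,
      MeasurableSet (G n) ∧ 1 - K / (ℓ n : ℝ) ≤ P.real (G n) ∧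
      ∀ ω ∈ G n, ∀ x : Fin n → ℂ, (∀ i, x i = X i ω) →
        -- (i) many distinct critical points in the annulus
        ((n : ℝ) ^ δ ≤
          ({w : ℂ | w ∈ critPts x ∧ w ∈ edgeAnnulus (ℓ n / n)}.ncard : ℝ)) ∧
        -- (ii) from roots to critical points; exactly one critical point, counting multiplicity
        (∀ i : Fin n, x i ∈ edgeAnnulus (ℓ n / n) →
          ∃ w : ℂ, (critPts x).filter (fun v => ‖v - x i‖ ≤ 3 / (n : ℝ)) = {w} ∧
            ‖w - x i + rootShift x i‖ <
              C * ℓ n * (n : ℝ) ^ (-((5 * α + 3) / (2 * (α + 1)))) ∧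
            ‖w - x i * (1 - 1 / (n : ℂ))‖ <
              C * (1 / ((ℓ n : ℝ) ^ 4 * n)) ^ (1 / (α + 1))) ∧
        -- (iii) from critical points to roots
        (∃ ι : {w : ℂ // w ∈ critPts x ∧ w ∈ edgeAnnulus (ℓ n / n)} → Fin n,
          Function.Injective ι ∧
          ∀ w, x (ι w) ∈ edgeAnnulus (ℓ n / n) ∧
            (∃ e : ℂ, ‖e‖ ≤ η n ∧ (w : ℂ) = x (ι w) * (1 - 1 / (n : ℂ) + e)) ∧
            ‖(w : ℂ) - x (ι w) * (1 - 1 / (n : ℂ))‖ <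
              C * (1 / ((ℓ n : ℝ) ^ 4 * n)) ^ (1 / (α + 1)) ∧
            (∀ j : Fin n, x j ∈ edgeAnnulus (ℓ n / n) →
              ‖(w : ℂ) - x j * (1 - 1 / (n : ℂ))‖ <
                C * (1 / ((ℓ n : ℝ) ^ 4 * n)) ^ (1 / (α + 1)) → j = ι w)) ∧
        -- (iv) the largest roots and the largest critical points
        (∀ i : Fin n, (i : ℕ) < ℓ n →
          1 - ((ℓ n : ℝ) ^ 2 / n) ^ (1 / (α + 1)) ≤ ‖descending x i‖ ∧
          ‖descending x i‖ ≤ 1 - (1 / ((n : ℝ) * ℓ n)) ^ (1 / (α + 1))) ∧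
        (∀ W : Fin (n - 1) → ℂ, IsCritListing x W →
          ∀ (k : Fin (n - 1)) (i : Fin n), (k : ℕ) = i → (i : ℕ) < ℓ n →
            ‖W k - descending x i * (1 - 1 / (n : ℂ))‖ <
              C * (1 / ((ℓ n : ℝ) ^ 4 * n)) ^ (1 / (α + 1)) ∧
            ‖W k - descending x i + rootShift (descending x) i‖ <
              C * ℓ n * (n : ℝ) ^ (-((5 * α + 3) / (2 * (α + 1)))) ∧
            (critPts x).filter (fun v => ‖v - descending x i‖ ≤ 3 / (n : ℝ)) = {W k}) := by
  obtain ⟨c, K, ρ, hE⟩ := hμ.exists_edgeBounds hα'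
  have hc := hE.c_pos
  have hK := hE.K_pos
  have hev := eventually_measure_not_pairingHolds_le hE hα hlaw
    (fun i j hij => hindep.indepFun hij) hℓ hℓ' hδ'
  -- The good event is the complement of a measurable hull of the failure event, so measurability of
  -- `PairingHolds` need not be shown.
  refine ⟨1, one_pos, 5 + K + 4 / c + 16 * K ^ 2, by positivity,
    fun n => 30 * (n : ℝ) ^ (-(1 / 6 + α / 2)) / n, ?_, fun n => (toMeasurable P
      {ω | ¬ PairingHolds (fun i : Fin n => X i ω) (ℓ n) ((n : ℝ) ^ δ)
        (1 * ℓ n * (n : ℝ) ^ (-((5 * α + 3) / (2 * (α + 1)))))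
        (1 * (1 / ((ℓ n : ℝ) ^ 4 * n)) ^ (1 / (α + 1)))
        (((ℓ n : ℝ) ^ 2 / n) ^ (1 / (α + 1))) ((1 / ((n : ℝ) * ℓ n)) ^ (1 / (α + 1)))
        (30 * (n : ℝ) ^ (-(1 / 6 + α / 2)) / n)})ᶜ, ?_⟩
  · norm_num at hα
    have h1 : Tendsto (fun n : ℕ => 30 * (n : ℝ) ^ (-(1 / 6 + α / 2))) atTop (𝓝 (30 * 0)) :=
      ((tendsto_rpow_neg_atTop (by linarith)).comp
        (tendsto_natCast_atTop_atTop (R := ℝ))).const_mul 30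
    rw [mul_zero] at h1
    have h2 := ((isLittleO_one_iff ℝ).2 h1).mul_isBigO (isBigO_refl (fun n : ℕ => 1 / (n : ℝ)) atTop)
    refine (h2.congr_left fun n => ?_).congr_right fun n => ?_
    · rw [mul_one_div]
    · rw [one_mul]
  · filter_upwards [hev] with n hn
    refine ⟨(measurableSet_toMeasurable _ _).compl, ?_, fun ω hω x hx => ?_⟩
    · rw [probReal_compl_eq_one_sub (measurableSet_toMeasurable _ _), Measure.real,
        measure_toMeasurable]
      refine sub_le_sub_left (ENNReal.toReal_le_of_le_ofReal (by positivity) hn) 1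
    · have hgood := not_not.1 fun h => hω (subset_toMeasurable _ _ h)
      rw [show x = fun i : Fin n => X i ω from funext hx]
      exact hgood
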